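/- **Conventions.** Let $A$ be a ring with unit. An $A$-coring $\mathfrak C$ is an $A$-bimodule with coassociative comultiplication $\Delta:\mathfrak C\to\mathfrak C\otimes_A\mathfrak C$ and counit $\varepsilon:\mathfrak C\to A$, both $A$-bimodule maps. $\mathcal M^{\mathfrak C}$ is the category of right $\mathfrak C$-comodules and right $A$-linear colinear maps, and $\mathrm{End}^{\mathfrak C}(\Sigma)$ is the endomorphism ring of $\Sigma$ in it. Other rings $R$ need not have a unit; $R$ has *left local units* if for every finite subset $F\subset R$ there is $e\in R$ with $er=r$ for all $r\in F$. A right $R$-module $M$ is *firm* if the multiplication map $M\otimes_RR\to M$ is bijective, a left $R$-module $M$ if $R\otimes_RM\to M$ is bijective; $\mathcal M_R$ is the category of firm right $R$-modules, a full subcategory of the category of all (non-unital) right $R$-modules. A left $R$-module $F$ is *flat* if $-\otimes_RF$ is exact on all right $R$-modules, and *faithfully flat* if moreover $-\otimes_RF:\mathcal M_R\to\mathrm{Ab}$ reflects exact sequences (exactness of a sequence in $\mathcal M_R$ being taken in the category $\mathcal M_R$). In a Grothendieck category, an object $E$ is *finitely generated* if, whenever $E$ is the sum of a nonempty directed family of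 subobjects, it is a member of the family. An object $X$ is *weakly locally projective* if for every monomorphism $i:E\to X$ with $E$ finitely generated, every epimorphism $g:M\to N$ and every $f:X\to N$ there is $h:X\to M$ with $g\circ h\circ i=f\circ i$. For a right $A$-module $\Sigma$ put $\Sigma^*=\mathrm{Hom}_A(\Sigma,A)$; $\Sigma\otimes_A\Sigma^*$ is a ring with product $(x\otimes\xi)(y\otimes\eta)=x\,\xi(y)\otimes\eta$, acting on $\Sigma$ by $(x\otimes\xi)\cdot y=x\,\xi(y)$. Let $\Sigma$ be a right $\mathfrak C$-comodule. A ring morphism $\iota:R\to\mathrm{End}^{\mathfrak C}(\Sigma)$ makes $\Sigma$ a left $R$-module. We say that $\Sigma$ is *weakly $R$-locally projective over $A$* if this action is induced by a ring morphism $\kappa:R\to\Sigma\otimes_A\Sigma^*$ such that for every $x\in\Sigma$ there is $r\in R$ with $\kappa(r)\cdot x=x$. The canonical map is $\mathrm{can}:\Sigma^*\otimes_R\Sigma\to\mathfrak C$, $\mathrm{can}(\xi\otimes x)=\xi(x_{[0]})x_{[1]}$, where $R$ acts on $\Sigma^*$ by $(\xi r)(x)=\xi(rx)$. **Theorem.**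 Let $\mathfrak C$ be an $A$-coring that is weakly locally projective as a left $A$-module (so that $\mathcal M^{\mathfrak C}$ is a Grothendieck category), and let $\Sigma$ be a right $\mathfrak C$-comodule. The following are equivalent: 1. $\Sigma$ is weakly locally projective in $\mathcal M^{\mathfrak C}$ and a generator of $\mathcal M^{\mathfrak C}$; 2. there are a ring $R$ with left local units and a ring morphism $\iota:R\to\mathrm{End}^{\mathfrak C}(\Sigma)$ such that $\Sigma$ is firm as a left $R$-module and the functor $-\otimes_R\Sigma:\mathcal M_R\to\mathcal M^{\mathfrak C}$ is an equivalence of categories; 3. there are a ring $R$ with left local units and a ring morphism $\iota:R\to\mathrm{End}^{\mathfrak C}(\Sigma)$ such that $\Sigma$ is weakly $R$-locally projective over $A$, $\mathrm{can}:\Sigma^*\otimes_R\Sigma\to\mathfrak C$ is bijective, and $\Sigma$ is faithfully flat as a left $R$-module. Moreover, if these conditions hold, then $R$ and $\iota$ can be chosen such that $\iota$ is injective with image a two-sided ideal of $\mathrm{End}^{\mathfrak C}(\Sigma)$ and such that all the properties in 2 and 3 hold for this same $R$. -/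

import Mathlib

open CategoryTheory MulOpposite
open scoped TensorProduct

universe u

namespace Galois

/-! ### Tensor products over a (possibly noncommutative, possibly non-unital) ring -/

section BalTensor

variable {S M N P M' N' : Type*} [AddCommGroup M] [AddCommGroup N] [AddCommGroup P]
  [AddCommGroup M'] [AddCommGroup N']

/-- The balanced tensor product `M ⊗_S N`: the quotient of `M ⊗_ℤ N` by the subgroup generated by
all `m s ⊗ n - m ⊗ s n`, where `m s = ρ s m` is a right action and `s n = l s n` a left action. -/
def BalTensor (ρ : S → M →+ M) (l : S → N →+ N) : Type _ :=
  (M ⊗[ℤ] N) ⧸ Submodule.span ℤ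
    {z : M ⊗[ℤ] N | ∃ s m n, z = ρ s m ⊗ₜ[ℤ] n - m ⊗ₜ[ℤ] l s n}

namespace BalTensor

instance (ρ : S → M →+ M) (l : S → N →+ N) : AddCommGroup (BalTensor ρ l) :=
  inferInstanceAs (AddCommGroup (_ ⧸ Submodule.span ℤ
    {z : M ⊗[ℤ] N | ∃ s m n, z = ρ s m ⊗ₜ[ℤ] n - m ⊗ₜ[ℤ] l s n}))

/-- The pure tensors `m ⊗_S n`. -/
def tmul (ρ : S → M →+ M) (l : S → N →+ N) : M →+ N →+ BalTensor ρ l :=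
  AddMonoidHom.mk' (fun m => AddMonoidHom.mk'
      (fun n => (Submodule.Quotient.mk (m ⊗ₜ[ℤ] n) : _ ⧸ Submodule.span ℤ _))
      (fun a b => by rw [TensorProduct.tmul_add, Submodule.Quotient.mk_add]; rfl))
    (fun a b => by
      ext n
      change Submodule.Quotient.mk _ = _
      rw [TensorProduct.add_tmul, Submodule.Quotient.mk_add]; rfl)

variable {ρ : S → M →+ M} {l : S → N →+ N} {ρ' : S → M' →+ M'} {l' : S → N' →+ N'}

theorem tmul_balanced (s : S) (m : M) (n : N) : tmul ρ l (ρ s m) n = tmul ρ l m (l s n) :=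
  (Submodule.Quotient.eq _).2 (Submodule.subset_span ⟨s, m, n, rfl⟩)

@[elab_as_elim]
theorem induction {p : BalTensor ρ l → Prop} (z : BalTensor ρ l)
    (zero : p 0) (pure : ∀ m n, p (tmul ρ l m n))
    (add : ∀ x y, p x → p y → p (x + y)) : p z := by
  obtain ⟨z, rfl⟩ := Submodule.Quotient.mk_surjective _ z
  induction z with
  | zero => exact zero
  | tmul m n => exact pure m n
  | add x y hx hy => exact add _ _ hx hy

@[ext]
theorem hom_ext {f g : BalTensor ρ l →+ P}
    (h : ∀ m n, f (tmul ρ l m n) = g (tmul ρ l m n)) : f = g := by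
  ext z
  induction z using induction with
  | zero => simp
  | pure m n => exact h m n
  | add x y hx hy => simp [hx, hy]

/-- The universal property: a balanced biadditive map factors through `M ⊗_S N`. -/
def lift (f : M →+ N →+ P) (h : ∀ s m n, f (ρ s m) n = f m (l s n)) : BalTensor ρ l →+ P :=
  (Submodule.liftQ (Submodule.span ℤ {z : M ⊗[ℤ] N | ∃ s m n, z = ρ s m ⊗ₜ[ℤ] n - m ⊗ₜ[ℤ] l s n})
    (TensorProduct.liftAddHom f (fun k m n => by simp)).toIntLinearMap (by
      rw [Submodule.span_le]
      rintro _ ⟨s, m, n, rfl⟩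
      simp [h])).toAddMonoidHom

@[simp]
theorem lift_tmul (f : M →+ N →+ P) (h : ∀ s m n, f (ρ s m) n = f m (l s n)) (m : M) (n : N) :
    lift f h (tmul ρ l m n) = f m n := rfl

/-- The additive map `f ⊗_S g`, for `f` and `g` commuting with the actions of `S`. -/
def map (f : M →+ M') (g : N →+ N') (hf : ∀ s m, f (ρ s m) = ρ' s (f m))
    (hg : ∀ s n, g (l s n) = l' s (g n)) : BalTensor ρ l →+ BalTensor ρ' l' :=
  lift (((tmul ρ' l').comp f).compr₂ (AddMonoidHom.id _) |>.compl₂ g)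
    (fun s m n => by simp [hf, hg, tmul_balanced])

@[simp]
theorem map_tmul (f : M →+ M') (g : N →+ N') (hf : ∀ s m, f (ρ s m) = ρ' s (f m))
    (hg : ∀ s n, g (l s n) = l' s (g n)) (m : M) (n : N) :
    map f g hf hg (tmul ρ l m n) = tmul ρ' l' (f m) (g n) := rfl

/-- If `B` acts on `N` by maps commuting with `S`, then `M ⊗_S N` is a `B`-module through `N`. -/
abbrev moduleOfRight (B : Type*) [Semiring B] [Module B N]
    (h : ∀ s (b : B) n, l s (b • n) = b • l s n) : Module B (BalTensor ρ l) where
  smul b := map (ρ' := ρ) (AddMonoidHom.id M) (DistribSMul.toAddMonoidHom N b) (fun _ _ => rfl)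
    (fun s n => (h s b n).symm)
  one_smul z := by
    change map _ _ _ _ z = z
    induction z using induction with
    | zero => exact map_zero _
    | pure m n => exact congrArg (tmul ρ l m) (one_smul B n)
    | add x y hx hy => rw [map_add, hx, hy]
  mul_smul b c z := by
    change map _ _ _ _ z = map _ _ _ _ (map _ _ _ _ z)
    induction z using induction with
    | zero => exact (map_zero _).trans (((congrArg _ (map_zero _)).trans (map_zero _)).symm)
    | pure m n => exact congrArg (tmul ρ l m) (mul_smul b c n)
    | add x y hx hy => rw [map_add, hx, hy, map_add, map_add]
  smul_zero b := map_zero _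
  smul_add b x y := map_add _ x y
  add_smul b c z := by
    change map _ _ _ _ z = map _ _ _ _ z + map _ _ _ _ z
    induction z using induction with
    | zero => exact (map_zero _).trans ((congrArg₂ (· + ·) (map_zero _) (map_zero _)).trans (add_zero 0)).symm
    | pure m n => exact (congrArg (tmul ρ l m) (add_smul b c n)).trans (map_add _ _ _)
    | add x y hx hy => rw [map_add, hx, hy, map_add, map_add]; abel
  zero_smul z := by
    change map _ _ _ _ z = 0
    induction z using induction with
    | zero => exact map_zero _
    | pure m n => exact (congrArg (tmul ρ l m) (zero_smul B n)).trans (map_zero _)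
    | add x y hx hy => rw [map_add, hx, hy, add_zero]

end BalTensor

end BalTensor

/-! ### Tensor products over the unital base ring `A`

Left `A`-modules are `Module A`, right `A`-modules are `Module Aᵐᵒᵖ`. -/

section ATensor

/-- The right action `m ↦ m a`. -/
abbrev rAct (A M : Type*) [Ring A] [AddCommGroup M] [Module Aᵐᵒᵖ M] (a : A) : M →+ M :=
  DistribSMul.toAddMonoidHom M (op a)

/-- The left action `n ↦ a n`. -/
abbrev lAct (A N : Type*) [Ring A] [AddCommGroup N] [Module A N] (a : A) : N →+ N :=
  DistribSMul.toAddMonoidHom N a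

variable (A : Type*) [Ring A]

/-- `M ⊗_A N` for a right `A`-module `M` and a left `A`-module `N`. -/
def ATensor (M N : Type*) [AddCommGroup M] [Module Aᵐᵒᵖ M] [AddCommGroup N] [Module A N] : Type _ :=
  BalTensor (rAct A M) (lAct A N)

variable {M N P M' N' : Type*} [AddCommGroup M] [Module Aᵐᵒᵖ M] [AddCommGroup N] [Module A N]
  [AddCommGroup M'] [Module Aᵐᵒᵖ M'] [AddCommGroup N'] [Module A N'] [AddCommGroup P]

namespace ATensor

instance : AddCommGroup (ATensor A M N) :=
  inferInstanceAs (AddCommGroup (BalTensor (rAct A M) (lAct A N)))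

/-- If `N` is an `A`-bimodule, then `M ⊗_A N` is a right `A`-module through `N`. -/
instance [Module Aᵐᵒᵖ N] [SMulCommClass A Aᵐᵒᵖ N] : Module Aᵐᵒᵖ (ATensor A M N) :=
  BalTensor.moduleOfRight (ρ := rAct A M) (l := lAct A N) Aᵐᵒᵖ (fun a b n => smul_comm a b n)

/-- The pure tensors `m ⊗_A n`. -/
def tmul : M →+ N →+ ATensor A M N := BalTensor.tmul (rAct A M) (lAct A N)

theorem tmul_balanced (a : A) (m : M) (n : N) : tmul A (op a • m) n = tmul A m (a • n) :=
  BalTensor.tmul_balanced (ρ := rAct A M) (l := lAct A N) a m n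

theorem op_smul_tmul [Module Aᵐᵒᵖ N] [SMulCommClass A Aᵐᵒᵖ N] (b : Aᵐᵒᵖ) (m : M) (n : N) :
    b • tmul A m n = tmul A m (b • n) := rfl

variable {A}

@[elab_as_elim]
theorem induction {p : ATensor A M N → Prop} (z : ATensor A M N)
    (zero : p 0) (pure : ∀ m n, p (tmul A m n))
    (add : ∀ x y, p x → p y → p (x + y)) : p z :=
  BalTensor.induction (ρ := rAct A M) (l := lAct A N) z zero pure add

@[ext]
theorem hom_ext {f g : ATensor A M N →+ P}
    (h : ∀ m n, f (tmul A m n) = g (tmul A m n)) : f = g :=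
  BalTensor.hom_ext (ρ := rAct A M) (l := lAct A N) h

/-- The universal property of `M ⊗_A N`. -/
def lift (f : M →+ N →+ P) (h : ∀ (a : A) m n, f (op a • m) n = f m (a • n)) : ATensor A M N →+ P :=
  BalTensor.lift (ρ := rAct A M) (l := lAct A N) f h

@[simp]
theorem lift_tmul (f : M →+ N →+ P) (h : ∀ (a : A) m n, f (op a • m) n = f m (a • n))
    (m : M) (n : N) : lift f h (tmul A m n) = f m n := rfl

/-- `f ⊗_A g` for a right `A`-linear map `f` and a left `A`-linear map `g`. -/
def map (f : M →ₗ[Aᵐᵒᵖ] M') (g : N →ₗ[A] N') : ATensor A M N →+ ATensor A M' N' :=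
  BalTensor.map (ρ := rAct A M) (l := lAct A N) (ρ' := rAct A M') (l' := lAct A N')
    f.toAddMonoidHom g.toAddMonoidHom (fun _ _ => f.map_smul _ _) (fun _ _ => g.map_smul _ _)

@[simp]
theorem map_tmul (f : M →ₗ[Aᵐᵒᵖ] M') (g : N →ₗ[A] N') (m : M) (n : N) :
    map f g (tmul A m n) = tmul A (f m) (g n) := rfl

/-- `f ⊗_A N` as a right `A`-linear map, for an `A`-bimodule `N`. -/
def rmap [Module Aᵐᵒᵖ N] [SMulCommClass A Aᵐᵒᵖ N] (f : M →ₗ[Aᵐᵒᵖ] M') :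
    ATensor A M N →ₗ[Aᵐᵒᵖ] ATensor A M' N where
  toFun := map f LinearMap.id
  map_add' := map_add _
  map_smul' b z := by
    induction z using induction with
    | zero => simp
    | pure m n => simp [op_smul_tmul]
    | add x y hx hy => rw [smul_add, map_add, hx, hy, map_add, smul_add]

@[simp]
theorem rmap_tmul [Module Aᵐᵒᵖ N] [SMulCommClass A Aᵐᵒᵖ N] (f : M →ₗ[Aᵐᵒᵖ] M') (m : M) (n : N) :
    rmap f (tmul A m n) = tmul A (f m) n := rfl

theorem rmap_id [Module Aᵐᵒᵖ N] [SMulCommClass A Aᵐᵒᵖ N] (z : ATensor A M N) :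
    rmap (LinearMap.id : M →ₗ[Aᵐᵒᵖ] M) z = z := by
  induction z using induction with
  | zero => simp
  | pure m n => simp
  | add x y hx hy => rw [map_add, hx, hy]

theorem rmap_comp {M'' : Type*} [AddCommGroup M''] [Module Aᵐᵒᵖ M'']
    [Module Aᵐᵒᵖ N] [SMulCommClass A Aᵐᵒᵖ N] (f : M →ₗ[Aᵐᵒᵖ] M')
    (g : M' →ₗ[Aᵐᵒᵖ] M'') (z : ATensor A M N) :
    rmap (g.comp f) z = rmap g (rmap f z) := by
  induction z using induction with
  | zero => simp
  | pure m n => simp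
  | add x y hx hy => simp only [map_add, hx, hy]

/-- If `M` is an `A`-bimodule, then `M ⊗_A N` is a left `A`-module through `M`. -/
instance [Module A M] [SMulCommClass A Aᵐᵒᵖ M] : Module A (ATensor A M N) where
  smul a := map
    { toFun := fun m : M => a • m
      map_add' := smul_add a
      map_smul' := fun b m => smul_comm a b m } LinearMap.id
  one_smul z := by
    change map _ _ z = z
    induction z using induction with
    | zero => simp
    | pure m n => simp
    | add x y hx hy => rw [map_add, hx, hy]
  mul_smul b c z := by
    change map _ _ z = map _ _ (map _ _ z)
    induction z using induction with
    | zero => simp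
    | pure m n => simp [mul_smul]
    | add x y hx hy => rw [map_add, hx, hy, map_add, map_add]
  smul_zero b := map_zero _
  smul_add b x y := map_add _ x y
  add_smul b c z := by
    change map _ _ z = map _ _ z + map _ _ z
    induction z using induction with
    | zero => simp
    | pure m n => simp [add_smul]
    | add x y hx hy => rw [map_add, hx, hy, map_add, map_add]; abel
  zero_smul z := by
    change map _ _ z = 0
    induction z using induction with
    | zero => simp
    | pure m n => simp
    | add x y hx hy => rw [map_add, hx, hy, add_zero]

theorem smul_tmul [Module A M] [SMulCommClass A Aᵐᵒᵖ M] (a : A) (m : M) (n : N) :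
    a • tmul A m n = tmul A (a • m) n := rfl

/-- The map `n' ↦ m ⊗ (n ⊗ n')`, biadditive in `m` and `n`. -/
def assocAux [Module Aᵐᵒᵖ N] [SMulCommClass A Aᵐᵒᵖ N] (m : M) : N →+ N' →+ ATensor A M (ATensor A N N') where
  toFun n := (tmul A m).comp (tmul A n)
  map_zero' := by ext n'; simp
  map_add' n₁ n₂ := by ext n'; simp

/-- The map `m ⊗ n ↦ (n' ↦ m ⊗ (n ⊗ n'))`. -/
def assocHom [Module Aᵐᵒᵖ N] [SMulCommClass A Aᵐᵒᵖ N] :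
    ATensor A M N →+ N' →+ ATensor A M (ATensor A N N') :=
  lift (AddMonoidHom.mk' assocAux (fun a b => by ext n n'; simp [assocAux]))
    (fun a m n => by
      ext n'
      exact tmul_balanced A a m (tmul A n n'))

/-- The associativity map `(M ⊗_A N) ⊗_A N' → M ⊗_A (N ⊗_A N')` for an `A`-bimodule `N`. -/
def assoc [Module Aᵐᵒᵖ N] [SMulCommClass A Aᵐᵒᵖ N] :
    ATensor A (ATensor A M N) N' →+ ATensor A M (ATensor A N N') :=
  lift assocHom (fun a z n' => by
    induction z using induction with
    | zero => rw [smul_zero, map_zero]; rfl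
    | pure m n => exact congrArg (tmul A m) (tmul_balanced A a n n')
    | add x y hx hy => rw [smul_add, map_add, map_add, AddMonoidHom.add_apply,
        AddMonoidHom.add_apply, hx, hy])

@[simp]
theorem assoc_tmul [Module Aᵐᵒᵖ N] [SMulCommClass A Aᵐᵒᵖ N] (m : M) (n : N) (n' : N') :
    assoc (tmul A (tmul A m n) n') = tmul A m (tmul A n n') := rfl

/-- The isomorphism `M ⊗_A A → M`, `m ⊗ a ↦ m a`. -/
def rid : ATensor A M A →+ M :=
  lift (AddMonoidHom.mk' (fun m => AddMonoidHom.mk' (fun a => op a • m)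
      (fun a b => by rw [MulOpposite.op_add, add_smul])) (fun a b => by ext; simp))
    (fun a m b => by simp [mul_smul])

@[simp]
theorem rid_tmul (m : M) (a : A) : rid (tmul A m a) = op a • m := rfl

/-- The isomorphism `A ⊗_A N → N`, `a ⊗ n ↦ a n`. -/
def lid : ATensor A A N →+ N :=
  lift (AddMonoidHom.mk' (fun a => AddMonoidHom.mk' (fun n => a • n)
      (fun x y => smul_add a x y)) (fun a b => by ext; simp [add_smul]))
    (fun a m b => by simp [mul_smul])

@[simp]
theorem lid_tmul (a : A) (n : N) : lid (tmul A a n) = a • n := rfl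

end ATensor

end ATensor

/-! ### Corings and comodules -/

/-- An `A`-coring: an `A`-bimodule `C` with coassociative comultiplication `Δ : C → C ⊗_A C` and
counit `ε : C → A`, both of them `A`-bimodule maps. -/
class Coring (A C : Type*) [Ring A] [AddCommGroup C] [Module A C] [Module Aᵐᵒᵖ C]
    [SMulCommClass A Aᵐᵒᵖ C] where
  /-- the comultiplication, as a left `A`-linear map -/
  comul : C →ₗ[A] ATensor A C C
  comul_op_smul : ∀ (b : Aᵐᵒᵖ) (c : C), comul (b • c) = b • comul c
  /-- the counit, as a left `A`-linear map -/
  counit : C →ₗ[A] A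
  counit_op_smul : ∀ (b : Aᵐᵒᵖ) (c : C), counit (b • c) = b • counit c
  coassoc : ∀ c : C,
    ATensor.assoc (ATensor.map (⟨comul.toAddHom, comul_op_smul⟩ : C →ₗ[Aᵐᵒᵖ] ATensor A C C)
      LinearMap.id (comul c)) = ATensor.map LinearMap.id comul (comul c)
  counit_left : ∀ c : C,
    ATensor.lid (ATensor.map (⟨counit.toAddHom, counit_op_smul⟩ : C →ₗ[Aᵐᵒᵖ] A)
      LinearMap.id (comul c)) = c
  counit_right : ∀ c : C, ATensor.rid (ATensor.map LinearMap.id counit (comul c)) = c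

section Comodules

variable (A C : Type u) [Ring A] [AddCommGroup C] [Module A C] [Module Aᵐᵒᵖ C]
  [SMulCommClass A Aᵐᵒᵖ C] [Coring A C]

/-- A right `C`-comodule: a right `A`-module `M` with a right `A`-linear, coassociative and counital
coaction `M → M ⊗_A C`. -/
structure Comod where
  carrier : Type u
  [addCommGroup : AddCommGroup carrier]
  [module : Module Aᵐᵒᵖ carrier]
  coact : carrier →ₗ[Aᵐᵒᵖ] ATensor A carrier C
  coassoc : ∀ m, ATensor.assoc (ATensor.rmap coact (coact m)) =
    ATensor.map LinearMap.id (Coring.comul (A := A) (C := C)) (coact m)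
  counit : ∀ m,
    ATensor.rid (ATensor.map LinearMap.id (Coring.counit (A := A) (C := C)) (coact m)) = m

variable {A C}

namespace Comod

instance : CoeSort (Comod A C) (Type u) := ⟨carrier⟩

attribute [instance] Comod.addCommGroup Comod.module

/-- Colinearity of a right `A`-linear map `f`: `ρ_N ∘ f = (f ⊗_A C) ∘ ρ_M`. -/
def IsColinear {M N : Comod A C} (f : M →ₗ[Aᵐᵒᵖ] N) : Prop :=
  ∀ m, N.coact (f m) = ATensor.rmap f (M.coact m)

/-- Morphisms of right `C`-comodules: right `A`-linear colinear maps. -/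
@[ext]
structure Hom (M N : Comod A C) where
  lin : M →ₗ[Aᵐᵒᵖ] N
  colinear : IsColinear lin

/-- The category `M^C` of right `C`-comodules. -/
instance : Category (Comod A C) where
  Hom := Hom
  id M := ⟨LinearMap.id, fun m => (ATensor.rmap_id _).symm⟩
  comp f g := ⟨g.lin.comp f.lin, fun m => by
    rw [ATensor.rmap_comp, ← f.colinear, ← g.colinear]; rfl⟩

/-- The endomorphism ring `End^C(M)`, with composition of maps as product. -/
def endRing (M : Comod A C) : Subring (Module.End Aᵐᵒᵖ M) where
  carrier := {f | IsColinear f}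
  one_mem' := fun m => (ATensor.rmap_id _).symm
  mul_mem' := fun {f g} hf hg m => by
    have h := ATensor.rmap_comp g f (M.coact m)
    rw [← hg, ← hf] at h
    exact h.symm
  zero_mem' := fun m => by
    change M.coact 0 = _
    rw [map_zero]
    generalize M.coact m = z
    induction z using ATensor.induction with
    | zero => simp
    | pure m n => simp
    | add x y hx hy => rw [map_add, ← hx, ← hy, add_zero]
  add_mem' := fun {f g} hf hg m => by
    change M.coact (f m + g m) = _
    rw [map_add, hf, hg]
    generalize M.coact m = z
    induction z using ATensor.induction with
    | zero => simp
    | pure m n => simp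
    | add x y hx hy => rw [map_add, map_add, map_add, ← hx, ← hy]; abel
  neg_mem' := fun {f} hf m => by
    change M.coact (-(f m)) = _
    rw [map_neg, hf]
    generalize M.coact m = z
    induction z using ATensor.induction with
    | zero => simp
    | pure m n => simp
    | add x y hx hy => rw [map_add, map_add, ← hx, ← hy]; abel

end Comod

end Comodules

/-! ### Finitely generated and weakly locally projective objects -/

section Categories

variable {𝒞 : Type*} [Category 𝒞]

/-- `X` is finitely generated: whenever `X` is the sum (least upper bound) of a nonempty directed
family of subobjects, it is a member of the family. -/
def IsFinGen (X : 𝒞) : Prop :=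
  ∀ F : Set (Subobject X), F.Nonempty → DirectedOn (· ≤ ·) F → IsLUB F ⊤ → ⊤ ∈ F

/-- `X` is weakly locally projective: for a monomorphism `i : E ⟶ X` with `E` finitely generated,
an epimorphism `g : M ⟶ N` and `f : X ⟶ N`, there is `h : X ⟶ M` such that `g ∘ h ∘ i = f ∘ i`. -/
def WeaklyLocallyProjective (X : 𝒞) : Prop :=
  ∀ ⦃E M N : 𝒞⦄ (i : E ⟶ X) (f : X ⟶ N) (g : M ⟶ N), Mono i → Epi g → IsFinGen E →
    ∃ h : X ⟶ M, i ≫ h ≫ g = i ≫ f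

end Categories

/-! ### Modules over non-unital rings -/

section NonUnital

/-- Left local units: each finite subset of `R` has a common left unit in `R`. -/
def HasLeftLocalUnits (R : Type*) [NonUnitalRing R] : Prop :=
  ∀ s : Finset R, ∃ e : R, ∀ r ∈ s, e * r = r

/-- A right module over the (not necessarily unital) ring `R`. -/
structure RMod (R : Type u) [NonUnitalRing R] where
  carrier : Type u
  [addCommGroup : AddCommGroup carrier]
  act : Rᵐᵒᵖ →ₙ+* AddMonoid.End carrier

variable {R : Type u} [NonUnitalRing R]

namespace RMod

instance : CoeSort (RMod R) (Type u) := ⟨carrier⟩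

attribute [instance] RMod.addCommGroup

/-- The map `m ↦ m r`. -/
def ract (M : RMod R) (r : R) : M →+ M := M.act (op r)

theorem ract_add (M : RMod R) (a b : R) : M.ract (a + b) = M.ract a + M.ract b :=
  map_add M.act (op a) (op b)

theorem ract_mul (M : RMod R) (a b : R) (m : M) : M.ract (a * b) m = M.ract b (M.ract a m) := by
  change M.act (op (a * b)) m = _
  rw [op_mul, map_mul]; rfl

/-- Right `R`-linear maps. -/
@[ext]
structure Hom (M N : RMod R) where
  toHom : M →+ N
  linear : ∀ r m, toHom (M.ract r m) = N.ract r (toHom m)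

/-- The category of all (non-unital) right `R`-modules. -/
instance : Category (RMod R) where
  Hom := Hom
  id M := ⟨AddMonoidHom.id M, fun _ _ => rfl⟩
  comp f g := ⟨g.toHom.comp f.toHom, fun r m => by simp [f.linear, g.linear]⟩

instance : Limits.HasZeroMorphisms (RMod R) where
  zero M N := ⟨⟨0, fun r m => by simp⟩⟩
  comp_zero f N := Hom.ext (by ext; rfl)
  zero_comp M N P f := Hom.ext (by
    ext x
    exact map_zero f.toHom)

/-- `M` is firm: the multiplication map `M ⊗_R R → M` is bijective. -/
def IsFirm : ObjectProperty (RMod R) := fun M =>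
  Function.Bijective (BalTensor.lift (ρ := M.ract) (l := fun r : R => AddMonoidHom.mulLeft r)
    (AddMonoidHom.flip (AddMonoidHom.mk' (fun r : R => M.ract r) M.ract_add))
    (fun s m r => (M.ract_mul s r m).symm))

end RMod

/-- The category `M_R` of firm right `R`-modules, a full subcategory of all right `R`-modules. -/
abbrev FirmMod (R : Type u) [NonUnitalRing R] := (RMod.IsFirm (R := R)).FullSubcategory

variable {F : Type u} [AddCommGroup F]

/-- The map `x ↦ r x` for the left `R`-module structure on `F` given by a ring morphism
`l : R → End(F)`. -/
def lact (l : R →ₙ+* AddMonoid.End F) (r : R) : F →+ F := l r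

/-- The left `R`-module `F` is firm: the multiplication map `R ⊗_R F → F` is bijective. -/
def IsFirmLeft (l : R →ₙ+* AddMonoid.End F) : Prop :=
  Function.Bijective (BalTensor.lift (ρ := fun r : R => AddMonoidHom.mulRight r) (l := lact l)
    (AddMonoidHom.mk' (lact l) (fun a b => map_add l a b))
    (fun s r x => by
      change l (r * s) x = l r (l s x)
      rw [map_mul]; rfl))

/-- The map `f ⊗_R F : M ⊗_R F → N ⊗_R F` induced by a right `R`-linear map `f : M → N`. -/
def tensorMap (l : R →ₙ+* AddMonoid.End F) {M N : RMod R} (f : M ⟶ N) :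
    BalTensor M.ract (lact l) →+ BalTensor N.ract (lact l) :=
  BalTensor.map f.toHom (AddMonoidHom.id F) f.linear (fun _ _ => rfl)

/-- The left `R`-module `F` is flat: the functor `- ⊗_R F` from all right `R`-modules to abelian
groups is exact. -/
def IsFlatLeft (l : R →ₙ+* AddMonoid.End F) : Prop :=
  ∀ ⦃K L N : RMod R⦄ (f : K ⟶ L) (g : L ⟶ N), Function.Exact f.toHom g.toHom →
    Function.Exact (tensorMap l f) (tensorMap l g)

/-- The left `R`-module `F` is faithfully flat: it is flat and the functor `- ⊗_R F` from the
category of firm right `R`-modules to abelian groups reflects exact sequences. -/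
def IsFaithfullyFlatLeft (l : R →ₙ+* AddMonoid.End F) : Prop :=
  IsFlatLeft l ∧
  ∀ ⦃K L N : FirmMod R⦄ (f : K ⟶ L) (g : L ⟶ N),
    Function.Exact (tensorMap l f.hom) (tensorMap l g.hom) →
      ∃ w : f ≫ g = 0, (ShortComplex.mk f g w).Exact

end NonUnital

/-! ### The dual of a right module and the ring `X ⊗_A X^*` -/

section DualTensor

/-- The dual `X^* = Hom_A(X, A)` of the right `A`-module `X`; a left `A`-module through `A`. -/
abbrev Dual (A X : Type*) [Ring A] [AddCommGroup X] [Module Aᵐᵒᵖ X] := X →ₗ[Aᵐᵒᵖ] A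

/-- The ring `X ⊗_A X^*`. -/
abbrev DualTensor (A X : Type*) [Ring A] [AddCommGroup X] [Module Aᵐᵒᵖ X] : Type _ :=
  ATensor A X (Dual A X)

namespace DualTensor

variable {A X : Type*} [Ring A] [AddCommGroup X] [Module Aᵐᵒᵖ X]

/-- The action of `X ⊗_A X^*` on `X` by right `A`-linear maps: `(x ⊗ ξ) · y = x ξ(y)`. -/
def ev : DualTensor A X →+ Module.End Aᵐᵒᵖ X :=
  ATensor.lift (AddMonoidHom.mk' (fun x => AddMonoidHom.mk' (fun ξ : Dual A X =>
        ({ toFun := fun y => op (ξ y) • x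
           map_add' := fun y z => by rw [map_add, MulOpposite.op_add, add_smul]
           map_smul' := fun b y => by
            rw [map_smul, ← mul_smul]; rfl } : Module.End Aᵐᵒᵖ X))
        (fun ξ η => by ext y; simp [add_smul]))
      (fun x y => by ext ξ z; simp))
    (fun a x ξ => by ext y; simp [mul_smul])

theorem ev_tmul (x : X) (ξ : Dual A X) (y : X) :
    ev (ATensor.tmul A x ξ) y = op (ξ y) • x := rfl

/-- The product `(x ⊗ ξ)(y ⊗ η) = x ξ(y) ⊗ η`. -/
instance : Mul (DualTensor A X) := ⟨fun z w => ATensor.map (ev z) LinearMap.id w⟩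

theorem tmul_mul_tmul (x y : X) (ξ η : Dual A X) :
    (ATensor.tmul A x ξ * ATensor.tmul A y η : DualTensor A X) =
      ATensor.tmul A (op (ξ y) • x) η := rfl

theorem mul_def (z w : DualTensor A X) : z * w = ATensor.map (ev z) LinearMap.id w := rfl

theorem add_mul' (z w v : DualTensor A X) : (z + w) * v = z * v + w * v := by
  simp only [mul_def, map_add]
  induction v using ATensor.induction with
  | zero => simp
  | pure y η => simp
  | add x y hx hy => rw [map_add, map_add, map_add, hx, hy]; abel

theorem mul_add' (z w v : DualTensor A X) : z * (w + v) = z * w + z * v := map_add _ _ _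

theorem ev_mul (z w : DualTensor A X) : ev (z * w) = ev z * ev w := by
  rw [mul_def]
  induction w using ATensor.induction with
  | zero => simp
  | pure y η =>
    ext v
    rw [ATensor.map_tmul, ev_tmul, Module.End.mul_apply, ev_tmul, map_smul]; rfl
  | add x y hx hy => rw [map_add, map_add, map_add, hx, hy, mul_add]

instance : NonUnitalRing (DualTensor A X) where
  left_distrib := mul_add'
  right_distrib := add_mul'
  zero_mul z := by
    have := add_mul' (0 : DualTensor A X) 0 z
    simpa using this
  mul_zero z := map_zero _
  mul_assoc z w v := by
    rw [mul_def (z * w), ev_mul, mul_def z, mul_def w]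
    induction v using ATensor.induction with
    | zero => simp
    | pure y η => simp
    | add x y hx hy => simp only [map_add, hx, hy]

end DualTensor

end DualTensor

/-! ### The functor `- ⊗_R Σ`, local projectivity over `R`, and the canonical map -/

section GaloisComodules

variable {A C : Type u} [Ring A] [AddCommGroup C] [Module A C] [Module Aᵐᵒᵖ C]
  [SMulCommClass A Aᵐᵒᵖ C] [Coring A C] {X : Comod A C}
  {R : Type u} [NonUnitalRing R]

/-- The left `R`-module structure of a comodule induced by a ring morphism `R → End^C(X)`. -/
def leftAct (ι : R →ₙ+* X.endRing) : R →ₙ+* AddMonoid.End X where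
  toFun r := (ι r).1.toAddMonoidHom
  map_mul' a b := by rw [map_mul]; rfl
  map_zero' := by rw [map_zero]; rfl
  map_add' a b := by rw [map_add]; rfl

/-- `M ⊗_R X` for a right `R`-module `M` and the left `R`-module `X`. -/
def RTensor (ι : R →ₙ+* X.endRing) (M : RMod R) : Type u :=
  BalTensor M.ract (lact (leftAct ι))

namespace RTensor

variable (ι : R →ₙ+* X.endRing)

instance (M : RMod R) : AddCommGroup (RTensor ι M) :=
  inferInstanceAs (AddCommGroup (BalTensor M.ract (lact (leftAct ι))))

instance (M : RMod R) : Module Aᵐᵒᵖ (RTensor ι M) :=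
  BalTensor.moduleOfRight (ρ := M.ract) (l := lact (leftAct ι)) Aᵐᵒᵖ
    (fun r b x => (ι r).1.map_smul b x)

/-- The right `A`-linear map `x ↦ m ⊗_R x`. -/
def tmulLin {M : RMod R} (m : M) : X →ₗ[Aᵐᵒᵖ] RTensor ι M where
  toFun := BalTensor.tmul M.ract (lact (leftAct ι)) m
  map_add' := map_add _
  map_smul' _ _ := rfl

theorem tmulLin_add {M : RMod R} (m m' : M) :
    tmulLin ι (m + m') = tmulLin ι m + tmulLin ι m' := by
  ext x
  change BalTensor.tmul _ _ (m + m') x = _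
  rw [map_add]; rfl

theorem tmulLin_ract {M : RMod R} (r : R) (m : M) :
    tmulLin ι (M.ract r m) = (tmulLin ι m).comp (ι r).1 := by
  ext x
  exact BalTensor.tmul_balanced r m x

theorem rmap_add_tmulLin {M : RMod R} (m m' : M) (z : ATensor A X C) :
    ATensor.rmap (tmulLin ι (m + m')) z =
      ATensor.rmap (tmulLin ι m) z + ATensor.rmap (tmulLin ι m') z := by
  induction z using ATensor.induction with
  | zero => simp
  | pure x c => simp [tmulLin_add]
  | add x y hx hy => rw [map_add, map_add, map_add, hx, hy]; abel

variable {ι}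

@[elab_as_elim]
theorem induction {M : RMod R} {p : RTensor ι M → Prop} (z : RTensor ι M)
    (zero : p 0) (pure : ∀ m x, p (tmulLin ι m x))
    (add : ∀ x y, p x → p y → p (x + y)) : p z :=
  BalTensor.induction (ρ := M.ract) (l := lact (leftAct ι)) z zero pure add

variable (ι)

/-- The coaction `M ⊗_R X → (M ⊗_R X) ⊗_A C`, `m ⊗ x ↦ (m ⊗ x_[0]) ⊗ x_[1]`. -/
def coactAdd (M : RMod R) : RTensor ι M →+ ATensor A (RTensor ι M) C :=
  BalTensor.lift (ρ := M.ract) (l := lact (leftAct ι))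
    (AddMonoidHom.mk' (fun m => ((ATensor.rmap (tmulLin ι m)).comp X.coact).toAddMonoidHom)
      (fun m m' => by
        ext x
        exact rmap_add_tmulLin ι m m' (X.coact x)))
    (fun r m x => by
      change ATensor.rmap (tmulLin ι (M.ract r m)) (X.coact x) =
        ATensor.rmap (tmulLin ι m) (X.coact ((ι r).1 x))
      rw [tmulLin_ract, ATensor.rmap_comp, (ι r).2 x])

@[simp]
theorem coactAdd_tmul (M : RMod R) (m : M) (x : X) :
    coactAdd ι M (tmulLin ι m x) = ATensor.rmap (tmulLin ι m) (X.coact x) := rfl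

/-- The same coaction as a right `A`-linear map. -/
def coact (M : RMod R) : RTensor ι M →ₗ[Aᵐᵒᵖ] ATensor A (RTensor ι M) C where
  toFun := coactAdd ι M
  map_add' := map_add _
  map_smul' b z := by
    induction z using induction with
    | zero => simp
    | pure m x => rw [← map_smul, coactAdd_tmul, coactAdd_tmul, map_smul, map_smul]; rfl
    | add x y hx hy => rw [smul_add, map_add, hx, hy, map_add, smul_add]

@[simp]
theorem coact_tmul (M : RMod R) (m : M) (x : X) :
    coact ι M (tmulLin ι m x) = ATensor.rmap (tmulLin ι m) (X.coact x) := rfl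

/-- The right `C`-comodule `M ⊗_R X`. -/
def comod (M : RMod R) : Comod A C where
  carrier := RTensor ι M
  coact := coact ι M
  coassoc z := by
    induction z using induction with
    | zero => simp
    | pure m x =>
      have h1 : ∀ z : ATensor A X C, ATensor.rmap (coact ι M) (ATensor.rmap (tmulLin ι m) z) =
          ATensor.rmap (ATensor.rmap (tmulLin ι m)) (ATensor.rmap X.coact z) := by
        intro z
        rw [← ATensor.rmap_comp, ← ATensor.rmap_comp]
        rfl
      have h2 : ∀ z : ATensor A (ATensor A X C) C,
          ATensor.assoc (ATensor.rmap (ATensor.rmap (tmulLin ι m)) z) =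
          ATensor.map (tmulLin ι m) LinearMap.id (ATensor.assoc z) := by
        intro z
        induction z using ATensor.induction with
        | zero => simp
        | pure w c =>
          induction w using ATensor.induction with
          | zero => simp
          | pure w c' => simp
          | add x y hx hy => simp only [map_add, AddMonoidHom.add_apply, hx, hy]
        | add x y hx hy => simp only [map_add, hx, hy]
      have h3 : ∀ z : ATensor A X C,
          ATensor.map (tmulLin ι m) LinearMap.id
            (ATensor.map LinearMap.id (Coring.comul (A := A) (C := C)) z) =
          ATensor.map LinearMap.id Coring.comul (ATensor.rmap (tmulLin ι m) z) := by
        intro z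
        induction z using ATensor.induction with
        | zero => simp
        | pure w c => simp
        | add x y hx hy => simp only [map_add, hx, hy]
      rw [coact_tmul, h1, h2, X.coassoc, h3]
    | add x y hx hy => simp only [map_add, hx, hy]
  counit z := by
    induction z using induction with
    | zero => simp
    | pure m x =>
      have h3 : ∀ z : ATensor A X C,
          ATensor.rid (ATensor.map LinearMap.id (Coring.counit (A := A) (C := C))
            (ATensor.rmap (tmulLin ι m) z)) =
          tmulLin ι m (ATensor.rid (ATensor.map LinearMap.id Coring.counit z)) := by
        intro z
        induction z using ATensor.induction with
        | zero => simp
        | pure w c => simp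
        | add x y hx hy => simp only [map_add, hx, hy]
      rw [coact_tmul, h3, X.counit]
    | add x y hx hy => simp only [map_add, hx, hy]

/-- The additive map `f ⊗_R X : M ⊗_R X → N ⊗_R X`. -/
def mapAdd {M N : RMod R} (f : M ⟶ N) : RTensor ι M →+ RTensor ι N := tensorMap (leftAct ι) f

@[simp]
theorem mapAdd_tmul {M N : RMod R} (f : M ⟶ N) (m : M) (x : X) :
    mapAdd ι f (tmulLin ι m x) = tmulLin ι (f.toHom m) x := rfl

/-- The map `f ⊗_R X` as a right `A`-linear map. -/
def mapLin {M N : RMod R} (f : M ⟶ N) : RTensor ι M →ₗ[Aᵐᵒᵖ] RTensor ι N where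
  toFun := mapAdd ι f
  map_add' := map_add _
  map_smul' b z := by
    induction z using induction with
    | zero => simp
    | pure m x => rfl
    | add x y hx hy => rw [smul_add, map_add, hx, hy, map_add, smul_add]

@[simp]
theorem mapLin_tmul {M N : RMod R} (f : M ⟶ N) (m : M) (x : X) :
    mapLin ι f (tmulLin ι m x) = tmulLin ι (f.toHom m) x := rfl

/-- The comodule morphism `f ⊗_R X`. -/
def comodMap {M N : RMod R} (f : M ⟶ N) : comod ι M ⟶ comod ι N where
  lin := mapLin ι f
  colinear z := by
    change coact ι N (mapLin ι f z) = ATensor.rmap (mapLin ι f) (coact ι M z)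
    induction z using induction with
    | zero => simp
    | pure m x =>
      rw [mapLin_tmul, coact_tmul, coact_tmul, ← ATensor.rmap_comp]
      rfl
    | add x y hx hy => simp only [map_add, hx, hy]

/-- The functor `- ⊗_R X` from all right `R`-modules to right `C`-comodules. -/
def functor : RMod R ⥤ Comod A C where
  obj := comod ι
  map f := comodMap ι f
  map_id M := by
    apply Comod.Hom.ext
    ext z
    change mapLin ι (𝟙 M) z = z
    induction z using induction with
    | zero => simp
    | pure m x => rfl
    | add x y hx hy => rw [map_add, hx, hy]
  map_comp f g := by
    apply Comod.Hom.ext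
    ext z
    change mapLin ι (f ≫ g) z = mapLin ι g (mapLin ι f z)
    induction z using induction with
    | zero => simp
    | pure m x => rfl
    | add x y hx hy => simp only [map_add, hx, hy]

end RTensor

/-- The functor `- ⊗_R X : M_R ⥤ M^C` on firm right `R`-modules. -/
def tensorFunctor (ι : R →ₙ+* X.endRing) : FirmMod R ⥤ Comod A C :=
  (RMod.IsFirm (R := R)).ι ⋙ RTensor.functor ι

/-- `X` is weakly `R`-locally projective as a right `A`-module, for the ring `R` acting on `X`
through `ι`: the action comes from a ring morphism `κ : R → X ⊗_A X^*`, and each `x ∈ X` has a local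
dual basis in the image of `κ`, i.e. `κ r · x = x` for some `r`. -/
def WeaklyRLocallyProjective (ι : R →ₙ+* X.endRing) : Prop :=
  ∃ κ : R →ₙ+* DualTensor A X, (∀ r x, DualTensor.ev (κ r) x = (ι r).1 x) ∧
    ∀ x : X, ∃ r : R, DualTensor.ev (κ r) x = x

/-- The right action of `R` on `X^*`, `(ξ r)(x) = ξ(r x)`. -/
def dualRact (ι : R →ₙ+* X.endRing) (r : R) : Dual A X →+ Dual A X :=
  AddMonoidHom.mk' (fun ξ => ξ.comp (ι r).1) (fun _ _ => rfl)

/-- The map `X ⊗_A C → C`, `x ⊗ c ↦ ξ(x) c`, for `ξ ∈ X^*`. -/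
def contract (ξ : Dual A X) : ATensor A X C →+ C :=
  ATensor.lid.comp (ATensor.map ξ LinearMap.id)

/-- The canonical map `can : X^* ⊗_R X → C`, `ξ ⊗ x ↦ ξ(x_[0]) x_[1]`. -/
def can (ι : R →ₙ+* X.endRing) : BalTensor (dualRact ι) (lact (leftAct ι)) →+ C :=
  BalTensor.lift
    (AddMonoidHom.mk' (fun ξ => (contract ξ).comp X.coact.toAddMonoidHom) (fun ξ η => by
      ext x
      change contract (ξ + η) (X.coact x) = contract ξ (X.coact x) + contract η (X.coact x)
      generalize X.coact x = z
      induction z using ATensor.induction with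
      | zero => simp
      | pure x c => simp [contract]
      | add x y hx hy => rw [map_add, map_add, map_add, hx, hy]; abel))
    (fun r ξ x => by
      change contract (ξ.comp (ι r).1) (X.coact x) = contract ξ (X.coact ((ι r).1 x))
      rw [(ι r).2 x]
      generalize X.coact x = z
      induction z using ATensor.induction with
      | zero => simp
      | pure x c => simp [contract]
      | add x y hx hy => rw [map_add, map_add, map_add, hx, hy])

end GaloisComodules

end Galois

/-! Local projectivity of `C` gives every finite subset of `C` a finite dual basis, so the slices `m
⊗ c ↦ m φ(c)`, for left linear `φ : C → A`, separate the elements of `M ⊗_A C`. Comodules are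
thereby governed by the operators `hit φ`: a linear map is colinear as soon as it commutes with them
(`isColinear_of_hit`), stable submodules carry subcomodules and quotients, monomorphisms are
injective, epimorphisms are surjective, and each element generates a subcomodule that is finitely
generated over `A` (`fg_gen`).

For 1 ⇒ 2 and 1 ⇒ 3 take `R = finEnd X`, the ideal of endomorphisms whose image lies in a finitely
generated subcomodule. Since `X` is a generator, the images of `R` add up to `X`. Weak local
projectivity lifts the identity of a finitely generated subcomodule `E` through copies of `X`, and
the lift sums up to an element of `R` that fixes `E` (`exists_finEnd_eq_self`). Hence `R` has left
local units and `X` is firm. The generator property also gives `exists_factorization`: the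
subcomodule of `X^J` generated by `(y_j)` is a sum of images of `X`, so `y_j = ∑_l k_jl w_l` with
`k_jl ∈ R`, and each colinear relation `∑_j f_j(y_j) = 0` already holds as `∑_j f_j k_jl = 0` for
all `l`. From this follow flatness of `X`, bijectivity of the evaluations `Hom^C(X, M) ⊗_R X → M`,
and, for `M = C`, bijectivity of `can`. If `n ⊗ x = 0` for all `x`, the images of the annihilator of
`n` add up to `X`, and local projectivity enlarges the annihilator to `R`
(`ract_eq_zero_of_tmulLin_eq_zero`); so `- ⊗_R X` is faithful on firm modules. It is then an
equivalence with inverse `M ↦ Hom^C(X, M) ⊗_R R`, and flatness improves to faithful flatness. The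
map `κ` exists because `X ⊗_A X^*` acts faithfully on `X` (`ev_injective`) and contains local dual
bases (`exists_dualBasis`).

For 2 ⇒ 1, the firm module `R` is a weakly locally projective generator, and the equivalence carries
it to `R ⊗_R X ≅ X`.

For 3 ⇒ 1, bijectivity of `can` spreads to `Hom_A(X, P) ⊗_R X ≅ P ⊗_A C` for every `P`
(`canAt_bijective`). Flatness preserves the kernel that defines `Hom^C(X, M)`, so the evaluations
are again bijective and `X` is a generator. For an epimorphism `M → N` the cokernel of `Hom^C(X, M)
→ Hom^C(X, N)` dies after `- ⊗_R X`, so by faithful flatness `R` annihilates it; composing with a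
local unit of `R` then yields the lifts that weak local projectivity asks for. -/

namespace Galois

/-! ### Local dual bases and slice maps -/

section Slices

variable {A M M' N N' : Type*} [Ring A] [AddCommGroup M] [Module Aᵐᵒᵖ M]
  [AddCommGroup M'] [Module Aᵐᵒᵖ M'] [AddCommGroup N] [Module A N]
  [AddCommGroup N'] [Module A N'] [Module Aᵐᵒᵖ N'] [SMulCommClass A Aᵐᵒᵖ N']

/-- Every finite subset of `N` has a finite dual basis. -/
def HasLocalDualBases (A N : Type*) [Ring A] [AddCommGroup N] [Module A N] : Prop :=
  ∀ s : Finset N, ∃ (t : Finset N) (φ : N → N →ₗ[A] A), ∀ x ∈ s, ∑ c ∈ t, φ c x • c = x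

namespace ATensor

theorem map_map {N₁ N₂ M₁ M₂ : Type*} [AddCommGroup N₁] [Module A N₁] [AddCommGroup N₂]
    [Module A N₂] [AddCommGroup M₁] [Module Aᵐᵒᵖ M₁] [AddCommGroup M₂] [Module Aᵐᵒᵖ M₂]
    (f : M →ₗ[Aᵐᵒᵖ] M₁) (g : N →ₗ[A] N₁) (f' : M₁ →ₗ[Aᵐᵒᵖ] M₂) (g' : N₁ →ₗ[A] N₂)
    (z : ATensor A M N) : map f' g' (map f g z) = map (f'.comp f) (g'.comp g) z := by
  induction z using induction with
  | zero => simp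
  | pure m n => rfl
  | add x y hx hy => simp only [map_add, hx, hy]

theorem map_sub_left (f g : M →ₗ[Aᵐᵒᵖ] M') (k : N →ₗ[A] N) (z : ATensor A M N) :
    map (f - g) k z = map f k z - map g k z := by
  induction z using induction with
  | zero => simp
  | pure m n => simp
  | add x y hx hy => rw [map_add, map_add, map_add, hx, hy]; abel

theorem rmap_add [Module Aᵐᵒᵖ N] [SMulCommClass A Aᵐᵒᵖ N] (f g : M →ₗ[Aᵐᵒᵖ] M')
    (z : ATensor A M N) : rmap (f + g) z = rmap f z + rmap g z := by
  induction z using induction with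
  | zero => simp
  | pure m n => simp
  | add x y hx hy => rw [map_add, map_add, map_add, hx, hy]; abel

theorem rmap_zero [Module Aᵐᵒᵖ N] [SMulCommClass A Aᵐᵒᵖ N] (z : ATensor A M N) :
    rmap (0 : M →ₗ[Aᵐᵒᵖ] M') z = 0 := by
  induction z using induction with
  | zero => simp
  | pure m n => simp
  | add x y hx hy => rw [map_add, hx, hy, add_zero]

theorem rmap_eq_map [Module Aᵐᵒᵖ N] [SMulCommClass A Aᵐᵒᵖ N] (f : M →ₗ[Aᵐᵒᵖ] M')
    (z : ATensor A M N) : rmap f z = map f LinearMap.id z := rfl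

/-- The map `m ⊗ n ↦ m φ(n)`. -/
def slice (φ : N →ₗ[A] A) : ATensor A M N →+ M := rid.comp (map LinearMap.id φ)

@[simp]
theorem slice_tmul (φ : N →ₗ[A] A) (m : M) (n : N) : slice φ (tmul A m n) = op (φ n) • m := rfl

theorem slice_map (φ : N →ₗ[A] A) {N₁ : Type*} [AddCommGroup N₁] [Module A N₁]
    (f : M →ₗ[Aᵐᵒᵖ] M') (k : N₁ →ₗ[A] N) (z : ATensor A M N₁) :
    slice φ (map f k z) = f (slice (φ.comp k) z) := by
  induction z using induction with
  | zero => simp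
  | pure m n => simp
  | add x y hx hy => simp only [map_add, hx, hy]

theorem slice_rmap [Module Aᵐᵒᵖ N] [SMulCommClass A Aᵐᵒᵖ N] (φ : N →ₗ[A] A)
    (f : M →ₗ[Aᵐᵒᵖ] M') (z : ATensor A M N) : slice φ (rmap f z) = f (slice φ z) :=
  slice_map φ f LinearMap.id z

/-- The map `x ⊗ n ↦ x φ(n)` as a left `A`-linear map. -/
def lslice (φ : N →ₗ[A] A) : ATensor A N' N →ₗ[A] N' where
  toFun := slice φ
  map_add' := map_add _
  map_smul' a z := by
    induction z using induction with
    | zero => simp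
    | pure m n => exact (smul_comm a (op (φ n)) m).symm
    | add x y hx hy => rw [smul_add, map_add, map_add, smul_add, hx, hy]

/-- The map `x ↦ x ⊗ n` as a left `A`-linear map. -/
def ltmul (n : N) : N' →ₗ[A] ATensor A N' N where
  toFun x := tmul A x n
  map_add' x y := by simp
  map_smul' a x := rfl

theorem map_lslice_assoc (φ : N →ₗ[A] A) (z : ATensor A (ATensor A M N') N) :
    map LinearMap.id (lslice φ) (assoc z) = slice φ z := by
  induction z using induction with
  | zero => simp
  | pure w n =>
    induction w using induction with
    | zero => simp
    | pure m x => rfl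
    | add x y hx hy =>
      simp only [map_add, AddMonoidHom.add_apply, hx, hy]
  | add x y hx hy => simp only [map_add, hx, hy]

/-- Only finitely many elements of `N` occur in a presentation of `z`, and an endomorphism `k` of
`N` fixing them satisfies `(id ⊗ k) z = z`. A dual basis of these elements provides such a `k = ∑
φ_c(-) c`. -/
theorem exists_eq_sum_slice (h : HasLocalDualBases A N) (z : ATensor A M N) :
    ∃ (t : Finset N) (φ : N → N →ₗ[A] A), z = ∑ c ∈ t, tmul A (slice (φ c) z) c := by
  classical
  obtain ⟨s, hs⟩ : ∃ s : Finset N, ∀ k : N →ₗ[A] N, (∀ x ∈ s, k x = x) →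
      map LinearMap.id k z = z := by
    induction z using induction with
    | zero => exact ⟨∅, fun k _ => map_zero _⟩
    | pure m n => exact ⟨{n}, fun k hk => by rw [map_tmul, hk n (by simp)]; rfl⟩
    | add x y hx hy =>
      obtain ⟨s, hs⟩ := hx
      obtain ⟨t, ht⟩ := hy
      exact ⟨s ∪ t, fun k hk => by
        rw [map_add, hs k fun x hx => hk x (by simp [hx]), ht k fun x hx => hk x (by simp [hx])]⟩
  obtain ⟨t, φ, hφ⟩ := h s
  refine ⟨t, φ, ?_⟩
  have key : ∀ w : ATensor A M N, map LinearMap.id (∑ c ∈ t, (φ c).smulRight c) w =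
      ∑ c ∈ t, tmul A (slice (φ c) w) c := by
    intro w
    induction w using induction with
    | zero => simp
    | pure m n => simp [tmul_balanced]
    | add x y hx hy => simp only [map_add, hx, hy, AddMonoidHom.add_apply, Finset.sum_add_distrib]
  rw [← key, hs]
  intro x hx
  simpa using hφ x hx

theorem eq_zero_of_slice (h : HasLocalDualBases A N) {z : ATensor A M N}
    (hz : ∀ φ : N →ₗ[A] A, slice φ z = 0) : z = 0 := by
  obtain ⟨t, φ, ht⟩ := exists_eq_sum_slice h z
  rw [ht]
  exact Finset.sum_eq_zero fun c _ => by simp [hz]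

theorem ext_slice (h : HasLocalDualBases A N) {z w : ATensor A M N}
    (hz : ∀ φ : N →ₗ[A] A, slice φ z = slice φ w) : z = w :=
  sub_eq_zero.1 (eq_zero_of_slice h fun φ => by rw [map_sub, hz, sub_self])

/-- The same expansion in the last tensor factor of `M ⊗ (N' ⊗ N)`. It allows coassociativity to be
tested after slicing the last leg. -/
theorem eq_zero_of_lslice (h : HasLocalDualBases A N) {z : ATensor A M (ATensor A N' N)}
    (hz : ∀ φ : N →ₗ[A] A, map LinearMap.id (lslice φ) z = 0) : z = 0 := by
  classical
  suffices ∃ (t : Finset N) (φ : N → N →ₗ[A] A),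
      z = ∑ c ∈ t, map LinearMap.id (ltmul c) (map LinearMap.id (lslice (φ c)) z) by
    obtain ⟨t, φ, ht⟩ := this
    rw [ht]
    exact Finset.sum_eq_zero fun c _ => by simp [hz]
  obtain ⟨s, hs⟩ : ∃ s : Finset N, ∀ (t : Finset N) (φ : N → N →ₗ[A] A),
      (∀ x ∈ s, ∑ c ∈ t, φ c x • c = x) →
      z = ∑ c ∈ t, map LinearMap.id (ltmul c) (map LinearMap.id (lslice (φ c)) z) := by
    clear hz
    induction z using induction with
    | zero => exact ⟨∅, fun t φ _ => by simp⟩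
    | pure m w =>
      suffices ∃ s : Finset N, ∀ (t : Finset N) (φ : N → N →ₗ[A] A),
          (∀ x ∈ s, ∑ c ∈ t, φ c x • c = x) → w = ∑ c ∈ t, ltmul c (lslice (φ c) w) by
        obtain ⟨s, hs⟩ := this
        refine ⟨s, fun t φ ht => ?_⟩
        conv_lhs => rw [hs t φ ht]
        simp
      induction w using induction with
      | zero => exact ⟨∅, fun t φ _ => by simp⟩
      | pure x n =>
        refine ⟨{n}, fun t φ ht => ?_⟩
        conv_lhs => rw [← ht n (by simp), map_sum]
        refine Finset.sum_congr rfl fun c _ => ?_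
        rw [← tmul_balanced]
        rfl
      | add x y hx hy =>
        obtain ⟨s, hs⟩ := hx
        obtain ⟨t, ht⟩ := hy
        refine ⟨s ∪ t, fun t' φ h' => ?_⟩
        conv_lhs => rw [hs t' φ fun x hx => h' x (by simp [hx]),
          ht t' φ fun x hx => h' x (by simp [hx])]
        simp only [map_add, Finset.sum_add_distrib]
    | add x y hx hy =>
      obtain ⟨s, hs⟩ := hx
      obtain ⟨t, ht⟩ := hy
      refine ⟨s ∪ t, fun t' φ h' => ?_⟩
      conv_lhs => rw [hs t' φ fun x hx => h' x (by simp [hx]),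
        ht t' φ fun x hx => h' x (by simp [hx])]
      simp only [map_add, Finset.sum_add_distrib]
  obtain ⟨t, φ, hφ⟩ := h s
  exact ⟨t, φ, hs t φ hφ⟩

theorem map_injective_of_injective (h : HasLocalDualBases A N) {f : M →ₗ[Aᵐᵒᵖ] M'}
    (hf : Function.Injective f) :
    Function.Injective (map f LinearMap.id : ATensor A M N →+ ATensor A M' N) := by
  rw [injective_iff_map_eq_zero]
  refine fun z hz => eq_zero_of_slice h fun φ => hf ?_
  have := slice_map φ f LinearMap.id z
  rw [hz] at this
  rw [map_zero]
  exact this.symm.trans (map_zero _)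

end ATensor

/-- Lift the identity of `C` through the free module on the set `C`, over the span of `s`. The
coordinates of the lift are the dual functionals, and the supports at the elements of `s` bound the
basis. -/
theorem HasLocalDualBases.of_weaklyLocallyProjective {A C : Type u} [Ring A] [AddCommGroup C]
    [Module A C] (hC : WeaklyLocallyProjective (ModuleCat.of A C)) : HasLocalDualBases A C := by
  classical
  intro s
  let E : Submodule A C := Submodule.span A s
  -- A finitely generated module is a compact element of its submodule lattice, which is isomorphic
  -- to the lattice of subobjects.
  have hE : IsFinGen (ModuleCat.of A E) := by
    intro F hne hdir hlub
    have hfg : Module.Finite A E := Module.Finite.iff_fg.2 ⟨s, rfl⟩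
    let o := ModuleCat.subobjectModule (ModuleCat.of A E)
    have h1 : IsLUB (o '' F) ⊤ := by
      have := o.isLUB_image'.2 hlub
      simpa using this
    have hdir' : DirectedOn (· ≤ ·) (o '' F) := by
      rintro _ ⟨a, ha, rfl⟩ _ ⟨b, hb, rfl⟩
      obtain ⟨c, hc, h1, h2⟩ := hdir a ha b hb
      exact ⟨o c, ⟨c, hc, rfl⟩, o.monotone h1, o.monotone h2⟩
    have hk := (Submodule.fg_iff_compact (⊤ : Submodule A (ModuleCat.of A E))).1 hfg.fg_top
    obtain ⟨y, ⟨x, hx, rfl⟩, hle⟩ := (CompleteLattice.isCompactElement_iff_le_of_directed_sSup_le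
      _ _).1 hk (o '' F) (hne.image _) hdir' (h1.sSup_eq).ge
    have : x = ⊤ := o.injective (by rw [map_top]; exact top_le_iff.1 hle)
    exact this ▸ hx
  obtain ⟨h, hh⟩ := hC (E := ModuleCat.of A E) (M := ModuleCat.of A (C →₀ A))
    (N := ModuleCat.of A C) (ModuleCat.ofHom E.subtype) (𝟙 _)
    (ModuleCat.ofHom (Finsupp.linearCombination A (id : C → C)))
    ((ModuleCat.mono_iff_injective _).2 E.injective_subtype)
    ((ModuleCat.epi_iff_surjective _).2 (Finsupp.linearCombination_id_surjective A C)) hE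
  refine ⟨s.biUnion fun x => (h.hom x).support, fun c => (Finsupp.lapply c).comp h.hom,
    fun x hx => ?_⟩
  have := congr(($hh).hom ⟨x, Submodule.subset_span hx⟩)
  replace this : Finsupp.linearCombination A (id : C → C) (h.hom x) = x := this
  conv_rhs => rw [← this, Finsupp.linearCombination_apply,
    Finsupp.sum_of_support_subset _ (Finset.subset_biUnion_of_mem (fun x => (h.hom x).support) hx)
      _ (by simp)]
  rfl

end Slices

/-! ### Comodules as modules over the left dual of the coring. -/

section ComodBasics

variable {A C : Type u} [Ring A] [AddCommGroup C] [Module A C] [Module Aᵐᵒᵖ C]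
  [SMulCommClass A Aᵐᵒᵖ C]

/-- The right action of a scalar on an `A`-bimodule, as a left `A`-linear map. -/
def opSMulLin (A : Type*) {N : Type*} [Ring A] [AddCommGroup N] [Module A N] [Module Aᵐᵒᵖ N]
    [SMulCommClass A Aᵐᵒᵖ N] (b : Aᵐᵒᵖ) : N →ₗ[A] N where
  toFun n := b • n
  map_add' := smul_add b
  map_smul' a n := (smul_comm a b n).symm

variable [Coring A C]

/-- The map `c ↦ c_(1) φ(c_(2))`. -/
def conv (φ : C →ₗ[A] A) : C →ₗ[A] C := (ATensor.lslice φ).comp Coring.comul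

namespace Comod

variable {M N : Comod A C}

/-- The right action `m ↦ m_[0] φ(m_[1])` of the left dual of `C` on a comodule. -/
def hit (M : Comod A C) (φ : C →ₗ[A] A) : M →+ M :=
  (ATensor.slice φ).comp M.coact.toAddMonoidHom

theorem hit_apply (φ : C →ₗ[A] A) (m : M) : M.hit φ m = ATensor.slice φ (M.coact m) := rfl

/-- This is coassociativity with the last leg sliced by `φ`. -/
theorem coact_hit (φ : C →ₗ[A] A) (m : M) :
    M.coact (M.hit φ m) = ATensor.map LinearMap.id (conv φ) (M.coact m) := by
  rw [hit_apply, ← ATensor.slice_rmap, ← ATensor.map_lslice_assoc, M.coassoc, ATensor.map_map]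
  rfl

theorem hit_hit (φ ψ : C →ₗ[A] A) (m : M) :
    M.hit ψ (M.hit φ m) = M.hit (ψ.comp (conv φ)) m := by
  rw [hit_apply, coact_hit, ATensor.slice_map]
  rfl

theorem hit_counit (m : M) : M.hit Coring.counit m = m := M.counit m

theorem hit_smul (φ : C →ₗ[A] A) (b : Aᵐᵒᵖ) (m : M) :
    M.hit φ (b • m) = M.hit (φ.comp (opSMulLin A b)) m := by
  rw [hit_apply, hit_apply, map_smul]
  generalize M.coact m = z
  induction z using ATensor.induction with
  | zero => simp
  | pure m n => rfl
  | add x y hx hy => rw [smul_add, map_add, map_add, hx, hy]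

theorem IsColinear.hit {f : M →ₗ[Aᵐᵒᵖ] N} (hf : IsColinear f) (φ : C →ₗ[A] A) (m : M) :
    f (M.hit φ m) = N.hit φ (f m) := by
  rw [hit_apply, hit_apply, hf, ATensor.slice_rmap]

/-- The slices separate `N ⊗_A C`, and slicing the colinearity equation by `φ` gives compatibility
with `hit φ`. -/
theorem isColinear_of_hit (h : HasLocalDualBases A C) {f : M →ₗ[Aᵐᵒᵖ] N}
    (hf : ∀ φ m, f (M.hit φ m) = N.hit φ (f m)) : IsColinear f := fun m =>
  ATensor.ext_slice h fun φ => by rw [ATensor.slice_rmap]; exact (hf φ m).symm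

theorem IsColinear.comp {P : Comod A C} {g : N →ₗ[Aᵐᵒᵖ] P} {f : M →ₗ[Aᵐᵒᵖ] N}
    (hg : IsColinear g) (hf : IsColinear f) : IsColinear (g.comp f) := fun m => by
  rw [ATensor.rmap_comp, ← hf, ← hg]; rfl

theorem IsColinear.zero : IsColinear (0 : M →ₗ[Aᵐᵒᵖ] N) := fun m => by
  rw [ATensor.rmap_zero, LinearMap.zero_apply, map_zero]

theorem IsColinear.add {f g : M →ₗ[Aᵐᵒᵖ] N} (hf : IsColinear f) (hg : IsColinear g) :
    IsColinear (f + g) := fun m => by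
  rw [ATensor.rmap_add, LinearMap.add_apply, map_add, hf, hg]

theorem IsColinear.neg {f : M →ₗ[Aᵐᵒᵖ] N} (hf : IsColinear f) : IsColinear (-f) := fun m => by
  have h : ATensor.rmap (f + -f) (M.coact m) = 0 := by rw [add_neg_cancel, ATensor.rmap_zero]
  rw [ATensor.rmap_add, ← hf] at h
  rw [LinearMap.neg_apply, map_neg, eq_comm]
  exact (neg_eq_of_add_eq_zero_right h).symm

theorem IsColinear.id : IsColinear (LinearMap.id : M →ₗ[Aᵐᵒᵖ] M) :=
  fun _ => (ATensor.rmap_id _).symm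

/-! ### Constructions of comodules -/

/-- A coaction that is compatible with the actions of the left dual of `C` is coassociative. -/
@[reducible] def ofHit (h : HasLocalDualBases A C) (P : Type u) [AddCommGroup P] [Module Aᵐᵒᵖ P]
    (ρ : P →ₗ[Aᵐᵒᵖ] ATensor A P C)
    (hρ : ∀ (φ : C →ₗ[A] A) m, ρ (ATensor.slice φ (ρ m)) = ATensor.map LinearMap.id (conv φ) (ρ m))
    (hε : ∀ m, ATensor.slice Coring.counit (ρ m) = m) : Comod A C where
  carrier := P
  coact := ρ
  counit := hε
  coassoc m := by
    -- Slicing the last leg by `φ` turns coassociativity into the hypothesis `hρ` for `φ`.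
    rw [← sub_eq_zero]
    refine ATensor.eq_zero_of_lslice h fun φ => ?_
    rw [map_sub, ATensor.map_lslice_assoc, ATensor.slice_rmap, hρ, ATensor.map_map, sub_eq_zero]
    rfl

/-- A submodule stable under the action of the left dual of `C`. -/
def Stable (E : Submodule Aᵐᵒᵖ M) : Prop := ∀ (φ : C →ₗ[A] A), ∀ m ∈ E, M.hit φ m ∈ E

theorem rmap_subtype_injective (h : HasLocalDualBases A C) (E : Submodule Aᵐᵒᵖ M) :
    Function.Injective (ATensor.rmap E.subtype : ATensor A E C →ₗ[Aᵐᵒᵖ] ATensor A M C) :=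
  ATensor.map_injective_of_injective h E.injective_subtype

/-- In the dual basis expansion of `ρ(m)` the coefficients are the elements `hit φ_c m`, which stay
in `E`. -/
theorem Stable.exists_coact (h : HasLocalDualBases A C) {E : Submodule Aᵐᵒᵖ M} (hE : Stable E)
    (m : E) : ∃ z : ATensor A E C, ATensor.rmap E.subtype z = M.coact m := by
  obtain ⟨t, φ, ht⟩ := ATensor.exists_eq_sum_slice h (M.coact m)
  refine ⟨∑ c ∈ t, ATensor.tmul A (⟨M.hit (φ c) m, hE _ _ m.2⟩ : E) c, ?_⟩
  rw [map_sum]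
  conv_rhs => rw [ht]
  rfl

/-- The coaction of a stable submodule. -/
noncomputable def Stable.coact (h : HasLocalDualBases A C) {E : Submodule Aᵐᵒᵖ M} (hE : Stable E) :
    E →ₗ[Aᵐᵒᵖ] ATensor A E C where
  toFun m := (hE.exists_coact h m).choose
  map_add' m n := rmap_subtype_injective h E (by
    rw [map_add, (hE.exists_coact h m).choose_spec, (hE.exists_coact h n).choose_spec,
      (hE.exists_coact h (m + n)).choose_spec, Submodule.coe_add, map_add])
  map_smul' b m := rmap_subtype_injective h E (by
    rw [RingHom.id_apply, map_smul, (hE.exists_coact h m).choose_spec,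
      (hE.exists_coact h (b • m)).choose_spec, Submodule.coe_smul, map_smul])

theorem Stable.rmap_coact (h : HasLocalDualBases A C) {E : Submodule Aᵐᵒᵖ M} (hE : Stable E)
    (m : E) : ATensor.rmap E.subtype (hE.coact h m) = M.coact m :=
  (hE.exists_coact h m).choose_spec

theorem Stable.coe_slice_coact (h : HasLocalDualBases A C) {E : Submodule Aᵐᵒᵖ M} (hE : Stable E)
    (φ : C →ₗ[A] A) (m : E) : ((ATensor.slice φ (hE.coact h m) : E) : M) = M.hit φ m := by
  rw [hit_apply, ← hE.rmap_coact h, ATensor.slice_rmap]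
  rfl

/-- The subcomodule on a stable submodule. -/
noncomputable abbrev Stable.sub (h : HasLocalDualBases A C) {E : Submodule Aᵐᵒᵖ M} (hE : Stable E) :
    Comod A C :=
  ofHit h E (hE.coact h)
    (fun φ m => rmap_subtype_injective h E (by
      rw [hE.rmap_coact, hE.coe_slice_coact, coact_hit, ATensor.rmap_eq_map, ATensor.map_map,
        ← hE.rmap_coact h, ATensor.rmap_eq_map, ATensor.map_map]
      rfl))
    (fun m => Subtype.ext (by rw [hE.coe_slice_coact, hit_counit]))

theorem Stable.subtype_colinear (h : HasLocalDualBases A C) {E : Submodule Aᵐᵒᵖ M}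
    (hE : Stable E) : IsColinear (M := hE.sub h) (N := M) E.subtype :=
  fun m => (hE.rmap_coact h m).symm

theorem Stable.codRestrict_colinear (h : HasLocalDualBases A C) {E : Submodule Aᵐᵒᵖ M}
    (hE : Stable E) {f : N →ₗ[Aᵐᵒᵖ] M} (hf : IsColinear f) (hfE : ∀ x, f x ∈ E) :
    IsColinear (M := N) (N := hE.sub h) (f.codRestrict E hfE) :=
  isColinear_of_hit h fun φ m => Subtype.ext (by
    refine (hf.hit φ m).trans ?_
    exact (hE.coe_slice_coact h φ ⟨f m, hfE m⟩).symm)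

/-- The coaction of a quotient by a stable submodule. -/
def Stable.quotCoact (h : HasLocalDualBases A C) {E : Submodule Aᵐᵒᵖ M} (hE : Stable E) :
    (M ⧸ E) →ₗ[Aᵐᵒᵖ] ATensor A (M ⧸ E) C :=
  E.liftQ ((ATensor.rmap E.mkQ).comp M.coact) (fun m hm => by
    rw [LinearMap.mem_ker]
    refine ATensor.eq_zero_of_slice h fun φ => ?_
    rw [LinearMap.comp_apply, ATensor.slice_rmap]
    exact (Submodule.Quotient.mk_eq_zero _).2 (hE φ m hm))

theorem Stable.quotCoact_mkQ (h : HasLocalDualBases A C) {E : Submodule Aᵐᵒᵖ M} (hE : Stable E)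
    (m : M) : hE.quotCoact h (E.mkQ m) = ATensor.rmap E.mkQ (M.coact m) := rfl

/-- The quotient comodule by a stable submodule. -/
abbrev Stable.quot (h : HasLocalDualBases A C) {E : Submodule Aᵐᵒᵖ M} (hE : Stable E) :
    Comod A C :=
  ofHit h (M ⧸ E) (hE.quotCoact h)
    (fun φ m => by
      obtain ⟨m, rfl⟩ := E.mkQ_surjective m
      rw [hE.quotCoact_mkQ, ATensor.slice_rmap, ← hit_apply, hE.quotCoact_mkQ, coact_hit,
        ATensor.rmap_eq_map, ATensor.rmap_eq_map, ATensor.map_map, ATensor.map_map]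
      rfl)
    (fun m => by
      obtain ⟨m, rfl⟩ := E.mkQ_surjective m
      rw [hE.quotCoact_mkQ, ATensor.slice_rmap, ← hit_apply, hit_counit])

theorem Stable.mkQ_colinear (h : HasLocalDualBases A C) {E : Submodule Aᵐᵒᵖ M} (hE : Stable E) :
    IsColinear (M := M) (N := hE.quot h) E.mkQ := fun _ => rfl

/-- The coaction of a direct sum of copies of `M`. -/
noncomputable def powCoact (I : Type*) (M : Comod A C) :
    (I →₀ M) →ₗ[Aᵐᵒᵖ] ATensor A (I →₀ M) C :=
  Finsupp.lsum ℕ fun i => (ATensor.rmap (Finsupp.lsingle i)).comp M.coact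

theorem powCoact_single (I : Type*) (i : I) (m : M) :
    powCoact I M (Finsupp.single i m) = ATensor.rmap (Finsupp.lsingle i) (M.coact m) := by
  simp [powCoact]

/-- The direct sum of copies of the comodule `M`, indexed by `I`. -/
noncomputable abbrev pow (h : HasLocalDualBases A C) (I : Type u) (M : Comod A C) : Comod A C :=
  ofHit h (I →₀ M) (powCoact I M)
    (fun φ m => by
      induction m using Finsupp.induction_linear with
      | zero => simp
      | add f g hf hg => simp only [map_add, hf, hg]
      | single i m =>
        rw [powCoact_single, ATensor.slice_rmap, ← hit_apply, Finsupp.lsingle_apply,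
          powCoact_single, coact_hit, ATensor.rmap_eq_map, ATensor.rmap_eq_map, ATensor.map_map,
          ATensor.map_map]
        rfl)
    (fun m => by
      induction m using Finsupp.induction_linear with
      | zero => simp
      | add f g hf hg => simp only [map_add, hf, hg]
      | single i m =>
        rw [powCoact_single, ATensor.slice_rmap, ← hit_apply, hit_counit]
        rfl)

theorem single_colinear (h : HasLocalDualBases A C) {I : Type u} (i : I) :
    IsColinear (M := M) (N := pow h I M) (Finsupp.lsingle i) := fun m => powCoact_single I i m

theorem pow_colinear (h : HasLocalDualBases A C) {I : Type u} {f : (I →₀ M) →ₗ[Aᵐᵒᵖ] N}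
    (hf : ∀ i, IsColinear (M := M) (N := N) (f.comp (Finsupp.lsingle i))) :
    IsColinear (M := pow h I M) (N := N) f := fun m => by
  induction m using Finsupp.induction_linear with
  | zero => simp
  | add f g hf hg => simp only [map_add, hf, hg]
  | single i m =>
    refine (hf i m).trans ?_
    rw [ATensor.rmap_comp]
    exact congrArg _ (powCoact_single I i m).symm

theorem lapply_colinear (h : HasLocalDualBases A C) {I : Type u} (i : I) :
    IsColinear (M := pow h I M) (N := M) (Finsupp.lapply i) := by
  classical
  refine pow_colinear h fun j => ?_
  by_cases hij : j = i
  · subst hij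
    convert IsColinear.id (M := M)
    ext; simp
  · convert IsColinear.zero (M := M) (N := M)
    ext; simp [hij]

variable (A C) in
/-- The coring `C` as a right comodule. -/
@[reducible] def regular : Comod A C where
  carrier := C
  coact := ⟨Coring.comul.toAddHom, Coring.comul_op_smul⟩
  coassoc := Coring.coassoc
  counit := Coring.counit_right

/-- The comodule map `M → C` attached to a functional `ξ`, `m ↦ ξ(m_[0]) m_[1]`. -/
def toRegular (ξ : Dual A M) : M →ₗ[Aᵐᵒᵖ] regular A C where
  toFun m := contract ξ (M.coact m)
  map_add' _ _ := by rw [map_add, map_add]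
  map_smul' b m := by
    rw [map_smul]
    generalize M.coact m = z
    induction z using ATensor.induction with
    | zero => simp
    | pure m n => exact smul_comm _ _ _
    | add x y hx hy => simp only [smul_add, map_add, hx, hy]

theorem contract_map_conv (ξ : Dual A M) (k : C →ₗ[A] C) (z : ATensor A M C) :
    contract ξ (ATensor.map LinearMap.id k z) = k (contract ξ z) := by
  induction z using ATensor.induction with
  | zero => simp
  | pure m n => simp [contract]
  | add x y hx hy => simp only [map_add, hx, hy]

theorem toRegular_colinear (h : HasLocalDualBases A C) (ξ : Dual A M) :
    IsColinear (toRegular ξ) :=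
  isColinear_of_hit h fun φ m => by
    change contract ξ (M.coact (M.hit φ m)) = conv φ (contract ξ (M.coact m))
    rw [coact_hit, contract_map_conv]

/-- Together with `toRegular_counitComp` this is the adjunction `Hom^C(M, C) ≅ M^*`, which later
turns an evaluation map into `can`. -/
theorem counit_toRegular (ξ : Dual A M) (m : M) :
    Coring.counit (A := A) (toRegular ξ m) = ξ m := by
  have key : ∀ z : ATensor A M C, Coring.counit (A := A) (contract ξ z) =
      ξ (ATensor.slice Coring.counit z) := by
    intro z
    induction z using ATensor.induction with
    | zero => simp
    | pure m n => simp [contract]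
    | add x y hx hy => simp only [map_add, hx, hy]
  exact (key _).trans (congrArg ξ (M.counit m))

/-- Composition of a comodule map to `C` with the counit. -/
def counitComp (f : M →ₗ[Aᵐᵒᵖ] regular A C) : Dual A M :=
  (⟨(Coring.counit (A := A) (C := C)).toAddHom, Coring.counit_op_smul⟩ : C →ₗ[Aᵐᵒᵖ] A).comp f

theorem toRegular_counitComp {f : M →ₗ[Aᵐᵒᵖ] regular A C} (hf : IsColinear f) :
    toRegular (counitComp f) = f := by
  ext m
  have key : ∀ z : ATensor A M C, contract (counitComp f) z =
      contract (X := regular A C)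
        (⟨(Coring.counit (A := A) (C := C)).toAddHom, Coring.counit_op_smul⟩ : C →ₗ[Aᵐᵒᵖ] A)
        (ATensor.rmap f z) := by
    intro z
    induction z using ATensor.induction with
    | zero => simp
    | pure m n => simp [contract, counitComp]
    | add x y hx hy => simp only [map_add, hx, hy]
  refine (key _).trans ?_
  rw [← hf]
  exact Coring.counit_left _

end Comod

end ComodBasics

/-! ### Monomorphisms, epimorphisms and isomorphisms of comodules. -/

section ComodCategory

variable {A C : Type u} [Ring A] [AddCommGroup C] [Module A C] [Module Aᵐᵒᵖ C]
  [SMulCommClass A Aᵐᵒᵖ C] [Coring A C]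

namespace Comod

variable {M N P : Comod A C}

/-- The morphism of comodules given by a colinear map. -/
def IsColinear.hom {f : M →ₗ[Aᵐᵒᵖ] N} (hf : IsColinear f) : M ⟶ N := Hom.mk f hf

theorem hom_ext {f g : M ⟶ N} (h : ∀ m, f.lin m = g.lin m) : f = g :=
  Hom.ext (LinearMap.ext h)

theorem mono_of_injective (f : M ⟶ N) (hf : Function.Injective f.lin) : Mono f :=
  ⟨fun _ _ hab => hom_ext fun m => hf congr(($hab).lin m)⟩

theorem epi_of_surjective (f : M ⟶ N) (hf : Function.Surjective f.lin) : Epi f :=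
  ⟨fun _ _ hab => hom_ext fun n => by
    obtain ⟨m, rfl⟩ := hf n
    exact congr(($hab).lin m)⟩

theorem stable_ker {f : M →ₗ[Aᵐᵒᵖ] N} (hf : IsColinear f) : Stable (LinearMap.ker f) :=
  fun φ m hm => by rw [LinearMap.mem_ker, hf.hit, LinearMap.mem_ker.1 hm, map_zero]

theorem stable_range {f : M →ₗ[Aᵐᵒᵖ] N} (hf : IsColinear f) : Stable (LinearMap.range f) := by
  rintro φ _ ⟨m, rfl⟩
  exact ⟨M.hit φ m, hf.hit φ m⟩

theorem Stable.map {E : Submodule Aᵐᵒᵖ M} (hE : Stable E) {f : M →ₗ[Aᵐᵒᵖ] N} (hf : IsColinear f) :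
    Stable (E.map f) := by
  rintro φ _ ⟨m, hm, rfl⟩
  exact ⟨M.hit φ m, hE φ m hm, hf.hit φ m⟩

theorem stable_iSup {ι : Sort*} {E : ι → Submodule Aᵐᵒᵖ M} (hE : ∀ i, Stable (E i)) :
    Stable (⨆ i, E i) := by
  intro φ m hm
  induction hm using Submodule.iSup_induction' with
  | mem i x hx => exact Submodule.mem_iSup_of_mem i (hE i φ x hx)
  | zero => simp
  | add x y _ _ hx hy => rw [map_add]; exact add_mem hx hy

theorem Stable.sup {E F : Submodule Aᵐᵒᵖ M} (hE : Stable E) (hF : Stable F) : Stable (E ⊔ F) := by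
  rw [sup_eq_iSup]
  exact stable_iSup fun b => by cases b <;> assumption

theorem stable_span {s : Set M} (hs : ∀ m ∈ s, ∀ φ, M.hit φ m ∈ Submodule.span Aᵐᵒᵖ s) :
    Stable (Submodule.span Aᵐᵒᵖ s) := by
  intro φ m hm
  induction hm using Submodule.span_induction generalizing φ with
  | mem x hx => exact hs x hx φ
  | zero => simp
  | add x y _ _ hx hy => rw [map_add]; exact add_mem (hx φ) (hy φ)
  | smul b x _ hx => rw [hit_smul]; exact hx _

/-- The kernel is a subcomodule, and its inclusion and the zero map agree after composition with
`f`. -/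
theorem injective_of_mono (h : HasLocalDualBases A C) (f : M ⟶ N) [Mono f] :
    Function.Injective f.lin := by
  rw [← LinearMap.ker_eq_bot, eq_bot_iff]
  intro m hm
  have hK := stable_ker f.colinear
  have : (hK.subtype_colinear h).hom = (IsColinear.zero (M := hK.sub h) (N := M)).hom := by
    rw [← cancel_mono f]
    refine hom_ext fun x => ?_
    refine Eq.trans (LinearMap.mem_ker.1 x.2) ?_
    exact (map_zero f.lin).symm
  exact congr(($this).lin ⟨m, hm⟩)

/-- Dually, the projection onto the cokernel agrees with zero on the range. -/
theorem surjective_of_epi (h : HasLocalDualBases A C) (f : M ⟶ N) [Epi f] :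
    Function.Surjective f.lin := by
  have hK := stable_range f.colinear
  have : (hK.mkQ_colinear h).hom = (IsColinear.zero (M := N) (N := hK.quot h)).hom := by
    rw [← cancel_epi f]
    refine hom_ext fun x => ?_
    exact (Submodule.Quotient.mk_eq_zero _).2 ⟨x, rfl⟩
  intro n
  exact (Submodule.Quotient.mk_eq_zero _).1 congr(($this).lin n)

theorem isIso_of_bijective (h : HasLocalDualBases A C) (f : M ⟶ N)
    (hf : Function.Bijective f.lin) : IsIso f := by
  let e := LinearEquiv.ofBijective f.lin hf
  have he : IsColinear (M := N) (N := M) e.symm.toLinearMap := isColinear_of_hit h fun φ n => by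
    obtain ⟨m, rfl⟩ := e.surjective n
    apply e.injective
    change e (e.symm (N.hit φ (e m))) = e (M.hit φ (e.symm (e m)))
    rw [e.apply_symm_apply, e.symm_apply_apply]
    exact (f.colinear.hit φ m).symm
  exact ⟨he.hom, hom_ext fun m => e.symm_apply_apply m, hom_ext fun m => e.apply_symm_apply m⟩

theorem bijective_of_isIso (f : M ⟶ N) [IsIso f] : Function.Bijective f.lin :=
  Function.bijective_iff_has_inverse.2 ⟨(inv f).lin, fun m => congr(($(IsIso.hom_inv_id f)).lin m),
    fun m => congr(($(IsIso.inv_hom_id f)).lin m)⟩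

/-! ### Finiteness -/

/-- The subcomodule generated by an element. -/
def gen (m : M) : Submodule Aᵐᵒᵖ M := Submodule.span Aᵐᵒᵖ (Set.range fun φ => M.hit φ m)

theorem mem_gen (m : M) : m ∈ gen m := Submodule.subset_span ⟨Coring.counit, hit_counit m⟩

theorem stable_gen (m : M) : Stable (gen m) := stable_span (by
  rintro _ ⟨φ, rfl⟩ ψ
  exact Submodule.subset_span ⟨_, (hit_hit φ ψ m).symm⟩)

/-- With `ρ(m) = ∑ m_c ⊗ c` a finite dual basis expansion, `hit ψ m = ∑ m_c ψ(c)` for every `ψ`, and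
each `m_c` is itself of the form `hit φ_c m`. -/
theorem fg_gen (h : HasLocalDualBases A C) (m : M) : (gen m).FG := by
  classical
  obtain ⟨t, φ, ht⟩ := ATensor.exists_eq_sum_slice h (M.coact m)
  refine ⟨t.image fun c => M.hit (φ c) m, le_antisymm (Submodule.span_le.2 ?_)
    (Submodule.span_le.2 ?_)⟩
  · intro x hx
    obtain ⟨c, _, rfl⟩ := Finset.mem_image.1 hx
    exact Submodule.subset_span ⟨φ c, rfl⟩
  · rintro _ ⟨ψ, rfl⟩
    change ATensor.slice ψ (M.coact m) ∈ _
    rw [ht, map_sum]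
    refine Submodule.sum_mem _ fun c hc => ?_
    rw [ATensor.slice_tmul]
    exact Submodule.smul_mem _ _ (Submodule.subset_span (Finset.mem_image_of_mem _ hc))

theorem Stable.gen_le {E : Submodule Aᵐᵒᵖ M} (hE : Stable E) {m : M} (hm : m ∈ E) : gen m ≤ E :=
  Submodule.span_le.2 (by rintro _ ⟨φ, rfl⟩; exact hE φ m hm)

theorem subobject_eq_top (h : HasLocalDualBases A C) {E : Comod A C} (S : Subobject E)
    (hS : Function.Surjective S.arrow.lin) : S = ⊤ := by
  have := isIso_of_bijective h S.arrow ⟨injective_of_mono h _, hS⟩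
  exact Subobject.eq_top_of_isIso_arrow S

theorem Stable.mono (h : HasLocalDualBases A C) {E : Submodule Aᵐᵒᵖ M} (hE : Stable E) :
    Mono (hE.subtype_colinear h).hom := mono_of_injective _ E.injective_subtype

/-- The sum of the images of the subobjects is stable, hence underlies a subobject that bounds the
family. So it is everything, and compactness of the finitely generated module picks out one member.
-/
theorem isFinGen_of_fg (h : HasLocalDualBases A C) (E : Comod A C)
    (hE : (⊤ : Submodule Aᵐᵒᵖ E).FG) : IsFinGen E := by
  intro F hne hdir hlub
  let o : Subobject E → Submodule Aᵐᵒᵖ E := fun S => LinearMap.range S.arrow.lin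
  have ho : Monotone o := by
    rintro S T hST _ ⟨x, rfl⟩
    exact ⟨(Subobject.ofLE S T hST).lin x, congr(($(Subobject.ofLE_arrow hST)).lin x)⟩
  have hU : Stable (⨆ S : F, o S) := stable_iSup fun S => stable_range S.1.arrow.colinear
  have := hU.mono h
  have htop : Subobject.mk (hU.subtype_colinear h).hom = ⊤ := by
    refine top_le_iff.1 (hlub.2 fun S hS => ?_)
    refine Subobject.le_mk_of_comm (hU.codRestrict_colinear h S.arrow.colinear
      fun x => Submodule.mem_iSup_of_mem ⟨S, hS⟩ ⟨x, rfl⟩).hom ?_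
    exact hom_ext fun x => rfl
  have hU' : (⨆ S : F, o S) = ⊤ := by
    rw [eq_top_iff]
    intro x _
    have := (Subobject.isIso_iff_mk_eq_top _).2 htop
    obtain ⟨y, rfl⟩ := (bijective_of_isIso (hU.subtype_colinear h).hom).2 x
    exact y.2
  have hk := (Submodule.fg_iff_compact _).1 hE
  obtain ⟨_, ⟨S, hS, rfl⟩, hle⟩ := (CompleteLattice.isCompactElement_iff_le_of_directed_sSup_le
      _ _).1 hk (o '' F) (hne.image _) (by
        rintro _ ⟨S, hS, rfl⟩ _ ⟨T, hT, rfl⟩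
        obtain ⟨W, hW, h1, h2⟩ := hdir S hS T hT
        exact ⟨o W, ⟨W, hW, rfl⟩, ho h1, ho h2⟩) (by
        rw [sSup_image, ← iSup_subtype'', hU'])
  rw [← subobject_eq_top h S fun x => hle (Submodule.mem_top (x := x))]
  exact hS

/-- Converts the categorical condition into one about elements, so that it applies to loci such as
the fixed points of a ring element. -/
theorem _root_.Galois.IsFinGen.exists_eq_top (h : HasLocalDualBases A C) {E : Comod A C}
    (hE : IsFinGen E) {ι : Type*} [Nonempty ι] (U : ι → Submodule Aᵐᵒᵖ E)
    (hU : ∀ i, Stable (U i)) (hdir : Directed (· ≤ ·) U) (hunion : ∀ x, ∃ i, x ∈ U i) :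
    ∃ i, U i = ⊤ := by
  have hm := fun i => (hU i).mono h
  obtain ⟨i, hi⟩ := hE (Set.range fun i => Subobject.mk ((hU i).subtype_colinear h).hom)
    (Set.range_nonempty _) (by
      rintro _ ⟨i, rfl⟩ _ ⟨j, rfl⟩
      obtain ⟨k, hik, hjk⟩ := hdir i j
      refine ⟨_, ⟨k, rfl⟩, ?_, ?_⟩
      · exact Subobject.mk_le_mk_of_comm ((hU k).codRestrict_colinear h
          ((hU i).subtype_colinear h) fun x => hik x.2).hom (hom_ext fun x => rfl)
      · exact Subobject.mk_le_mk_of_comm ((hU k).codRestrict_colinear h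
          ((hU j).subtype_colinear h) fun x => hjk x.2).hom (hom_ext fun x => rfl))
    ⟨fun _ _ => le_top, fun S hS => by
      rw [subobject_eq_top h S]
      intro x
      obtain ⟨i, hi⟩ := hunion x
      have hle := hS ⟨i, rfl⟩
      refine ⟨(Subobject.ofMkLE _ S hle).lin ⟨x, hi⟩, ?_⟩
      exact congr(($(Subobject.ofMkLE_arrow hle)).lin ⟨x, hi⟩)⟩
  refine ⟨i, eq_top_iff.2 fun x _ => ?_⟩
  have := (Subobject.isIso_iff_mk_eq_top _).2 hi
  obtain ⟨y, rfl⟩ := (bijective_of_isIso ((hU i).subtype_colinear h).hom).2 x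
  exact y.2

/-! ### Generators -/

/-- The sum of the images of all morphisms `X → M`. -/
def trace (X M : Comod A C) : Submodule Aᵐᵒᵖ M :=
  ⨆ f : X ⟶ M, LinearMap.range f.lin

/-- Every morphism from `X` dies in the quotient by the trace, so the separator forces the
projection to vanish. -/
theorem trace_eq_top (h : HasLocalDualBases A C) {X : Comod A C} (hX : IsSeparator X)
    (M : Comod A C) : trace X M = ⊤ := by
  have hT : Stable (trace X M) := stable_iSup fun f => stable_range f.colinear
  have := (isSeparator_def X).1 hX (hT.mkQ_colinear h).hom
    (IsColinear.zero (M := M) (N := hT.quot h)).hom (fun f => hom_ext fun x =>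
      (Submodule.Quotient.mk_eq_zero _).2 (Submodule.mem_iSup_of_mem f ⟨x, rfl⟩))
  exact eq_top_iff.2 fun m _ => (Submodule.Quotient.mk_eq_zero _).1 congr(($this).lin m)

theorem exists_eq_sum_of_isSeparator (h : HasLocalDualBases A C) {X : Comod A C}
    (hX : IsSeparator X) (m : M) : ∃ (L : Type u) (_ : Fintype L) (k : L → X →ₗ[Aᵐᵒᵖ] M) (w : L → X),
      (∀ l, IsColinear (k l)) ∧ m = ∑ l, k l (w l) := by
  have hm : m ∈ trace X M := trace_eq_top h hX M ▸ Submodule.mem_top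
  induction hm using Submodule.iSup_induction' with
  | mem f x hx =>
    obtain ⟨y, rfl⟩ := hx
    exact ⟨PUnit, inferInstance, fun _ => f.lin, fun _ => y, fun _ => f.colinear, by simp⟩
  | zero => exact ⟨PEmpty, inferInstance, PEmpty.elim, PEmpty.elim, fun l => l.elim, by simp⟩
  | add x y _ _ hx hy =>
    obtain ⟨L, _, k, w, hk, rfl⟩ := hx
    obtain ⟨L', _, k', w', hk', rfl⟩ := hy
    exact ⟨L ⊕ L', inferInstance, Sum.elim k k', Sum.elim w w',
      fun l => by cases l <;> simp [hk, hk'], by simp [Fintype.sum_sum_type]⟩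

theorem isSeparator_of_exists_eq_sum {X : Comod A C}
    (H : ∀ (M : Comod A C) (m : M), m ∈ trace X M) : IsSeparator X := by
  rw [isSeparator_def]
  intro M N f g hfg
  refine hom_ext fun m => ?_
  have hm := H M m
  induction hm using Submodule.iSup_induction' with
  | mem k x hx =>
    obtain ⟨y, rfl⟩ := hx
    exact congr(($(hfg k)).lin y)
  | zero => simp
  | add x y _ _ hx hy => rw [map_add, map_add, hx, hy]

end Comod

end ComodCategory

/-! ### Firm modules over a ring with left local units. -/

section RModules

variable {R : Type u} [NonUnitalRing R] {F : Type u} [AddCommGroup F]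

theorem lact_mul (l : R →ₙ+* AddMonoid.End F) (r s : R) (x : F) :
    lact l (r * s) x = lact l r (lact l s x) := by
  unfold lact
  rw [map_mul]; rfl

theorem lact_add (l : R →ₙ+* AddMonoid.End F) (r s : R) (x : F) :
    lact l (r + s) x = lact l r x + lact l s x := by
  unfold lact
  rw [map_add]; rfl

variable (R) in
/-- The left multiplication of `R` on itself. -/
def mulLeftHom : R →ₙ+* AddMonoid.End R where
  toFun r := AddMonoidHom.mulLeft r
  map_mul' r s := by ext x; exact mul_assoc r s x
  map_zero' := by ext x; exact zero_mul x
  map_add' r s := by ext x; exact add_mul r s x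

/-- The multiplication map `R ⊗_R F → F`. -/
def leftMul (l : R →ₙ+* AddMonoid.End F) :
    BalTensor (fun r : R => AddMonoidHom.mulRight r) (lact l) →+ F :=
  BalTensor.lift (AddMonoidHom.mk' (lact l) (fun a b => map_add l a b))
    (fun s r x => lact_mul l r s x)

@[simp]
theorem leftMul_tmul (l : R →ₙ+* AddMonoid.End F) (r : R) (x : F) :
    leftMul l (BalTensor.tmul _ _ r x) = lact l r x := rfl

theorem HasLeftLocalUnits.exists_left_unit (hR : HasLeftLocalUnits R) (r : R) : ∃ e, e * r = r := by
  obtain ⟨e, he⟩ := hR {r}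
  exact ⟨e, he r (by simp)⟩

/-- A common left unit `e` of the ring elements in a presentation of `z` gives `z = e ⊗ μ(z)`, where
`μ` is multiplication; so `μ` is injective. -/
theorem HasLeftLocalUnits.isFirmLeft (hR : HasLeftLocalUnits R) {l : R →ₙ+* AddMonoid.End F}
    (hl : ∀ x, ∃ r, lact l r x = x) : IsFirmLeft l := by
  classical
  change Function.Bijective (leftMul l)
  refine ⟨(injective_iff_map_eq_zero _).2 fun z hz => ?_, fun x => ?_⟩
  · obtain ⟨s, hs⟩ : ∃ s : Finset R, ∀ e, (∀ r ∈ s, e * r = r) →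
        z = BalTensor.tmul _ _ e (leftMul l z) := by
      clear hz
      induction z using BalTensor.induction with
      | zero => exact ⟨∅, by simp⟩
      | pure r x =>
        refine ⟨{r}, fun e he => ?_⟩
        rw [leftMul_tmul, ← BalTensor.tmul_balanced]
        change _ = BalTensor.tmul _ _ (e * r) x
        rw [he r (by simp)]
      | add x y hx hy =>
        obtain ⟨s, hs⟩ := hx
        obtain ⟨t, ht⟩ := hy
        refine ⟨s ∪ t, fun e he => ?_⟩
        rw [map_add, map_add, ← hs e fun r hr => he r (by simp [hr]),
          ← ht e fun r hr => he r (by simp [hr])]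
    obtain ⟨e, he⟩ := hR s
    rw [hs e he, hz, map_zero]
  · obtain ⟨r, hr⟩ := hl x
    exact ⟨BalTensor.tmul _ _ r x, hr⟩

namespace RMod

theorem hom_ext {M N : RMod R} {f g : M ⟶ N} (h : ∀ m, f.toHom m = g.toHom m) : f = g :=
  Hom.ext (AddMonoidHom.ext h)

theorem comp_apply {M N P : RMod R} (f : M ⟶ N) (g : N ⟶ P) (m : M) :
    (f ≫ g).toHom m = g.toHom (f.toHom m) := rfl

theorem ract_add_apply (M : RMod R) (a b : R) (m : M) :
    M.ract (a + b) m = M.ract a m + M.ract b m := by rw [ract_add]; rfl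

/-- A right `R`-module from its action maps. -/
@[reducible] def ofRact (P : Type u) [AddCommGroup P] (ρ : R → P →+ P)
    (hadd : ∀ a b m, ρ (a + b) m = ρ a m + ρ b m)
    (hmul : ∀ a b m, ρ (a * b) m = ρ b (ρ a m)) : RMod R where
  carrier := P
  act :=
    { toFun := fun r => ρ r.unop
      map_mul' := fun r s => AddMonoidHom.ext fun m => hmul s.unop r.unop m
      map_zero' := AddMonoidHom.ext fun m => by
        have := hadd 0 0 m
        rw [add_zero, left_eq_add] at this
        exact this
      map_add' := fun r s => AddMonoidHom.ext fun m => hadd r.unop s.unop m }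

/-- The submodule on a stable subgroup. -/
abbrev sub (M : RMod R) (K : AddSubgroup M) (hK : ∀ r, ∀ m ∈ K, M.ract r m ∈ K) : RMod R :=
  ofRact K (fun r => ((M.ract r).comp K.subtype).codRestrict K fun m => hK r m m.2)
    (fun a b m => Subtype.ext (M.ract_add_apply a b m))
    (fun a b m => Subtype.ext (M.ract_mul a b m))

/-- The inclusion of a submodule. -/
def subι (M : RMod R) (K : AddSubgroup M) (hK : ∀ r, ∀ m ∈ K, M.ract r m ∈ K) :
    M.sub K hK ⟶ M := Hom.mk K.subtype fun _ _ => rfl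

/-- The quotient by a stable subgroup. -/
abbrev quot (M : RMod R) (K : AddSubgroup M) (hK : ∀ r, ∀ m ∈ K, M.ract r m ∈ K) : RMod R :=
  ofRact (M ⧸ K) (fun r => QuotientAddGroup.map K K (M.ract r) fun m hm => hK r m hm)
    (fun a b m => by
      obtain ⟨m, rfl⟩ := QuotientAddGroup.mk_surjective m
      exact congrArg _ (M.ract_add_apply a b m))
    (fun a b m => by
      obtain ⟨m, rfl⟩ := QuotientAddGroup.mk_surjective m
      exact congrArg _ (M.ract_mul a b m))

/-- The projection to a quotient module. -/
def quotπ (M : RMod R) (K : AddSubgroup M) (hK : ∀ r, ∀ m ∈ K, M.ract r m ∈ K) :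
    M ⟶ M.quot K hK := Hom.mk (QuotientAddGroup.mk' K) fun _ _ => rfl

theorem ract_mem_ker {M N : RMod R} (f : M ⟶ N) (r : R) (m : M) (hm : m ∈ f.toHom.ker) :
    M.ract r m ∈ f.toHom.ker := by
  rw [AddMonoidHom.mem_ker] at hm ⊢
  rw [f.linear, hm, map_zero]

theorem ract_mem_range {M N : RMod R} (f : M ⟶ N) (r : R) (n : N) (hn : n ∈ f.toHom.range) :
    N.ract r n ∈ f.toHom.range := by
  obtain ⟨m, rfl⟩ := hn
  exact ⟨M.ract r m, f.linear r m⟩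

/-- The right module `M ⊗_R R`. -/
def tensorR (M : RMod R) : RMod R :=
  ofRact (BalTensor M.ract (fun r : R => AddMonoidHom.mulLeft r))
    (fun r => BalTensor.map (AddMonoidHom.id _) (AddMonoidHom.mulRight r) (fun _ _ => rfl)
      (fun s t => mul_assoc s t r))
    (fun a b z => by
      induction z using BalTensor.induction with
      | zero => simp
      | pure m r => exact (congrArg (BalTensor.tmul _ _ m) (mul_add r a b)).trans (map_add _ _ _)
      | add x y hx hy => rw [map_add, map_add, map_add, hx, hy]; abel)
    (fun a b z => by
      induction z using BalTensor.induction with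
      | zero => simp
      | pure m r => exact congrArg (BalTensor.tmul _ _ m) (mul_assoc r a b).symm
      | add x y hx hy => rw [map_add, map_add, map_add, hx, hy])

/-- The pure tensors in `M ⊗_R R`. -/
def tmulR (M : RMod R) : M →+ R →+ M.tensorR := BalTensor.tmul _ _

@[elab_as_elim]
theorem tensorR_induction {M : RMod R} {p : M.tensorR → Prop} (z : M.tensorR)
    (zero : p 0) (pure : ∀ m r, p (M.tmulR m r)) (add : ∀ x y, p x → p y → p (x + y)) : p z :=
  BalTensor.induction z zero pure add

theorem tmulR_balanced (M : RMod R) (s : R) (m : M) (r : R) :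
    M.tmulR (M.ract s m) r = M.tmulR m (s * r) := BalTensor.tmul_balanced s m r

@[simp]
theorem ract_tmulR (M : RMod R) (s : R) (m : M) (r : R) :
    M.tensorR.ract s (M.tmulR m r) = M.tmulR m (r * s) := rfl

/-- The universal property of `M ⊗_R R`. -/
def liftR {M : RMod R} {P : Type*} [AddCommGroup P] (f : M →+ R →+ P)
    (hf : ∀ s m r, f (M.ract s m) r = f m (s * r)) : M.tensorR →+ P :=
  BalTensor.lift f hf

/-- The multiplication map `M ⊗_R R → M`. -/
def mulR (M : RMod R) : M.tensorR ⟶ M where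
  toHom := liftR (AddMonoidHom.flip (AddMonoidHom.mk' (fun r : R => M.ract r) M.ract_add))
    (fun s m r => (M.ract_mul s r m).symm)
  linear r z := by
    induction z using tensorR_induction with
    | zero => simp
    | pure m s => exact M.ract_mul s r m
    | add x y hx hy => rw [map_add, map_add, map_add, hx, hy, map_add]

@[simp]
theorem mulR_tmulR (M : RMod R) (m : M) (r : R) : M.mulR.toHom (M.tmulR m r) = M.ract r m := rfl

/-- Consequently `R` annihilates the kernel of `M ⊗_R R → M`. -/
theorem ract_eq_tmulR (M : RMod R) (s : R) (z : M.tensorR) :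
    M.tensorR.ract s z = M.tmulR (M.mulR.toHom z) s := by
  induction z using tensorR_induction with
  | zero => simp
  | pure m r => rw [ract_tmulR, mulR_tmulR, tmulR_balanced]
  | add x y hx hy => rw [map_add, hx, hy, map_add, map_add]; rfl

/-- The map `f ⊗_R R`. -/
def mapR {M N : RMod R} (f : M ⟶ N) : M.tensorR ⟶ N.tensorR where
  toHom := liftR (N.tmulR.comp f.toHom) fun s m r => by
    change N.tmulR (f.toHom (M.ract s m)) r = N.tmulR (f.toHom m) (s * r)
    rw [f.linear, tmulR_balanced]
  linear r z := by
    induction z using tensorR_induction with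
    | zero => simp
    | pure m s => rfl
    | add x y hx hy => rw [map_add, map_add, map_add, hx, hy, map_add]

@[simp]
theorem mapR_tmulR {M N : RMod R} (f : M ⟶ N) (m : M) (r : R) :
    (mapR f).toHom (M.tmulR m r) = N.tmulR (f.toHom m) r := rfl

theorem mulR_mapR {M N : RMod R} (f : M ⟶ N) (z : M.tensorR) :
    N.mulR.toHom ((mapR f).toHom z) = f.toHom (M.mulR.toHom z) := by
  induction z using tensorR_induction with
  | zero => simp
  | pure m s => exact (f.linear s m).symm
  | add x y hx hy => simp only [map_add, hx, hy]

theorem isFirm_iff (M : RMod R) : IsFirm M ↔ Function.Bijective M.mulR.toHom := Iff.rfl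

/-- The biadditive map `(m ⊗ r, x) ↦ m ⊗ r x`. -/
def tensorAssocAux (l : R →ₙ+* AddMonoid.End F) (M : RMod R) :
    M.tensorR →+ F →+ BalTensor M.ract (lact l) :=
  liftR (AddMonoidHom.mk' (fun m => AddMonoidHom.mk' (fun r => (BalTensor.tmul _ _ m).comp (lact l r))
      (fun r s => by ext x; simp [lact_add])) (fun m n => by ext r x; simp))
    (fun r m s => by
      ext x
      change BalTensor.tmul _ _ (M.ract r m) (lact l s x) = BalTensor.tmul _ _ m (lact l (r * s) x)
      rw [BalTensor.tmul_balanced, lact_mul])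

theorem tensorAssocAux_ract (l : R →ₙ+* AddMonoid.End F) (M : RMod R) (s : R) (z : M.tensorR)
    (x : F) : tensorAssocAux l M (M.tensorR.ract s z) x = tensorAssocAux l M z (lact l s x) := by
  induction z using tensorR_induction with
  | zero => simp
  | pure m r =>
    change BalTensor.tmul _ _ m (lact l (r * s) x) = BalTensor.tmul _ _ m (lact l r (lact l s x))
    rw [lact_mul]
  | add x y hx hy => rw [map_add, map_add, map_add, AddMonoidHom.add_apply,
      AddMonoidHom.add_apply, hx, hy]

/-- The map `(M ⊗_R R) ⊗_R F → M ⊗_R F`, `(m ⊗ r) ⊗ x ↦ m ⊗ r x`. -/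
def tensorAssoc (l : R →ₙ+* AddMonoid.End F) (M : RMod R) :
    BalTensor M.tensorR.ract (lact l) →+ BalTensor M.ract (lact l) :=
  BalTensor.lift (tensorAssocAux l M) (tensorAssocAux_ract l M)

theorem tensorAssoc_eq (l : R →ₙ+* AddMonoid.End F) (M : RMod R)
    (z : BalTensor M.tensorR.ract (lact l)) : tensorAssoc l M z = tensorMap l M.mulR z := by
  induction z using BalTensor.induction with
  | zero => simp
  | pure w x =>
    induction w using tensorR_induction with
    | zero => simp
    | pure m r =>
      exact (BalTensor.tmul_balanced r m x).symm
    | add x y hx hy => simp only [map_add, AddMonoidHom.add_apply, hx, hy]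
  | add x y hx hy => simp only [map_add, hx, hy]

/-- The map `R ⊗_R F → (M ⊗_R R) ⊗_R F`, `r ⊗ x ↦ (m ⊗ r) ⊗ x`. -/
def insertLeft (l : R →ₙ+* AddMonoid.End F) (M : RMod R) (m : M) :
    BalTensor (fun r : R => AddMonoidHom.mulRight r) (lact l) →+
      BalTensor M.tensorR.ract (lact l) :=
  BalTensor.map (M.tmulR m) (AddMonoidHom.id F) (fun _ _ => rfl) (fun _ _ => rfl)

/-- This is `M ⊗ (R ⊗ F) ≅ M ⊗ F`: the inverse writes `x` as an element of `R ⊗_R F` by firmness and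
moves the ring factors to `M`. -/
theorem tensorAssoc_bijective {l : R →ₙ+* AddMonoid.End F} (hl : IsFirmLeft l) (M : RMod R) :
    Function.Bijective (tensorAssoc l M) := by
  let e : BalTensor (fun r : R => AddMonoidHom.mulRight r) (lact l) ≃+ F :=
    AddEquiv.ofBijective (leftMul l) hl
  have he : ∀ r x, e.symm (lact l r x) = BalTensor.tmul _ _ r x := fun r x =>
    e.symm_apply_eq.2 rfl
  have hadd : ∀ m n z, insertLeft l M (m + n) z = insertLeft l M m z + insertLeft l M n z := by
    intro m n z
    induction z using BalTensor.induction with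
    | zero => simp
    | pure r x =>
      change BalTensor.tmul _ _ (M.tmulR (m + n) r) x =
        BalTensor.tmul _ _ (M.tmulR m r) x + BalTensor.tmul _ _ (M.tmulR n r) x
      rw [map_add, AddMonoidHom.add_apply, map_add, AddMonoidHom.add_apply]
    | add x y hx hy => rw [map_add, map_add, map_add, hx, hy]; abel
  have hbal : ∀ (s : R) m z, insertLeft l M (M.ract s m) z =
      insertLeft l M m (e.symm (lact l s (e z))) := by
    intro s m z
    induction z using BalTensor.induction with
    | zero => simp
    | pure r x =>
      change BalTensor.tmul _ _ (M.tmulR (M.ract s m) r) x = insertLeft l M m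
        (e.symm (lact l s (lact l r x)))
      rw [← lact_mul, he, tmulR_balanced]
      rfl
    | add x y hx hy => simp only [map_add, hx, hy]
  let inv : BalTensor M.ract (lact l) →+ BalTensor M.tensorR.ract (lact l) :=
    BalTensor.lift (AddMonoidHom.mk' (fun m => (insertLeft l M m).comp e.symm.toAddMonoidHom)
      (fun m n => by ext x; exact hadd m n _))
      (fun s m x => by
        change insertLeft l M (M.ract s m) (e.symm x) = insertLeft l M m (e.symm (lact l s x))
        rw [hbal, e.apply_symm_apply])
  refine Function.bijective_iff_has_inverse.2 ⟨inv, fun z => ?_, fun z => ?_⟩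
  · change (inv.comp (tensorAssoc l M)) z = AddMonoidHom.id _ z
    congr 1
    ext w x
    change inv (tensorAssoc l M (BalTensor.tmul _ _ w x)) = BalTensor.tmul _ _ w x
    induction w using tensorR_induction with
    | zero => simp
    | pure m r =>
      change insertLeft l M m (e.symm (lact l r x)) = _
      rw [he]
      rfl
    | add x y hx hy => simp only [map_add, AddMonoidHom.add_apply, hx, hy]
  · have key : ∀ m w, tensorAssoc l M (insertLeft l M m w) = BalTensor.tmul _ _ m (e w) := by
      intro m w
      induction w using BalTensor.induction with
      | zero => simp
      | pure r x => rfl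
      | add x y hx hy => simp only [map_add, hx, hy]
    induction z using BalTensor.induction with
    | zero => simp
    | pure m x =>
      change tensorAssoc l M (insertLeft l M m (e.symm x)) = _
      rw [key, e.apply_symm_apply]
    | add x y hx hy => simp only [map_add, hx, hy]

/-- Replacing `M` by `M ⊗_R R` is invisible after tensoring with a firm `F`. Thus arbitrary modules
such as kernels and Hom groups may be replaced by firm ones. -/
theorem tensorMap_mulR_bijective {l : R →ₙ+* AddMonoid.End F} (hl : IsFirmLeft l) (M : RMod R) :
    Function.Bijective (tensorMap l M.mulR) := by
  have : ⇑(tensorMap l M.mulR) = tensorAssoc l M := funext fun z => (tensorAssoc_eq l M z).symm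
  rw [this]
  exact tensorAssoc_bijective hl M

/-- The preceding statement for `F = R`: on `(M ⊗_R R) ⊗_R R` multiplication coincides with `mulR ⊗
R`. -/
theorem isFirm_tensorR (hR : HasLeftLocalUnits R) (M : RMod R) : IsFirm M.tensorR := by
  have h := tensorMap_mulR_bijective (hR.isFirmLeft (l := mulLeftHom R) hR.exists_left_unit) M
  rw [isFirm_iff]
  suffices ⇑M.tensorR.mulR.toHom = tensorMap (mulLeftHom R) M.mulR by rw [this]; exact h
  funext z
  change _ = (mapR M.mulR).toHom z
  induction z using tensorR_induction with
  | zero => simp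
  | pure w s => rw [mulR_tmulR, ract_eq_tmulR]; rfl
  | add x y hx hy => simp only [map_add, hx, hy]

variable (R) in
/-- `R` as a right module over itself. -/
@[reducible] def self : RMod R :=
  ofRact R (fun r => AddMonoidHom.mulRight r) (fun a b m => mul_add m a b)
    (fun a b m => (mul_assoc m a b).symm)

theorem isFirm_self (hR : HasLeftLocalUnits R) : IsFirm (self R) :=
  hR.isFirmLeft (l := mulLeftHom R) hR.exists_left_unit

/-- The morphism `R → M`, `r ↦ m r`. -/
def ofElem {M : RMod R} (m : M) : self R ⟶ M where
  toHom := AddMonoidHom.mk' (fun r => M.ract r m) (fun a b => M.ract_add_apply a b m)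
  linear r s := M.ract_mul s r m

@[elab_as_elim]
theorem IsFirm.induction {M : RMod R} (hM : IsFirm M) {p : M → Prop} (m : M) (zero : p 0)
    (ract : ∀ r m, p (M.ract r m)) (add : ∀ x y, p x → p y → p (x + y)) : p m := by
  obtain ⟨z, rfl⟩ := ((isFirm_iff M).1 hM).2 m
  induction z using tensorR_induction with
  | zero => simpa using zero
  | pure m s => exact ract s m
  | add x y hx hy => rw [map_add]; exact add _ _ hx hy

theorem IsFirm.eq_zero {M N : RMod R} (hM : IsFirm M) {f : M ⟶ N}
    (h : ∀ (r : R) m, N.ract r (f.toHom m) = 0) (m : M) : f.toHom m = 0 := by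
  induction m using hM.induction with
  | zero => simp
  | ract r m => rw [f.linear, h]
  | add x y hx hy => rw [map_add, hx, hy, add_zero]

/-- The isomorphism `M ⊗_R R ≃ M` for a firm module. -/
noncomputable def IsFirm.equiv {W : RMod R} (hW : IsFirm W) : W.tensorR ≃+ W :=
  AddEquiv.ofBijective W.mulR.toHom hW

theorem IsFirm.equiv_symm_ract {W : RMod R} (hW : IsFirm W) (r : R) (w : W) :
    hW.equiv.symm (W.ract r w) = W.tmulR w r := hW.equiv.symm_apply_eq.2 rfl

/-- The lift of a morphism `f : W → M` from a firm module to `M ⊗_R R`. -/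
noncomputable def IsFirm.lift {W M : RMod R} (hW : IsFirm W) (f : W ⟶ M) : W ⟶ M.tensorR :=
  Hom.mk hW.equiv.symm.toAddMonoidHom (fun r w => by
    change hW.equiv.symm (W.ract r w) = W.tensorR.ract r (hW.equiv.symm w)
    rw [hW.equiv_symm_ract, ract_eq_tmulR]
    exact congrArg (fun x => W.tmulR x r) (hW.equiv.apply_symm_apply w).symm) ≫ mapR f

theorem IsFirm.lift_ract {W M : RMod R} (hW : IsFirm W) (f : W ⟶ M) (r : R) (w : W) :
    (hW.lift f).toHom (W.ract r w) = M.tmulR (f.toHom w) r := by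
  change (mapR f).toHom (hW.equiv.symm (W.ract r w)) = _
  rw [hW.equiv_symm_ract, mapR_tmulR]

theorem IsFirm.lift_mulR {W M : RMod R} (hW : IsFirm W) (f : W ⟶ M) : hW.lift f ≫ M.mulR = f :=
  hom_ext fun w => by
    induction w using hW.induction with
    | zero => simp
    | ract r m => rw [comp_apply, hW.lift_ract, mulR_tmulR, f.linear]
    | add x y hx hy => rw [map_add, map_add, hx, hy]

theorem tmulR_eq_zero (hR : HasLeftLocalUnits R) {M : RMod R} {m : M}
    (hm : ∀ r, M.ract r m = 0) (r : R) : M.tmulR m r = 0 := by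
  obtain ⟨e, he⟩ := hR.exists_left_unit r
  rw [← he, ← tmulR_balanced, hm, map_zero]; rfl

/-- A surjective morphism of firm modules whose kernel is annihilated by `R` is bijective. -/
theorem bijective_of_surjective (hR : HasLeftLocalUnits R) {M N : RMod R} (hM : IsFirm M)
    (hN : IsFirm N) (f : M ⟶ N) (hf : Function.Surjective f.toHom)
    (hker : ∀ m, f.toHom m = 0 → ∀ r, M.ract r m = 0) : Function.Bijective f.toHom := by
  refine ⟨(injective_iff_map_eq_zero _).2 fun m hm => ?_, hf⟩
  have hz : ∀ m r, f.toHom m = 0 → M.tmulR m r = 0 := fun m r hm =>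
    tmulR_eq_zero hR (hker m hm) r
  -- The section `g` need not be additive, but `g n ⊗ r` is additive in `n`: elements of the kernel
  -- of `f` die in `M ⊗_R R`. It therefore inverts `f ⊗ R` from the left.
  let g : N → M := Function.surjInv hf
  have hg : ∀ n, f.toHom (g n) = n := Function.surjInv_eq hf
  have hg' : ∀ a b r, f.toHom a = f.toHom b → M.tmulR a r = M.tmulR b r := fun a b r h => by
    rw [← sub_eq_zero, ← AddMonoidHom.sub_apply, ← map_sub]
    exact hz _ r (by rw [map_sub, h, sub_self])
  let inv : N.tensorR →+ M.tensorR := liftR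
    (AddMonoidHom.mk' (fun n => M.tmulR (g n)) (fun a b => by
      ext r
      rw [← map_add]
      exact hg' _ _ r (by rw [map_add, hg, hg, hg])))
    (fun s n r => by
      change M.tmulR (g (N.ract s n)) r = M.tmulR (g n) (s * r)
      rw [← tmulR_balanced]
      exact hg' _ _ r (by rw [hg, f.linear, hg]))
  have hinv : ∀ z, inv ((mapR f).toHom z) = z := by
    intro z
    induction z using tensorR_induction with
    | zero => simp
    | pure m r => exact hg' _ _ r (hg _)
    | add x y hx hy => simp only [map_add, hx, hy]
  obtain ⟨z, rfl⟩ : ∃ z, M.mulR.toHom z = m := hM.2 m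
  have h0 : (mapR f).toHom z = 0 := hN.1 (by
    refine (mulR_mapR f z).trans (hm.trans ?_)
    exact (map_zero N.mulR.toHom).symm)
  rw [← hinv z, h0, map_zero, map_zero]

/-- Lift an element of the kernel to `L ⊗_R R`. Its product lies in the image of `K`, and firmness
of `K` and `L` shows that the lift comes from `K ⊗_R R`, which dies in the quotient. -/
theorem isFirm_quot {K L : RMod R} (hK : IsFirm K) (hL : IsFirm L) (f : K ⟶ L) :
    IsFirm (L.quot f.toHom.range (ract_mem_range f)) := by
  rw [isFirm_iff]
  set Q := L.quot f.toHom.range (ract_mem_range f)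
  let π : L ⟶ Q := L.quotπ f.toHom.range (ract_mem_range f)
  have hπ : Function.Surjective π.toHom := QuotientAddGroup.mk_surjective
  have hπ' : Function.Surjective (mapR π).toHom := by
    intro z
    induction z using tensorR_induction with
    | zero => exact ⟨0, map_zero _⟩
    | pure q r =>
      obtain ⟨l, rfl⟩ := hπ q
      exact ⟨L.tmulR l r, rfl⟩
    | add x y hx hy =>
      obtain ⟨a, rfl⟩ := hx
      obtain ⟨b, rfl⟩ := hy
      exact ⟨a + b, map_add _ _ _⟩
  refine ⟨(injective_iff_map_eq_zero _).2 fun z hz => ?_, fun q => ?_⟩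
  · obtain ⟨z, rfl⟩ := hπ' z
    rw [mulR_mapR] at hz
    obtain ⟨k, hk⟩ := (QuotientAddGroup.eq_zero_iff _).1 hz
    obtain ⟨k, rfl⟩ : ∃ z, K.mulR.toHom z = k := hK.2 k
    have : z = (mapR f).toHom k := hL.1 (by
      refine hk.symm.trans ?_
      exact (mulR_mapR f k).symm)
    rw [this]
    clear this hk hz
    induction k using tensorR_induction with
    | zero => simp
    | pure k r =>
      have : π.toHom (f.toHom k) = 0 := (QuotientAddGroup.eq_zero_iff _).2 ⟨k, rfl⟩
      rw [mapR_tmulR, mapR_tmulR, this, map_zero]; rfl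
    | add x y hx hy => rw [map_add, map_add, hx, hy, add_zero]
  · obtain ⟨l, rfl⟩ := hπ q
    obtain ⟨z, rfl⟩ : ∃ z, L.mulR.toHom z = l := hL.2 l
    exact ⟨(mapR π).toHom z, mulR_mapR π z⟩

end RMod

end RModules

/-! ### Invariance of the categorical conditions under isomorphism and equivalence. -/

section Transfer

variable {𝒞 𝒟 : Type*} [Category 𝒞] [Category 𝒟]

theorem IsFinGen.of_orderIso {X : 𝒞} {Y : 𝒟} (o : Subobject Y ≃o Subobject X) (hX : IsFinGen X) :
    IsFinGen Y := by
  intro F hne hdir hlub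
  obtain ⟨S, hS, hS'⟩ := hX (o '' F) (hne.image _) (by
    rintro _ ⟨S, hS, rfl⟩ _ ⟨T, hT, rfl⟩
    obtain ⟨W, hW, h1, h2⟩ := hdir S hS T hT
    exact ⟨o W, ⟨W, hW, rfl⟩, o.monotone h1, o.monotone h2⟩) (by
    have := o.isLUB_image'.2 hlub
    rwa [map_top] at this)
  have : S = ⊤ := o.injective (by rw [hS', map_top])
  exact this ▸ hS

theorem IsFinGen.of_iso {X Y : 𝒞} (e : X ≅ Y) (hX : IsFinGen X) : IsFinGen Y :=
  hX.of_orderIso (Subobject.mapIsoToOrderIso e.symm)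

theorem IsFinGen.of_functor_obj (F : 𝒞 ⥤ 𝒟) [F.IsEquivalence] {X : 𝒞} (hX : IsFinGen (F.obj X)) :
    IsFinGen X :=
  hX.of_orderIso (Subobject.lowerEquivalence (MonoOver.congr X F.asEquivalence)).toOrderIso

theorem isSeparator_of_iso {X Y : 𝒞} (e : X ≅ Y) (hX : IsSeparator X) : IsSeparator Y := by
  rw [isSeparator_def] at hX ⊢
  intro M N f g hfg
  exact hX f g fun k => by simpa using e.hom ≫= hfg (e.inv ≫ k)

theorem WeaklyLocallyProjective.of_iso {X Y : 𝒞} (e : X ≅ Y) (hX : WeaklyLocallyProjective X) :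
    WeaklyLocallyProjective Y := by
  intro E M N i f g _ _ hE
  obtain ⟨h, hh⟩ := hX (i ≫ e.inv) (e.hom ≫ f) g inferInstance ‹_› hE
  exact ⟨e.inv ≫ h, by simpa using hh⟩

theorem WeaklyLocallyProjective.functor_obj (F : 𝒞 ⥤ 𝒟) [F.IsEquivalence] {X : 𝒞}
    (hX : WeaklyLocallyProjective X) : WeaklyLocallyProjective (F.obj X) := by
  intro E M N i f g _ _ hE
  let eE := F.objObjPreimageIso E
  let eM := F.objObjPreimageIso M
  let eN := F.objObjPreimageIso N
  have hi : Mono (F.preimage (eE.hom ≫ i)) := F.mono_of_mono_map (by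
    rw [F.map_preimage]; infer_instance)
  have hg : Epi (F.preimage (eM.hom ≫ g ≫ eN.inv)) := F.epi_of_epi_map (by
    rw [F.map_preimage]; infer_instance)
  obtain ⟨h, hh⟩ := hX (F.preimage (eE.hom ≫ i)) (F.preimage (f ≫ eN.inv))
    (F.preimage (eM.hom ≫ g ≫ eN.inv)) hi hg ((hE.of_iso eE.symm).of_functor_obj F)
  refine ⟨F.map h ≫ eM.hom, ?_⟩
  have := congrArg F.map hh
  simp only [F.map_comp, F.map_preimage, Category.assoc, cancel_epi] at this
  simpa only [← Category.assoc, cancel_mono] using this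

end Transfer

/-! ### The category of firm modules and its generator `R`. -/

section Firm

variable {R : Type u} [NonUnitalRing R]

namespace FirmMod

theorem hom_ext {M N : FirmMod R} {f g : M ⟶ N} (h : ∀ m, f.hom.toHom m = g.hom.toHom m) : f = g :=
  ObjectProperty.hom_ext _ (RMod.hom_ext h)

/-- `M ⊗_R R → M` need not be injective, but its kernel is annihilated by `R`, and a firm source is
generated by products `w r`. -/
theorem mono_of_injective {M : RMod R} {N : FirmMod R} (hM : RMod.IsFirm M.tensorR)
    (f : M ⟶ N.obj) (hf : Function.Injective f.toHom) :
    Mono (ObjectProperty.homMk (M.mulR ≫ f) : (⟨M.tensorR, hM⟩ : FirmMod R) ⟶ N) where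
  right_cancellation {W} a b hab := by
    refine hom_ext fun w => ?_
    induction w using RMod.IsFirm.induction W.property with
    | zero => rw [map_zero, map_zero]
    | ract r w =>
      have : M.mulR.toHom (a.hom.toHom w) = M.mulR.toHom (b.hom.toHom w) :=
        hf congr(($hab).hom.toHom w)
      rw [a.hom.linear, b.hom.linear, RMod.ract_eq_tmulR, RMod.ract_eq_tmulR, this]
    | add x y hx hy => rw [map_add, map_add, hx, hy]

theorem surjective_of_epi {M N : FirmMod R} (f : M ⟶ N) [Epi f] :
    Function.Surjective f.hom.toHom := by
  let Q : FirmMod R := ⟨_, RMod.isFirm_quot M.property N.property f.hom⟩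
  have h : (ObjectProperty.homMk (N.obj.quotπ _ (RMod.ract_mem_range f.hom)) : N ⟶ Q) =
      ObjectProperty.homMk 0 := by
    rw [← cancel_epi f]
    exact hom_ext fun m => (QuotientAddGroup.eq_zero_iff _).2 ⟨m, rfl⟩
  exact fun n => (QuotientAddGroup.eq_zero_iff _).1 congr(($h).hom.toHom n)

/-- The set-theoretic kernel may fail to be firm, so the monomorphism is tested on its replacement
`K ⊗_R R`. -/
theorem ract_eq_zero_of_mono (hR : HasLeftLocalUnits R) {M N : FirmMod R} (f : M ⟶ N) [Mono f]
    {m : M.obj} (hm : f.hom.toHom m = 0) (r : R) : M.obj.ract r m = 0 := by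
  let K := M.obj.sub f.hom.toHom.ker (RMod.ract_mem_ker f.hom)
  let K' : FirmMod R := ⟨_, RMod.isFirm_tensorR hR K⟩
  have h : (ObjectProperty.homMk (K.mulR ≫ M.obj.subι _ (RMod.ract_mem_ker f.hom)) : K' ⟶ M) =
      ObjectProperty.homMk 0 := by
    rw [← cancel_mono f]
    refine hom_ext fun z => ?_
    exact (K.mulR.toHom z).2.trans (map_zero f.hom.toHom).symm
  exact congr(($h).hom.toHom (K.tmulR ⟨m, hm⟩ r))

theorem isIso_of_bijective {M N : FirmMod R} (f : M ⟶ N) (hf : Function.Bijective f.hom.toHom) :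
    IsIso f := by
  let e := AddEquiv.ofBijective f.hom.toHom hf
  have he : ∀ x, f.hom.toHom (e.symm x) = x := e.apply_symm_apply
  refine ⟨ObjectProperty.homMk ⟨e.symm.toAddMonoidHom, fun r n => hf.1 ?_⟩,
    hom_ext fun m => e.symm_apply_apply m, hom_ext fun m => e.apply_symm_apply m⟩
  change f.hom.toHom (e.symm (N.obj.ract r n)) = f.hom.toHom (M.obj.ract r (e.symm n))
  rw [f.hom.linear, he, he]

theorem isIso_of_mono_of_surjective (hR : HasLeftLocalUnits R) {M N : FirmMod R} (f : M ⟶ N)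
    [Mono f] (hf : Function.Surjective f.hom.toHom) : IsIso f :=
  isIso_of_bijective f (RMod.bijective_of_surjective hR M.property N.property f.hom hf
    fun _ hm r => ract_eq_zero_of_mono hR f hm r)

theorem bijective_of_isIso {M N : FirmMod R} (f : M ⟶ N) [IsIso f] :
    Function.Bijective f.hom.toHom :=
  Function.bijective_iff_has_inverse.2 ⟨(inv f).hom.toHom,
    fun m => congr(($(IsIso.hom_inv_id f)).hom.toHom m),
    fun m => congr(($(IsIso.inv_hom_id f)).hom.toHom m)⟩

/-- The firm module `R`. -/
abbrev self (hR : HasLeftLocalUnits R) : FirmMod R := ⟨RMod.self R, RMod.isFirm_self hR⟩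

theorem isSeparator_self (hR : HasLeftLocalUnits R) : IsSeparator (self hR) := by
  rw [isSeparator_def]
  intro M N f g hfg
  refine hom_ext fun m => ?_
  induction m using RMod.IsFirm.induction M.property with
  | zero => rw [map_zero, map_zero]
  | ract r m => exact congr(($(hfg (ObjectProperty.homMk (RMod.ofElem m)))).hom.toHom r)
  | add x y hx hy => rw [map_add, map_add, hx, hy]

/-- `E` is the union of the submodules on which `e` acts as a left unit. They are directed because
`e` and `e'` have a common left unit. Their firm replacements have supremum `E`, so one of them is
`E`. -/
theorem exists_left_unit_of_isFinGen (hR : HasLeftLocalUnits R) {E : FirmMod R} (hE : IsFinGen E)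
    (i : E ⟶ self hR) : ∃ e : R, ∀ x, e * i.hom.toHom x = i.hom.toHom x := by
  classical
  let U : R → AddSubgroup E.obj := fun e =>
    ((AddMonoidHom.mulLeft e).comp i.hom.toHom).eqLocus i.hom.toHom
  have hU : ∀ e r, ∀ m ∈ U e, E.obj.ract r m ∈ U e := fun e r m hm => by
    change e * i.hom.toHom (E.obj.ract r m) = i.hom.toHom (E.obj.ract r m)
    rw [i.hom.linear]
    refine (mul_assoc _ _ _).symm.trans (congrArg (· * r) hm)
  let S : R → RMod R := fun e => E.obj.sub (U e) (hU e)
  have hS := fun e => RMod.isFirm_tensorR hR (S e)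
  let j : ∀ e, S e ⟶ E.obj := fun e => E.obj.subι (U e) (hU e)
  let J : ∀ e, (⟨_, hS e⟩ : FirmMod R) ⟶ E := fun e => ObjectProperty.homMk ((S e).mulR ≫ j e)
  have hJ : ∀ e, Mono (J e) := fun e => mono_of_injective (hS e) (j e) Subtype.val_injective
  have hle : ∀ e e', e' * e = e → Subobject.mk (J e) ≤ Subobject.mk (J e') := by
    intro e e' he
    have hUU : ∀ x ∈ U e, x ∈ U e' := fun x hx => by
      change e * i.hom.toHom x = i.hom.toHom x at hx
      change e' * i.hom.toHom x = i.hom.toHom x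
      rw [← hx, ← mul_assoc, he]
    let k : S e ⟶ S e' := ⟨(U e).subtype.codRestrict (U e') fun x => hUU x x.2, fun _ _ => rfl⟩
    refine Subobject.mk_le_mk_of_comm (ObjectProperty.homMk (RMod.mapR k)) (hom_ext fun z => ?_)
    exact congrArg Subtype.val (RMod.mulR_mapR k z)
  have hmem : ∀ x, ∃ e, x ∈ U e := fun x => hR.exists_left_unit _
  obtain ⟨e, he⟩ := hE (Set.range fun e => Subobject.mk (J e)) ⟨_, 0, rfl⟩ (by
      rintro _ ⟨e, rfl⟩ _ ⟨e', rfl⟩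
      obtain ⟨e'', h⟩ := hR {e, e'}
      exact ⟨_, ⟨e'', rfl⟩, hle _ _ (h _ (by simp)), hle _ _ (h _ (by simp))⟩)
    ⟨fun _ _ => le_top, fun T hT => by
      -- Reaching the products `x r` suffices, since a firm module is generated by them.
      have : IsIso T.arrow := isIso_of_mono_of_surjective hR T.arrow fun x => by
        induction x using RMod.IsFirm.induction E.property with
        | zero => exact ⟨0, map_zero _⟩
        | ract r x =>
          obtain ⟨e, he⟩ := hmem x
          have hle := hT ⟨e, rfl⟩
          refine ⟨(Subobject.ofMkLE _ T hle).hom.toHom ((S e).tmulR ⟨x, he⟩ r), ?_⟩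
          exact congr(($(Subobject.ofMkLE_arrow hle)).hom.toHom ((S e).tmulR ⟨x, he⟩ r))
        | add x y hx hy =>
          obtain ⟨a, rfl⟩ := hx
          obtain ⟨b, rfl⟩ := hy
          exact ⟨a + b, map_add _ _ _⟩
      rw [Subobject.eq_top_of_isIso_arrow T]⟩
  refine ⟨e, fun x => ?_⟩
  have := (Subobject.isIso_iff_mk_eq_top _).2 he
  obtain ⟨y, rfl⟩ := (bijective_of_isIso (J e)).2 x
  exact ((S e).mulR.toHom y).2

/-- With `e` a left unit on the image of `i` and `m` a preimage of `f(e)`, the morphism `r ↦ m r`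
works: `g(m i(x)) = f(e) i(x) = f(e i(x)) = f(i(x))`. -/
theorem weaklyLocallyProjective_self (hR : HasLeftLocalUnits R) :
    WeaklyLocallyProjective (self hR) := by
  intro E M N i f g _ _ hE
  obtain ⟨e, he⟩ := exists_left_unit_of_isFinGen hR hE i
  obtain ⟨m, hm⟩ := surjective_of_epi g (f.hom.toHom e)
  refine ⟨ObjectProperty.homMk (RMod.ofElem m), hom_ext fun x => ?_⟩
  change g.hom.toHom (M.obj.ract (i.hom.toHom x) m) = f.hom.toHom (i.hom.toHom x)
  rw [g.hom.linear, hm, ← f.hom.linear]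
  exact congrArg _ (he x)

end FirmMod

end Firm

/-! ### Condition 2 implies condition 1. -/

section EquivalenceImplies

variable {A C : Type u} [Ring A] [AddCommGroup C] [Module A C] [Module Aᵐᵒᵖ C]
  [SMulCommClass A Aᵐᵒᵖ C] [Coring A C] {X : Comod A C} {R : Type u} [NonUnitalRing R]

namespace RTensor

variable {ι : R →ₙ+* X.endRing} {N : RMod R} {P : Type*} [AddCommGroup P] [Module Aᵐᵒᵖ P]

/-- The additive map `N ⊗_R X → P` induced by a balanced family of maps `X → P`. -/
def liftAdd (φ : N →+ (X →ₗ[Aᵐᵒᵖ] P)) (hφ : ∀ r n x, φ (N.ract r n) x = φ n ((ι r).1 x)) :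
    RTensor ι N →+ P :=
  BalTensor.lift (AddMonoidHom.mk' (fun n => (φ n).toAddMonoidHom) fun a b => by
    rw [map_add]; rfl) hφ

theorem liftAdd_tmul (φ : N →+ (X →ₗ[Aᵐᵒᵖ] P))
    (hφ : ∀ r n x, φ (N.ract r n) x = φ n ((ι r).1 x)) (n : N) (x : X) :
    liftAdd φ hφ (tmulLin ι n x) = φ n x := rfl

/-- The linear map `N ⊗_R X → P` induced by a balanced family of maps `X → P`. -/
def liftLin (φ : N →+ (X →ₗ[Aᵐᵒᵖ] P)) (hφ : ∀ r n x, φ (N.ract r n) x = φ n ((ι r).1 x)) :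
    RTensor ι N →ₗ[Aᵐᵒᵖ] P where
  toFun := liftAdd φ hφ
  map_add' := map_add _
  map_smul' b z := by
    induction z using induction with
    | zero => simp
    | pure n x => rw [← map_smul, liftAdd_tmul, liftAdd_tmul, map_smul]; rfl
    | add x y hx hy => rw [smul_add, map_add, hx, hy, map_add, smul_add]

@[simp]
theorem liftLin_tmul (φ : N →+ (X →ₗ[Aᵐᵒᵖ] P))
    (hφ : ∀ r n x, φ (N.ract r n) x = φ n ((ι r).1 x)) (n : N) (x : X) :
    liftLin φ hφ (tmulLin ι n x) = φ n x := rfl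

/-- The comodule map `N ⊗_R X → M` induced by a balanced family of colinear maps `X → M`. -/
def liftHom {M : Comod A C} (φ : N →+ (X →ₗ[Aᵐᵒᵖ] M))
    (hφ : ∀ r n x, φ (N.ract r n) x = φ n ((ι r).1 x)) (hc : ∀ n, Comod.IsColinear (φ n)) :
    comod ι N ⟶ M where
  lin := liftLin φ hφ
  colinear z := by
    change M.coact (liftLin φ hφ z) = ATensor.rmap (liftLin φ hφ) (coact ι N z)
    induction z using induction with
    | zero => simp
    | pure n x => rw [liftLin_tmul, hc, coact_tmul, ← ATensor.rmap_comp]; rfl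
    | add x y hx hy => simp only [map_add, hx, hy]

end RTensor

/-- The comodule map `R ⊗_R X → X`. -/
def selfTensorHom (ι : R →ₙ+* X.endRing) : RTensor.comod ι (RMod.self R) ⟶ X :=
  RTensor.liftHom (AddMonoidHom.mk' (fun r => (ι r).1) fun a b => by rw [map_add]; rfl)
    (fun r s x => by
      change (ι (s * r)).1 x = _
      rw [map_mul]; rfl)
    (fun r => (ι r).2)

theorem weaklyLocallyProjective_and_isSeparator_of_isEquivalence (h : HasLocalDualBases A C)
    (ι : R →ₙ+* X.endRing) (hR : HasLeftLocalUnits R) (hX : IsFirmLeft (leftAct ι))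
    (hF : (tensorFunctor ι).IsEquivalence) : WeaklyLocallyProjective X ∧ IsSeparator X := by
  -- Firmness of `X` is exactly the bijectivity of `R ⊗_R X → X`.
  have := Comod.isIso_of_bijective h (selfTensorHom ι) hX
  let e' : RTensor.comod ι (RMod.self R) ≅ X := asIso (selfTensorHom ι)
  let e : (tensorFunctor ι).obj (FirmMod.self hR) ≅ X := e'
  refine ⟨((FirmMod.weaklyLocallyProjective_self hR).functor_obj (tensorFunctor ι)).of_iso e, ?_⟩
  have := (FirmMod.isSeparator_self hR).of_equivalence (tensorFunctor ι).asEquivalence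
  exact isSeparator_of_iso e this

end EquivalenceImplies

/-! ### Associativity maps for tensor products with the coring. -/

section TensorCoring

variable {A C : Type u} [Ring A] [AddCommGroup C] [Module A C] [Module Aᵐᵒᵖ C]
  [SMulCommClass A Aᵐᵒᵖ C]

theorem assoc_rmap_rmap {M N : Type u} [AddCommGroup M] [Module Aᵐᵒᵖ M] [AddCommGroup N]
    [Module Aᵐᵒᵖ N] (f : M →ₗ[Aᵐᵒᵖ] N) (z : ATensor A (ATensor A M C) C) :
    ATensor.assoc (ATensor.rmap (ATensor.rmap f) z) =
      ATensor.map f LinearMap.id (ATensor.assoc z) := by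
  induction z using ATensor.induction with
  | zero => simp
  | pure w c =>
    induction w using ATensor.induction with
    | zero => simp
    | pure w c' => simp
    | add x y hx hy => simp only [map_add, AddMonoidHom.add_apply, hx, hy]
  | add x y hx hy => simp only [map_add, hx, hy]

theorem rmap_sub {M N : Type u} [AddCommGroup M] [Module Aᵐᵒᵖ M] [AddCommGroup N]
    [Module Aᵐᵒᵖ N] (f g : M →ₗ[Aᵐᵒᵖ] N) (z : ATensor A M C) :
    ATensor.rmap (f - g) z = ATensor.rmap f z - ATensor.rmap g z :=
  ATensor.map_sub_left f g LinearMap.id z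

theorem assoc_injective (h : HasLocalDualBases A C) {M : Type u} [AddCommGroup M]
    [Module Aᵐᵒᵖ M] : Function.Injective
      (ATensor.assoc : ATensor A (ATensor A M C) C →+ ATensor A M (ATensor A C C)) :=
  (injective_iff_map_eq_zero _).2 fun z hz => ATensor.eq_zero_of_slice h fun φ => by
    rw [← ATensor.map_lslice_assoc, hz, map_zero]

end TensorCoring

/-! ### Hom modules and their evaluation maps. -/

section HomModules

variable {A C : Type u} [Ring A] [AddCommGroup C] [Module A C] [Module Aᵐᵒᵖ C]
  [SMulCommClass A Aᵐᵒᵖ C] [Coring A C] {X : Comod A C} {R : Type u} [NonUnitalRing R]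
  (ι : R →ₙ+* X.endRing)

/-- The right `R`-module `Hom_A(X, P)`. -/
@[reducible] def homMod (P : Type u) [AddCommGroup P] [Module Aᵐᵒᵖ P] : RMod R :=
  RMod.ofRact (X →ₗ[Aᵐᵒᵖ] P)
    (fun r => AddMonoidHom.mk' (fun f => f.comp (ι r).1) fun _ _ => rfl)
    (fun a b f => by
      change f.comp (ι (a + b)).1 = f.comp (ι a).1 + f.comp (ι b).1
      rw [map_add, ← LinearMap.comp_add]; rfl)
    (fun a b f => by
      change f.comp (ι (a * b)).1 = (f.comp (ι a).1).comp (ι b).1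
      rw [map_mul]; rfl)

/-- The group of comodule morphisms `X → M`. -/
def colinHom (X M : Comod A C) : AddSubgroup (X →ₗ[Aᵐᵒᵖ] M) where
  carrier := {f | Comod.IsColinear f}
  zero_mem' := Comod.IsColinear.zero
  add_mem' := Comod.IsColinear.add
  neg_mem' := Comod.IsColinear.neg

theorem ract_mem_colinHom {M : Comod A C} (r : R) (f : homMod ι M) (hf : f ∈ colinHom X M) :
    (homMod ι M).ract r f ∈ colinHom X M := Comod.IsColinear.comp hf (ι r).2

/-- The right `R`-module of comodule morphisms `X → M`. -/
abbrev colinMod (M : Comod A C) : RMod R :=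
  (homMod ι M).sub (colinHom X M) (ract_mem_colinHom ι)

/-- The inclusion of comodule morphisms into `A`-linear maps. -/
abbrev colinIncl (M : Comod A C) : colinMod ι M ⟶ homMod ι M :=
  (homMod ι M).subι (colinHom X M) (ract_mem_colinHom ι)

/-- Postcomposition with a comodule morphism. -/
def colinMap {M N : Comod A C} (g : M ⟶ N) : colinMod ι M ⟶ colinMod ι N where
  toHom := AddMonoidHom.mk' (fun f => ⟨g.lin.comp f.1, Comod.IsColinear.comp g.colinear f.2⟩)
    fun _ _ => Subtype.ext (LinearMap.comp_add _ _ _)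
  linear _ _ := rfl

/-- The evaluation `Hom_A(X, P) ⊗_R X → P`. -/
def evalLin (P : Type u) [AddCommGroup P] [Module Aᵐᵒᵖ P] :
    RTensor ι (homMod ι P) →ₗ[Aᵐᵒᵖ] P :=
  RTensor.liftLin (AddMonoidHom.id _) fun _ _ _ => rfl

/-- The evaluation `Hom^C(X, M) ⊗_R X → M`. -/
def counitLin (M : Comod A C) : RTensor ι (colinMod ι M) →ₗ[Aᵐᵒᵖ] M :=
  RTensor.liftLin (colinHom X M).subtype fun _ _ _ => rfl

/-- The evaluation `Hom^C(X, M) ⊗_R X → M` as a morphism of comodules. -/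
def counitHom (M : Comod A C) : RTensor.comod ι (colinMod ι M) ⟶ M :=
  RTensor.liftHom (colinHom X M).subtype (fun _ _ _ => rfl) fun f => f.2

theorem counitLin_eq (M : Comod A C) (z : RTensor ι (colinMod ι M)) :
    counitLin ι M z = evalLin ι M (RTensor.mapLin ι (colinIncl ι M) z) := by
  induction z using RTensor.induction with
  | zero => simp
  | pure f x => rfl
  | add x y hx hy => simp only [map_add, hx, hy]

theorem counitLin_naturality {M N : Comod A C} (g : M ⟶ N) (z : RTensor ι (colinMod ι M)) :
    counitLin ι N (RTensor.mapLin ι (colinMap ι g) z) = g.lin (counitLin ι M z) := by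
  induction z using RTensor.induction with
  | zero => simp
  | pure f x => rfl
  | add x y hx hy => simp only [map_add, hx, hy]

theorem counitLin_mem_trace {M : Comod A C} (z : RTensor ι (colinMod ι M)) :
    counitLin ι M z ∈ Comod.trace X M := by
  induction z using RTensor.induction with
  | zero => simp
  | pure f x => exact Submodule.mem_iSup_of_mem (Comod.IsColinear.hom f.2) ⟨x, rfl⟩
  | add x y hx hy =>
    rw [map_add]
    exact add_mem hx hy

end HomModules

/-! ### Flatness preserves injectivity. -/

section Flat

variable {R : Type u} [NonUnitalRing R] {F : Type u} [AddCommGroup F] {l : R →ₙ+* AddMonoid.End F}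

theorem tensorMap_zero {M N : RMod R} (z : BalTensor M.ract (lact l)) :
    tensorMap l (0 : M ⟶ N) z = 0 := by
  induction z using BalTensor.induction with
  | zero => simp
  | pure m x =>
    change BalTensor.tmul _ _ (0 : N) x = 0
    rw [map_zero]; rfl
  | add x y hx hy => rw [map_add, hx, hy, add_zero]

theorem IsFlatLeft.injective (hl : IsFlatLeft l) {M N : RMod R} (f : M ⟶ N)
    (hf : Function.Injective f.toHom) : Function.Injective (tensorMap l f) := by
  have := hl (0 : M ⟶ M) f fun m => ⟨fun hm => ⟨0, (hf (hm.trans (map_zero _).symm)).symm⟩, by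
    rintro ⟨x, rfl⟩; exact map_zero f.toHom⟩
  refine (injective_iff_map_eq_zero _).2 fun z hz => ?_
  obtain ⟨w, rfl⟩ := (this z).1 hz
  exact tensorMap_zero w

end Flat

/-! ### Bijectivity of the evaluations from the canonical map and flatness. -/

section CanonicalMap

variable {A C : Type u} [Ring A] [AddCommGroup C] [Module A C] [Module Aᵐᵒᵖ C]
  [SMulCommClass A Aᵐᵒᵖ C] [Coring A C] {X : Comod A C} {R : Type u} [NonUnitalRing R]
  (ι : R →ₙ+* X.endRing) {P : Type u} [AddCommGroup P] [Module Aᵐᵒᵖ P]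

variable (P) in
/-- The map `Hom_A(X, P) ⊗_R X → P ⊗_A C`, `f ⊗ x ↦ f(x_[0]) ⊗ x_[1]`. -/
def canAt : RTensor ι (homMod ι P) →ₗ[Aᵐᵒᵖ] ATensor A P C :=
  RTensor.liftLin (AddMonoidHom.mk' (fun f : X →ₗ[Aᵐᵒᵖ] P => (ATensor.rmap f).comp X.coact)
    fun f g => LinearMap.ext fun x => ATensor.rmap_add f g _)
    fun r f x => by
      change ATensor.rmap (f.comp (ι r).1) (X.coact x) = ATensor.rmap f (X.coact ((ι r).1 x))
      rw [(ι r).2 x, ATensor.rmap_comp]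

@[simp]
theorem canAt_tmul (f : X →ₗ[Aᵐᵒᵖ] P) (x : X) :
    canAt ι P (RTensor.tmulLin ι (M := homMod ι P) f x) = ATensor.rmap f (X.coact x) := rfl

theorem slice_canAt (z : RTensor ι (homMod ι P)) :
    ATensor.slice Coring.counit (canAt ι P z) = evalLin ι P z := by
  induction z using RTensor.induction with
  | zero => simp
  | pure f x =>
    refine (ATensor.slice_rmap _ f _).trans ?_
    exact congrArg f (X.counit x)
  | add x y hx hy => simp only [map_add, hx, hy]

/-- The map `a ↦ p a`. -/
def spanMap (A : Type*) [Ring A] {P : Type*} [AddCommGroup P] [Module Aᵐᵒᵖ P] (p : P) :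
    A →ₗ[Aᵐᵒᵖ] P where
  toFun a := op a • p
  map_add' a b := by rw [MulOpposite.op_add, add_smul]
  map_smul' b a := by
    rw [← smul_assoc]; rfl

/-- The map `X^* ⊗_R X → Hom_A(X, P) ⊗_R X`, `ξ ⊗ x ↦ p ξ(-) ⊗ x`. -/
def dualToHom (p : P) : BalTensor (dualRact ι) (lact (leftAct ι)) →+ RTensor ι (homMod ι P) :=
  BalTensor.map (ρ' := (homMod ι P).ract)
    (AddMonoidHom.mk' (fun ξ : Dual A X => (spanMap A p).comp ξ)
      fun _ _ => LinearMap.comp_add _ _ _) (AddMonoidHom.id X) (fun _ _ => rfl) (fun _ _ => rfl)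

theorem dualToHom_tmul (p : P) (ξ : Dual A X) (x : X) :
    dualToHom ι p (BalTensor.tmul _ _ ξ x) =
      RTensor.tmulLin ι (M := homMod ι P) ((spanMap A p).comp ξ) x := rfl

theorem dualToHom_add (p q : P) (d : BalTensor (dualRact ι) (lact (leftAct ι))) :
    dualToHom ι (p + q) d = dualToHom ι p d + dualToHom ι q d := by
  induction d using BalTensor.induction with
  | zero => simp
  | pure ξ x =>
    rw [dualToHom_tmul, dualToHom_tmul, dualToHom_tmul, ← LinearMap.add_apply,
      ← RTensor.tmulLin_add]
    congr 2
    ext y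
    exact smul_add _ _ _
  | add x y hx hy => rw [map_add, map_add, map_add, hx, hy]; abel

/-- The left action of `A` on `X^* ⊗_R X`. -/
def dualSMul (a : A) : BalTensor (dualRact ι) (lact (leftAct ι)) →+
    BalTensor (dualRact ι) (lact (leftAct ι)) :=
  BalTensor.map (DistribSMul.toAddMonoidHom (Dual A X) a) (AddMonoidHom.id X) (fun _ _ => rfl)
    (fun _ _ => rfl)

theorem dualToHom_op_smul (a : A) (p : P) (d : BalTensor (dualRact ι) (lact (leftAct ι))) :
    dualToHom ι (op a • p) d = dualToHom ι p (dualSMul ι a d) := by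
  induction d using BalTensor.induction with
  | zero => simp
  | pure ξ x =>
    refine congrArg (fun f => RTensor.tmulLin ι (M := homMod ι P) f x) ?_
    ext y
    change op (ξ y) • op a • p = op (a * ξ y) • p
    rw [op_mul, mul_smul]
  | add x y hx hy => simp only [map_add, hx, hy]

theorem can_tmul (ξ : Dual A X) (x : X) :
    can ι (BalTensor.tmul _ _ ξ x) = contract ξ (X.coact x) := rfl

theorem can_dualSMul (a : A) (d : BalTensor (dualRact ι) (lact (leftAct ι))) :
    can ι (dualSMul ι a d) = a • can ι d := by
  induction d using BalTensor.induction with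
  | zero => simp
  | pure ξ x =>
    change contract (a • ξ) (X.coact x) = a • contract ξ (X.coact x)
    generalize X.coact x = z
    induction z using ATensor.induction with
    | zero => simp
    | pure x c => exact mul_smul a (ξ x) c
    | add x y hx hy => rw [map_add, hx, hy, map_add, smul_add]
  | add x y hx hy => rw [map_add, map_add, hx, hy, map_add, smul_add]

theorem canAt_dualToHom (p : P) (d : BalTensor (dualRact ι) (lact (leftAct ι))) :
    canAt ι P (dualToHom ι p d) = ATensor.tmul A p (can ι d) := by
  induction d using BalTensor.induction with
  | zero => simp
  | pure ξ x =>
    rw [dualToHom_tmul, canAt_tmul, can_tmul]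
    generalize X.coact x = z
    induction z using ATensor.induction with
    | zero => simp
    | pure x c => exact ATensor.tmul_balanced A (ξ x) p c
    | add x y hx hy => rw [map_add, hx, hy, map_add, map_add]
  | add x y hx hy => simp only [map_add, hx, hy]

/-- The inverse sends `p ⊗ can(ξ ⊗ x)` to `p ξ(-) ⊗ x`. It is onto by local dual bases: if `κ(r) x =
x`, then `f ⊗ x = f κ(r) ⊗ x`, and for `κ(r) = ∑ y ⊗ ξ` this is `∑ f(y) ξ(-) ⊗ x`. -/
theorem canAt_bijective (hκ : WeaklyRLocallyProjective ι) (hcan : Function.Bijective (can ι)) :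
    Function.Bijective (canAt ι P) := by
  let e := AddEquiv.ofBijective (can ι) hcan
  have he : ∀ c, can ι (e.symm c) = c := e.apply_symm_apply
  let inv : ATensor A P C →+ RTensor ι (homMod ι P) :=
    ATensor.lift (AddMonoidHom.mk' (fun p => (dualToHom ι p).comp e.symm.toAddMonoidHom)
      fun p q => by ext c; exact dualToHom_add ι p q _)
      (fun a p c => by
        change dualToHom ι (op a • p) (e.symm c) = dualToHom ι p (e.symm (a • c))
        rw [dualToHom_op_smul]
        congr 1
        exact e.injective ((can_dualSMul ι a _).trans (by rw [he]; exact (he _).symm)))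
  have hinv : ∀ p d, inv (ATensor.tmul A p (can ι d)) = dualToHom ι p d := fun p d =>
    congrArg (dualToHom ι p) (e.symm_apply_apply d)
  have h1 : ∀ z, canAt ι P (inv z) = z := by
    intro z
    induction z using ATensor.induction with
    | zero => simp
    | pure p c =>
      obtain ⟨d, rfl⟩ := hcan.2 c
      rw [hinv, canAt_dualToHom]
    | add x y hx hy => simp only [map_add, hx, hy]
  have h2 : Function.Surjective inv := by
    intro z
    induction z using RTensor.induction with
    | zero => exact ⟨0, map_zero _⟩
    | pure f x =>
      obtain ⟨κ, hκ, hx⟩ := hκ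
      obtain ⟨r, hr⟩ := hx x
      have : RTensor.tmulLin ι f x =
          RTensor.tmulLin ι (M := homMod ι P) (f.comp (DualTensor.ev (κ r))) x := by
        have h3 : DualTensor.ev (κ r) = (ι r).1 := LinearMap.ext (hκ r)
        conv_lhs => rw [← hr, h3]
        rw [h3]
        exact congr($(RTensor.tmulLin_ract ι (M := homMod ι P) r f) x).symm
      rw [this]
      generalize κ r = z
      induction z using ATensor.induction with
      | zero => exact ⟨0, by
          rw [map_zero, map_zero, LinearMap.comp_zero]
          exact congr($(map_zero (AddMonoidHom.mk' (RTensor.tmulLin ι (M := homMod ι P))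
            (RTensor.tmulLin_add ι))) x).symm⟩
      | pure y ξ =>
        refine ⟨ATensor.tmul A (f y) (can ι (BalTensor.tmul _ _ ξ x)), ?_⟩
        rw [hinv, dualToHom_tmul]
        refine congrArg (fun f => RTensor.tmulLin ι (M := homMod ι P) f x) ?_
        ext v
        exact (f.map_smul _ _).symm
      | add z w hz hw =>
        obtain ⟨a, ha⟩ := hz
        obtain ⟨b, hb⟩ := hw
        refine ⟨a + b, ?_⟩
        rw [map_add, map_add, ha, hb, LinearMap.comp_add, ← LinearMap.add_apply]
        exact congr($(RTensor.tmulLin_add ι (M := homMod ι P) _ _) x).symm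
    | add x y hx hy =>
      obtain ⟨a, rfl⟩ := hx
      obtain ⟨b, rfl⟩ := hy
      exact ⟨a + b, map_add _ _ _⟩
  refine ⟨fun z w hzw => ?_, fun z => ⟨_, h1 z⟩⟩
  obtain ⟨z, rfl⟩ := h2 z
  obtain ⟨w, rfl⟩ := h2 w
  rw [h1, h1] at hzw
  rw [hzw]

/-- The obstruction to colinearity, `f ↦ ρ_M ∘ f - (f ⊗ C) ∘ ρ_X`. -/
def colinDefect (M : Comod A C) : homMod ι M ⟶ homMod ι (ATensor A M C) where
  toHom := AddMonoidHom.mk' (fun f : X →ₗ[Aᵐᵒᵖ] M => M.coact.comp f - (ATensor.rmap f).comp X.coact)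
    fun f g => LinearMap.ext fun x => by
      have := ATensor.rmap_add f g (X.coact x)
      simp only [LinearMap.sub_apply, LinearMap.add_apply, LinearMap.comp_apply, map_add, this]
      abel
  linear r f := LinearMap.ext fun x => by
    change M.coact (f ((ι r).1 x)) - ATensor.rmap (f.comp (ι r).1) (X.coact x) =
      M.coact (f ((ι r).1 x)) - ATensor.rmap f (X.coact ((ι r).1 x))
    rw [(ι r).2 x, ATensor.rmap_comp]

theorem exact_colinIncl_colinDefect (M : Comod A C) :
    Function.Exact (colinIncl ι M).toHom (colinDefect ι M).toHom := by
  intro f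
  constructor
  · intro hf
    exact ⟨⟨f, fun x => sub_eq_zero.1 congr($hf x)⟩, rfl⟩
  · rintro ⟨f, rfl⟩
    exact LinearMap.ext fun x => sub_eq_zero.2 (f.2 x)

/-- Under `canAt` the colinearity defect becomes the difference of the two sides of coassociativity,
which vanishes on `ρ_M(m)`. -/
theorem assoc_canAt_colinDefect (M : Comod A C) (z : RTensor ι (homMod ι M)) :
    ATensor.assoc (canAt ι (ATensor A M C) (RTensor.mapLin ι (colinDefect ι M) z)) =
      ATensor.assoc (ATensor.rmap M.coact (canAt ι M z)) -
        ATensor.map LinearMap.id Coring.comul (canAt ι M z) := by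
  induction z using RTensor.induction with
  | zero => simp
  | pure f x =>
    change ATensor.assoc (ATensor.rmap (M.coact.comp f - (ATensor.rmap f).comp X.coact)
      (X.coact x)) = ATensor.assoc (ATensor.rmap M.coact (ATensor.rmap f (X.coact x))) -
      ATensor.map LinearMap.id Coring.comul (ATensor.rmap f (X.coact x))
    rw [rmap_sub, ATensor.rmap_comp, ATensor.rmap_comp, map_sub, assoc_rmap_rmap, X.coassoc,
      ATensor.rmap_eq_map f, ATensor.map_map, ATensor.map_map]
    rfl
  | add x y hx hy =>
    simp only [map_add, hx, hy]
    abel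

/-- The element of `Hom_A(X, M) ⊗_R X` that corresponds to `ρ_M(m)` is killed by the colinearity
defect. By flatness it comes from `Hom^C(X, M) ⊗_R X`, and its evaluation is `m` by the counit
axiom. -/
theorem counitLin_surjective (h : HasLocalDualBases A C) (hκ : WeaklyRLocallyProjective ι)
    (hcan : Function.Bijective (can ι)) (hflat : IsFlatLeft (leftAct ι)) (M : Comod A C) :
    Function.Surjective (counitLin ι M) := by
  intro m
  obtain ⟨z, hz⟩ := (canAt_bijective ι hκ hcan (P := M)).2 (M.coact m)
  have h0 : RTensor.mapLin ι (colinDefect ι M) z = 0 := by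
    apply (canAt_bijective ι hκ hcan (P := ATensor A M C)).1
    apply assoc_injective h
    rw [assoc_canAt_colinDefect, hz, M.coassoc, sub_self, map_zero, map_zero]
  obtain ⟨w, rfl⟩ : ∃ w, RTensor.mapLin ι (colinIncl ι M) w = z :=
    (hflat _ _ (exact_colinIncl_colinDefect ι M) z).1 h0
  refine ⟨w, ?_⟩
  rw [counitLin_eq, ← slice_canAt]
  exact (congrArg _ hz).trans (M.counit m)

theorem canAt_mapLin_colinIncl (M : Comod A C) (z : RTensor ι (colinMod ι M)) :
    canAt ι M (RTensor.mapLin ι (colinIncl ι M) z) = M.coact ((counitLin ι M) z) := by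
  rw [counitLin_eq]
  induction z using RTensor.induction with
  | zero => simp
  | pure f x => exact (f.2 x).symm
  | add x y hx hy => simp only [map_add, hx, hy]

/-- The injective composite of `Hom^C(X, M) ⊗_R X → Hom_A(X, M) ⊗_R X` with `canAt` equals `ρ_M`
after evaluation. -/
theorem counitLin_injective (hκ : WeaklyRLocallyProjective ι)
    (hcan : Function.Bijective (can ι)) (hflat : IsFlatLeft (leftAct ι)) (M : Comod A C) :
    Function.Injective (counitLin ι M) := by
  refine (injective_iff_map_eq_zero _).2 fun z hz => ?_
  have h1 : RTensor.mapLin ι (colinIncl ι M) z = 0 := (canAt_bijective ι hκ hcan).1 (by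
    rw [canAt_mapLin_colinIncl, map_zero]
    exact (congrArg _ hz).trans (map_zero _))
  exact hflat.injective (colinIncl ι M) Subtype.val_injective (h1.trans (map_zero _).symm)

end CanonicalMap

/-! ### Modules annihilated by tensoring with a faithfully flat module. -/

section FirmZero

variable {R : Type u} [NonUnitalRing R]

/-- Read off the homology data: the identity factors through the cycles since the second map is
zero, and `π` is a split monomorphism since the first is zero. Its target is a zero object. -/
theorem FirmMod.id_eq_zero_of_exact {W : FirmMod R} {w : (0 : W ⟶ W) ≫ (0 : W ⟶ W) = 0}
    (h : (ShortComplex.mk (0 : W ⟶ W) (0 : W ⟶ W) w).Exact) : 𝟙 W = 0 := by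
  obtain ⟨d, hd⟩ := h
  let k : W ⟶ d.left.K := d.left.liftK (𝟙 W) Limits.comp_zero
  have hk : k ≫ d.left.i = 𝟙 W := d.left.liftK_i _ _
  have hf' : d.left.f' = 0 := by
    rw [← cancel_mono d.left.i, d.left.f'_i, Limits.zero_comp]
  let p : d.left.H ⟶ d.left.K := d.left.descH (𝟙 _) (by rw [hf', Limits.zero_comp])
  have hp : d.left.π ≫ p = 𝟙 _ := d.left.π_descH _ _
  rw [← hk, ← Category.id_comp d.left.i, ← hp, hd.eq_of_src p 0, Limits.comp_zero,
    Limits.zero_comp, Limits.comp_zero]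

/-- For `W = Q ⊗_R R` also `W ⊗_R F` vanishes, so the zero maps `W → W → W` become exact. Reflecting
this exactness gives `W = 0`, and `q r` is the image of `q ⊗ r`. -/
theorem IsFaithfullyFlatLeft.ract_eq_zero {F : Type u} [AddCommGroup F]
    {l : R →ₙ+* AddMonoid.End F} (hl : IsFaithfullyFlatLeft l) (hR : HasLeftLocalUnits R)
    (hF : IsFirmLeft l) (Q : RMod R) (hQ : ∀ z : BalTensor Q.ract (lact l), z = 0) (q : Q) (r : R) :
    Q.ract r q = 0 := by
  let W : FirmMod R := ⟨_, RMod.isFirm_tensorR hR Q⟩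
  have hW : ∀ z : BalTensor W.obj.ract (lact l), z = 0 := fun z =>
    (RMod.tensorMap_mulR_bijective hF Q).1 (by rw [hQ (tensorMap l Q.mulR z), map_zero])
  obtain ⟨w, hw⟩ := hl.2 (0 : W ⟶ W) (0 : W ⟶ W) fun z =>
    ⟨fun _ => ⟨0, by rw [hW z, map_zero]⟩, fun _ => by rw [hW z, map_zero]⟩
  have := FirmMod.id_eq_zero_of_exact hw
  have h0 : Q.tmulR q r = 0 := congr(($this).hom.toHom (Q.tmulR q r))
  rw [← RMod.mulR_tmulR, h0, map_zero]

end FirmZero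

/-! ### Condition 3 implies condition 1. -/

section FaithfullyFlatImplies

variable {A C : Type u} [Ring A] [AddCommGroup C] [Module A C] [Module Aᵐᵒᵖ C]
  [SMulCommClass A Aᵐᵒᵖ C] [Coring A C] {X : Comod A C} {R : Type u} [NonUnitalRing R]
  {ι : R →ₙ+* X.endRing}

/-- The fixed loci of the elements of `R` are stable and cover `E`. They form a directed family
because `R` has left local units. -/
theorem Comod.exists_left_unit_of_isFinGen (h : HasLocalDualBases A C) (hR : HasLeftLocalUnits R)
    (hX : ∀ x, ∃ r, lact (leftAct ι) r x = x) {E : Comod A C} (hE : IsFinGen E) (i : E ⟶ X) :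
    ∃ e : R, ∀ x, (ι e).1 (i.lin x) = i.lin x := by
  classical
  obtain ⟨e, he⟩ := hE.exists_eq_top h
    (fun e : R => LinearMap.eqLocus ((ι e).1.comp i.lin) i.lin)
    (fun e φ m hm => by
      change (ι e).1 (i.lin (E.hit φ m)) = i.lin (E.hit φ m)
      rw [i.colinear.hit, IsColinear.hit (ι e).2]
      exact congrArg _ hm)
    (fun e e' => by
      obtain ⟨e'', h⟩ := hR {e, e'}
      have key : ∀ f : R, e'' * f = f → LinearMap.eqLocus ((ι f).1.comp i.lin) i.lin ≤
          LinearMap.eqLocus ((ι e'').1.comp i.lin) i.lin := by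
        intro f hf x hx
        change (ι f).1 (i.lin x) = i.lin x at hx
        change (ι e'').1 (i.lin x) = i.lin x
        rw [← hx]
        exact (lact_mul (leftAct ι) e'' f (i.lin x)).symm.trans (by rw [hf]; rfl)
      exact ⟨e'', key _ (h _ (by simp)), key _ (h _ (by simp))⟩)
    (fun x => hX (i.lin x))
  exact ⟨e, fun x => he.ge (Submodule.mem_top (x := x))⟩

theorem weaklyLocallyProjective_and_isSeparator_of_isFaithfullyFlatLeft
    (h : HasLocalDualBases A C) (hR : HasLeftLocalUnits R) (hκ : WeaklyRLocallyProjective ι)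
    (hcan : Function.Bijective (can ι)) (hff : IsFaithfullyFlatLeft (leftAct ι)) :
    WeaklyLocallyProjective X ∧ IsSeparator X := by
  have hX : ∀ x, ∃ r, lact (leftAct ι) r x = x := by
    obtain ⟨κ, hκ, hx⟩ := hκ
    intro x
    obtain ⟨r, hr⟩ := hx x
    exact ⟨r, (hκ r x).symm.trans hr⟩
  have hsurj := counitLin_surjective ι h hκ hcan hff.1
  refine ⟨?_, Comod.isSeparator_of_exists_eq_sum fun M m => ?_⟩
  · intro E M N i f g _ _ hE
    obtain ⟨e, he⟩ := Comod.exists_left_unit_of_isFinGen h hR hX hE i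
    let g' := colinMap ι (X := X) g
    let Q := (colinMod ι N).quot g'.toHom.range (RMod.ract_mem_range g')
    let π : colinMod ι N ⟶ Q := (colinMod ι N).quotπ g'.toHom.range (RMod.ract_mem_range g')
    -- Through the bijective evaluations, `Hom^C(X, M) ⊗_R X → Hom^C(X, N) ⊗_R X` is the surjection
    -- `g`, so the tensored cokernel is zero.
    have hQ : ∀ z : RTensor ι Q, z = 0 := by
      have h1 : ∀ w : RTensor ι (colinMod ι N), RTensor.mapLin ι π w = 0 := by
        intro w
        obtain ⟨m, hm⟩ := Comod.surjective_of_epi h g (counitLin ι N w)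
        obtain ⟨v, rfl⟩ := hsurj M m
        have : w = RTensor.mapLin ι g' v := counitLin_injective ι hκ hcan hff.1 N (by
          rw [counitLin_naturality]; exact hm.symm)
        rw [this]
        clear this hm
        induction v using RTensor.induction with
        | zero => simp
        | pure k x =>
          have : π.toHom (g'.toHom k) = 0 := (QuotientAddGroup.eq_zero_iff _).2 ⟨k, rfl⟩
          rw [RTensor.mapLin_tmul, RTensor.mapLin_tmul, this]
          exact congr($(map_zero (BalTensor.tmul Q.ract (lact (leftAct ι)))) x)
        | add x y hx hy => rw [map_add, map_add, hx, hy, add_zero]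
      intro z
      induction z using RTensor.induction with
      | zero => rfl
      | pure q x =>
        obtain ⟨f, rfl⟩ : ∃ f, π.toHom f = q := QuotientAddGroup.mk_surjective q
        exact h1 (RTensor.tmulLin ι f x)
      | add x y hx hy => rw [hx, hy, add_zero]
    -- The class of `f` in the cokernel is annihilated by `e`, so `f ∘ e = g ∘ k`; and `e` is the
    -- identity on the image of `i`.
    obtain ⟨k, hk⟩ := (QuotientAddGroup.eq_zero_iff _).1
      (hff.ract_eq_zero hR (hR.isFirmLeft hX) Q hQ (π.toHom ⟨f.lin, f.colinear⟩) e)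
    refine ⟨Comod.IsColinear.hom k.2, Comod.hom_ext fun x => ?_⟩
    have h2 : g.lin (k.1 (i.lin x)) = f.lin ((ι e).1 (i.lin x)) :=
      congr(($hk : X →ₗ[Aᵐᵒᵖ] N) (i.lin x))
    rw [he] at h2
    exact h2
  · obtain ⟨z, rfl⟩ := hsurj M m
    exact counitLin_mem_trace ι z

end FaithfullyFlatImplies

/-! ### Formal sums and vanishing in a tensor product. -/

section Vanishing

variable {R : Type u} [NonUnitalRing R] {F : Type u} [AddCommGroup F] (l : R →ₙ+* AddMonoid.End F)
  (N : RMod R)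

/-- The map `r ↦ r x`. -/
def lactAt (x : F) : R →+ F := AddMonoidHom.mk' (fun r => lact l r x) fun a b => lact_add l a b x

/-- The map sending `∑ n ⊗ r_n` to `∑ n ⊗ r_n x`, on formal sums. -/
noncomputable def formalAct (x : F) : (N →₀ R) →+ (N →₀ F) :=
  Finsupp.mapRange.addMonoidHom (lactAt l x)

/-- The map sending a formal sum `∑ n ⊗ r_n` to `∑ n r_n`. -/
noncomputable def formalSum : (N →₀ R) →+ N :=
  Finsupp.liftAddHom fun n => AddMonoidHom.mk' (fun r => N.ract r n)
    fun a b => N.ract_add_apply a b n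

/-- The projection from formal sums to the tensor product. -/
noncomputable def formalTmul : (N →₀ F) →+ BalTensor N.ract (lact l) :=
  Finsupp.liftAddHom fun n => BalTensor.tmul _ _ n

variable {l N}

theorem formalAct_single (x : F) (n : N) (r : R) :
    formalAct l N x (Finsupp.single n r) = Finsupp.single n (lact l r x) := by
  simp [formalAct, lactAt]

theorem formalAct_apply (x : F) (k : N →₀ R) (n : N) :
    formalAct l N x k n = lact l (k n) x := rfl

theorem formalSum_single (n : N) (r : R) :
    formalSum N (Finsupp.single n r) = N.ract r n := by
  rw [formalSum, Finsupp.liftAddHom_apply_single]; rfl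

theorem formalTmul_single (n : N) (x : F) :
    formalTmul l N (Finsupp.single n x) = BalTensor.tmul _ _ n x := by
  simp [formalTmul]

theorem formalTmul_surjective : Function.Surjective (formalTmul l N) := by
  intro z
  induction z using BalTensor.induction with
  | zero => exact ⟨0, map_zero _⟩
  | pure n x => exact ⟨_, formalTmul_single n x⟩
  | add x y hx hy =>
    obtain ⟨a, rfl⟩ := hx
    obtain ⟨b, rfl⟩ := hy
    exact ⟨a + b, map_add _ _ _⟩

theorem formalTmul_formalAct (x : F) (k : N →₀ R) :
    formalTmul l N (formalAct l N x k) = BalTensor.tmul _ _ (formalSum N k) x := by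
  induction k using Finsupp.induction_linear with
  | zero => simp
  | add f g hf hg => simp only [map_add, hf, hg, AddMonoidHom.add_apply]
  | single n r =>
    rw [formalAct_single, formalTmul_single, formalSum_single, BalTensor.tmul_balanced]

/-- A formal sum that vanishes in the tensor product is a combination of trivial relations. -/
theorem mem_closure_of_formalTmul_eq_zero (hl : ∀ x, ∃ r, lact l r x = x) {u : N →₀ F}
    (hu : formalTmul l N u = 0) : u ∈ AddSubgroup.closure
      {v | ∃ (k : N →₀ R) (x : F), formalSum N k = 0 ∧ v = formalAct l N x k} := by
  set V := AddSubgroup.closure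
      {v | ∃ (k : N →₀ R) (x : F), formalSum N k = 0 ∧ v = formalAct l N x k} with hV
  have key : ∀ (k : N →₀ R) (x : F), formalSum N k = 0 → formalAct l N x k ∈ V :=
    fun k x hk => AddSubgroup.subset_closure ⟨k, x, hk, rfl⟩
  let f : BalTensor N.ract (lact l) →+ (N →₀ F) ⧸ V := BalTensor.lift
    (AddMonoidHom.mk' (fun n => (QuotientAddGroup.mk' V).comp (Finsupp.singleAddHom n))
      fun m n => by
        ext x
        -- A unit `e` of `x` replaces the missing `1` in `R`: the additivity relation is the formal
        -- sum `[m + n] e - [m] e - [n] e` applied to `x`.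
        obtain ⟨e, he⟩ := hl x
        have := key (Finsupp.single (m + n) e - Finsupp.single m e - Finsupp.single n e) x
          (by simp only [map_sub, formalSum_single, map_add]; abel)
        rw [map_sub, map_sub, formalAct_single, formalAct_single, formalAct_single, he,
          sub_sub] at this
        change (QuotientAddGroup.mk' V) (Finsupp.single (m + n) x) =
          (QuotientAddGroup.mk' V) (Finsupp.single m x) +
          (QuotientAddGroup.mk' V) (Finsupp.single n x)
        rw [← map_add, ← sub_eq_zero, ← map_sub]
        exact (QuotientAddGroup.eq_zero_iff _).2 this)
    (fun s n x => by
      obtain ⟨e, he⟩ := hl x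
      have := key (Finsupp.single (N.ract s n) e - Finsupp.single n (s * e)) x
        (by rw [map_sub, formalSum_single, formalSum_single, N.ract_mul, sub_self])
      rw [map_sub, formalAct_single, formalAct_single, lact_mul, he] at this
      change (QuotientAddGroup.mk' V) (Finsupp.single (N.ract s n) x) =
        (QuotientAddGroup.mk' V) (Finsupp.single n (lact l s x))
      rw [← sub_eq_zero, ← map_sub]
      exact (QuotientAddGroup.eq_zero_iff _).2 this)
  have hf : ∀ v, f (formalTmul l N v) = QuotientAddGroup.mk' V v := by
    intro v
    induction v using Finsupp.induction_linear with
    | zero => simp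
    | add f g hf hg => simp only [map_add, hf, hg]
    | single n x => rw [formalTmul_single]; rfl
  have := hf u
  rw [hu, map_zero] at this
  exact (QuotientAddGroup.eq_zero_iff _).1 this.symm

theorem exists_trivial_relations (hl : ∀ x, ∃ r, lact l r x = x) {u : N →₀ F}
    (hu : formalTmul l N u = 0) : ∃ (J : Type u) (_ : Fintype J) (k : J → N →₀ R) (y : J → F),
      (∀ j, formalSum N (k j) = 0) ∧ u = ∑ j, formalAct l N (y j) (k j) := by
  have hmem := mem_closure_of_formalTmul_eq_zero hl hu
  clear hu
  induction hmem using AddSubgroup.closure_induction with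
  | mem v hv =>
    obtain ⟨k, x, hk, rfl⟩ := hv
    exact ⟨PUnit, inferInstance, fun _ => k, fun _ => x, fun _ => hk, by simp⟩
  | zero => exact ⟨PEmpty, inferInstance, PEmpty.elim, PEmpty.elim, fun j => j.elim, by simp⟩
  | add v w _ _ hv hw =>
    obtain ⟨J, _, k, y, hk, rfl⟩ := hv
    obtain ⟨J', _, k', y', hk', rfl⟩ := hw
    exact ⟨J ⊕ J', inferInstance, Sum.elim k k', Sum.elim y y',
      fun j => by cases j <;> simp [hk, hk'], by simp [Fintype.sum_sum_type]⟩
  | neg v _ hv =>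
    obtain ⟨J, _, k, y, hk, rfl⟩ := hv
    exact ⟨J, inferInstance, fun j => -k j, y, fun j => by rw [map_neg, hk, neg_zero],
      by simp⟩

theorem BalTensor.exists_eq_sum {S M P : Type u} [AddCommGroup M] [AddCommGroup P]
    {ρ : S → M →+ M} {l : S → P →+ P} (z : BalTensor ρ l) :
    ∃ (J : Type u) (_ : Fintype J) (f : J → M) (y : J → P), z = ∑ j, BalTensor.tmul ρ l (f j) (y j) := by
  induction z using BalTensor.induction with
  | zero => exact ⟨PEmpty, inferInstance, PEmpty.elim, PEmpty.elim, by simp⟩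
  | pure m n => exact ⟨PUnit, inferInstance, fun _ => m, fun _ => n, by simp⟩
  | add x y hx hy =>
    obtain ⟨J, _, k, y, rfl⟩ := hx
    obtain ⟨J', _, k', y', rfl⟩ := hy
    exact ⟨J ⊕ J', inferInstance, Sum.elim k k', Sum.elim y y', by simp [Fintype.sum_sum_type]⟩

end Vanishing

/-! ### Flatness and bijective evaluations from a generator. -/

section Generator

variable {A C : Type u} [Ring A] [AddCommGroup C] [Module A C] [Module Aᵐᵒᵖ C]
  [SMulCommClass A Aᵐᵒᵖ C] [Coring A C] {X : Comod A C} {R : Type u} [NonUnitalRing R]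
  {ι : R →ₙ+* X.endRing}

/-- Over a ring of endomorphisms that is a left ideal, a finite family of elements of a generator
factors through a family of endomorphisms that witnesses all its colinear relations. -/
theorem exists_factorization (h : HasLocalDualBases A C) (hsep : IsSeparator X)
    (hideal : ∀ (t : X.endRing) (r : R), t * ι r ∈ Set.range ι)
    (hX : ∀ x, ∃ r, lact (leftAct ι) r x = x) {J : Type u} [Fintype J] (y : J → X) :
    ∃ (L : Type u) (_ : Fintype L) (k : J → L → R) (w : L → X),
      (∀ j, y j = ∑ l, lact (leftAct ι) (k j l) (w l)) ∧
      ∀ (M : Comod A C) (f : J → X →ₗ[Aᵐᵒᵖ] M), (∀ j, Comod.IsColinear (f j)) →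
        ∑ j, f j (y j) = 0 → ∀ l, ∑ j, (f j).comp (ι (k j l)).1 = 0 := by
  classical
  -- The family `y` is one element of `X^J`, and the generator is applied to the subcomodule that
  -- this element generates.
  let v : Comod.pow h J X := Finsupp.equivFunOnFinite.symm y
  have hE := Comod.stable_gen v
  obtain ⟨L, _, k, w, hk, hw⟩ := Comod.exists_eq_sum_of_isSeparator h hsep
    (M := hE.sub h) ⟨v, Comod.mem_gen v⟩
  -- The coordinates of `k l` need not lie in `R`. Precomposition with `e l`, which fixes `w l`,
  -- moves them into the left ideal.
  choose e he using fun l => hX (w l)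
  let t : J → L → X.endRing := fun j l => ⟨((Finsupp.lapply j : (J →₀ X) →ₗ[Aᵐᵒᵖ] X).comp
    (Comod.gen v).subtype).comp (k l), Comod.IsColinear.comp
      (Comod.IsColinear.comp (Comod.lapply_colinear h j) (hE.subtype_colinear h)) (hk l)⟩
  choose s hs using fun j l => hideal (t j l) (e l)
  have hs' : ∀ j l x, lact (leftAct ι) (s j l) x = ((k l) ((ι (e l)).1 x)).1 j := fun j l x => by
    change (ι (s j l)).1 x = _
    rw [hs]; rfl
  refine ⟨L, inferInstance, s, w, fun j => ?_, fun M f hf hf0 l => ?_⟩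
  · have h1 : v j = y j := rfl
    rw [← h1]
    have h2 := congrArg (fun z : Comod.gen v => (Finsupp.lapply j : (J →₀ X) →ₗ[Aᵐᵒᵖ] X)
      ((Comod.gen v).subtype z)) hw
    simp only [map_sum] at h2
    refine h2.trans (Finset.sum_congr rfl fun l _ => ?_)
    rw [hs']
    have h3 : (ι (e l)).1 (w l) = w l := he l
    rw [h3]; rfl
  · let g : (J →₀ X) →ₗ[Aᵐᵒᵖ] M := Finsupp.lsum ℕ f
    have hg : Comod.IsColinear (M := Comod.pow h J X) (N := M) g :=
      Comod.pow_colinear h fun j => by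
        convert hf j
        ext; simp [g]
    have hgs : ∀ z : J →₀ X, g z = ∑ j, f j (z j) := fun z => by
      simp only [g, Finsupp.lsum_apply]
      exact Finsupp.sum_fintype _ _ (by simp)
    -- A colinear relation that holds at `v` holds on the whole subcomodule generated by `v`, hence
    -- on the range of every `k l`.
    have hker : Comod.gen v ≤ LinearMap.ker g := (Comod.stable_ker hg).gen_le (by
      rw [LinearMap.mem_ker]
      exact (hgs v).trans hf0)
    ext x
    have := hker ((k l) ((ι (e l)).1 x)).2
    rw [LinearMap.mem_ker, hgs] at this
    simp only [LinearMap.sum_apply, LinearMap.comp_apply, LinearMap.zero_apply]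
    refine Eq.trans (Finset.sum_congr rfl fun j _ => ?_) this
    exact congrArg (f j) (hs' j l x)

/-- Start from relations `k_j` with `u = ∑_j k_j y_j` and factor `y_j = ∑_l s_jl w_l`. Where `u n =
∑_j k_j(n) y_j` vanishes, the factorization gives `∑_j k_j(n) s_jl = 0`, so the new relations have
no support outside that of `u`. -/
theorem exists_supported_trivial_relations (h : HasLocalDualBases A C) (hsep : IsSeparator X)
    (hinj : Function.Injective ι) (hideal : ∀ (t : X.endRing) (r : R), t * ι r ∈ Set.range ι)
    (hX : ∀ x, ∃ r, lact (leftAct ι) r x = x) {N : RMod R} {u : N →₀ X}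
    (hu : formalTmul (leftAct ι) N u = 0) :
    ∃ (L : Type u) (_ : Fintype L) (k : L → N →₀ R) (w : L → X),
      (∀ l, formalSum N (k l) = 0) ∧ u = ∑ l, formalAct (leftAct ι) N (w l) (k l) ∧
      ∀ n, u n = 0 → ∀ l, k l n = 0 := by
  obtain ⟨J, _, k, y, hk, rfl⟩ := exists_trivial_relations hX hu
  obtain ⟨L, _, s, w, hs, hrel⟩ := exists_factorization h hsep hideal hX y
  let k' : L → N →₀ R := fun l =>
    ∑ j, Finsupp.mapRange.addMonoidHom (AddMonoidHom.mulRight (s j l)) (k j)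
  have hk' : ∀ l n, k' l n = ∑ j, k j n * s j l := fun l n => by
    simp [k', Finsupp.finsetSum_apply]
  have hsum : ∀ (r : R) (k : N →₀ R), formalSum N
      (Finsupp.mapRange.addMonoidHom (AddMonoidHom.mulRight r) k) = N.ract r (formalSum N k) := by
    intro r k
    induction k using Finsupp.induction_linear with
    | zero => simp
    | add f g hf hg => simp only [map_add, hf, hg]
    | single n t =>
      rw [Finsupp.mapRange.addMonoidHom_apply, Finsupp.mapRange_single, formalSum_single,
        formalSum_single, ← N.ract_mul]
      rfl
  refine ⟨L, inferInstance, k', w, fun l => ?_, ?_, fun n hn l => ?_⟩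
  · simp only [k', map_sum, hsum, hk, map_zero, Finset.sum_const_zero]
  · ext n
    simp only [Finsupp.finsetSum_apply, formalAct_apply, hk']
    have : ∀ l, lact (leftAct ι) (∑ j, k j n * s j l) (w l) =
        ∑ j, lact (leftAct ι) (k j n) (lact (leftAct ι) (s j l) (w l)) := fun l => by
      change lactAt (leftAct ι) (w l) _ = _
      rw [map_sum]
      exact Finset.sum_congr rfl fun j _ => lact_mul (leftAct ι) (k j n) (s j l) (w l)
    simp only [this]
    rw [Finset.sum_comm]
    refine Finset.sum_congr rfl fun j _ => ?_
    conv_lhs => rw [hs j, map_sum]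
  · rw [hk']
    apply hinj
    rw [map_zero, map_sum]
    have := hrel X (fun j => (ι (k j n)).1) (fun j => (ι (k j n)).2) (by
      rw [← hn, Finsupp.finsetSum_apply]; rfl) l
    apply Subtype.ext
    rw [AddSubmonoidClass.coe_finsetSum]
    refine Eq.trans (Finset.sum_congr rfl fun j _ => ?_) this
    rw [map_mul]; rfl

/-- If `u` represents an element killed by `g ⊗ X`, its image in formal sums over `N` is a
combination of relations supported in `g(L)`. These lift to `L` along a section of `g`. What remains
consists of tensors `l ⊗ x` with `g(l) = 0`, which come from `K`. -/
theorem isFlatLeft_of_isSeparator (h : HasLocalDualBases A C) (hsep : IsSeparator X)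
    (hinj : Function.Injective ι) (hideal : ∀ (t : X.endRing) (r : R), t * ι r ∈ Set.range ι)
    (hX : ∀ x, ∃ r, lact (leftAct ι) r x = x) : IsFlatLeft (leftAct ι) := by
  classical
  intro K L N f g hfg z
  constructor
  · intro hz
    obtain ⟨u, rfl⟩ := formalTmul_surjective z
    have hmd : ∀ u : L →₀ X, formalTmul (leftAct ι) N (Finsupp.mapDomain g.toHom u) =
        tensorMap (leftAct ι) g (formalTmul (leftAct ι) L u) := by
      intro u
      induction u using Finsupp.induction_linear with
      | zero => simp
      | add f g hf hg => simp only [map_add, Finsupp.mapDomain_add, hf, hg]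
      | single n x => rw [Finsupp.mapDomain_single, formalTmul_single, formalTmul_single]; rfl
    have hgs : ∀ k : L →₀ R, formalSum N (Finsupp.mapDomain g.toHom k) =
        g.toHom (formalSum L k) := by
      intro u
      induction u using Finsupp.induction_linear with
      | zero => simp
      | add f g hf hg => simp only [map_add, Finsupp.mapDomain_add, hf, hg]
      | single n x =>
        rw [Finsupp.mapDomain_single, formalSum_single, formalSum_single, g.linear]
    obtain ⟨I, _, k, w, hk, hu, hsupp⟩ := exists_supported_trivial_relations h hsep hinj hideal hX
      ((hmd u).trans hz)
    -- The default value `0` plays no role: `σ` is only needed on the range of `g`, which contains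
    -- the supports of all `k i`.
    let σ : N → L := fun n => if hn : ∃ l, g.toHom l = n then hn.choose else 0
    have hσ : ∀ l, g.toHom (σ (g.toHom l)) = g.toHom l := fun l => by
      have hn : ∃ l', g.toHom l' = g.toHom l := ⟨l, rfl⟩
      simp only [σ, dif_pos hn]
      exact hn.choose_spec
    have hσk : ∀ i, Finsupp.mapDomain g.toHom (Finsupp.mapDomain σ (k i)) = k i := by
      intro i
      rw [← Finsupp.mapDomain_comp]
      conv_rhs => rw [← Finsupp.mapDomain_id (v := k i)]
      refine Finsupp.mapDomain_congr fun n hn => ?_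
      by_cases hn' : n ∈ Set.range g.toHom
      · obtain ⟨l, rfl⟩ := hn'
        exact hσ l
      · exact absurd (hsupp n (Finsupp.mapDomain_of_notMem_range _ _ hn') i)
          (Finsupp.mem_support_iff.1 hn)
    have hmem : ∀ l x, g.toHom l = 0 → BalTensor.tmul _ _ l x ∈ (tensorMap (leftAct ι) f).range := by
      intro l x hl
      obtain ⟨a, rfl⟩ := (hfg l).1 hl
      exact ⟨BalTensor.tmul _ _ a x, rfl⟩
    have h1 : ∀ u : L →₀ X, formalTmul (leftAct ι) L u -
        formalTmul (leftAct ι) L (Finsupp.mapDomain σ (Finsupp.mapDomain g.toHom u)) ∈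
          (tensorMap (leftAct ι) f).range := by
      intro u
      induction u using Finsupp.induction_linear with
      | zero => simp
      | add a b ha hb =>
        rw [Finsupp.mapDomain_add, Finsupp.mapDomain_add, map_add, map_add, add_sub_add_comm]
        exact add_mem ha hb
      | single l x =>
        rw [Finsupp.mapDomain_single, Finsupp.mapDomain_single, formalTmul_single,
          formalTmul_single, ← AddMonoidHom.sub_apply, ← map_sub]
        exact hmem _ x (by rw [map_sub, hσ, sub_self])
    have h2 : formalTmul (leftAct ι) L (Finsupp.mapDomain σ (Finsupp.mapDomain g.toHom u)) ∈
          (tensorMap (leftAct ι) f).range := by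
      rw [hu]
      change formalTmul (leftAct ι) L (Finsupp.mapDomain.addMonoidHom σ _) ∈ _
      rw [map_sum, map_sum]
      refine sum_mem fun i _ => ?_
      have : Finsupp.mapDomain.addMonoidHom σ (formalAct (leftAct ι) N (w i) (k i)) =
          formalAct (leftAct ι) L (w i) (Finsupp.mapDomain σ (k i)) :=
        Finsupp.mapDomain_mapRange σ (k i) _ (map_zero _) (map_add (lactAt (leftAct ι) (w i)))
      rw [this, formalTmul_formalAct]
      exact hmem _ _ (by rw [← hgs, hσk, hk])
    have := add_mem (h1 u) h2
    rwa [sub_add_cancel] at this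
  · rintro ⟨z, rfl⟩
    induction z using BalTensor.induction with
    | zero => simp
    | pure k x =>
      change BalTensor.tmul _ _ (g.toHom (f.toHom k)) x = 0
      rw [(hfg _).2 ⟨k, rfl⟩, map_zero]; rfl
    | add x y hx hy => rw [map_add, map_add, hx, hy, add_zero]

/-- If `∑_j f_j(y_j) = 0`, the factorization `y_j = ∑_l k_jl w_l` gives `∑_j f_j ⊗ y_j = ∑_l (∑_j
f_j k_jl) ⊗ w_l = 0`. Surjectivity restates that `X` generates `M`. -/
theorem counitLin_bijective_of_isSeparator (h : HasLocalDualBases A C) (hsep : IsSeparator X)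
    (hideal : ∀ (t : X.endRing) (r : R), t * ι r ∈ Set.range ι)
    (hX : ∀ x, ∃ r, lact (leftAct ι) r x = x) (M : Comod A C) :
    Function.Bijective (counitLin ι M) := by
  refine ⟨(injective_iff_map_eq_zero _).2 fun z hz => ?_, fun m => ?_⟩
  · obtain ⟨J, _, f, y, hz'⟩ := BalTensor.exists_eq_sum z
    replace hz' : z = ∑ j, RTensor.tmulLin ι (f j) (y j) := hz'
    obtain ⟨L, _, k, w, hk, hrel⟩ := exists_factorization h hsep hideal hX y
    have h0 := hrel M (fun j => (f j).1) (fun j => (f j).2) (by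
      rw [hz', map_sum] at hz
      exact hz)
    rw [hz']
    have h1 : ∀ j, RTensor.tmulLin ι (f j) (y j) =
        ∑ l, RTensor.tmulLin ι ((colinMod ι M).ract (k j l) (f j)) (w l) := fun j => by
      conv_lhs => rw [hk j, map_sum]
      refine Finset.sum_congr rfl fun l _ => ?_
      rw [RTensor.tmulLin_ract]; rfl
    simp only [h1]
    rw [Finset.sum_comm]
    refine Finset.sum_eq_zero fun l _ => ?_
    have h2 : ∑ j, (colinMod ι M).ract (k j l) (f j) = 0 := by
      apply Subtype.ext
      refine (AddSubmonoidClass.coe_finsetSum _ _).trans (h0 l)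
    have h3 := congr($(map_sum (BalTensor.tmul (colinMod ι M).ract (lact (leftAct ι)))
      (fun j => (colinMod ι M).ract (k j l) (f j)) Finset.univ) (w l))
    rw [h2, map_zero, AddMonoidHom.finsetSum_apply] at h3
    exact h3.symm
  · obtain ⟨L, _, k, w, hk, rfl⟩ := Comod.exists_eq_sum_of_isSeparator h hsep m
    exact ⟨∑ l, RTensor.tmulLin ι (M := colinMod ι M) ⟨k l, hk l⟩ (w l), by
      rw [map_sum]; rfl⟩

/-- Under `X^* ≅ Hom^C(X, C)`, the canonical map is the evaluation for the comodule `C`. -/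
theorem can_bijective_of_isSeparator (h : HasLocalDualBases A C) (hsep : IsSeparator X)
    (hideal : ∀ (t : X.endRing) (r : R), t * ι r ∈ Set.range ι)
    (hX : ∀ x, ∃ r, lact (leftAct ι) r x = x) : Function.Bijective (can ι) := by
  let M := Comod.regular A C
  have ha : ∀ {ξ : Dual A X} {f : X →ₗ[Aᵐᵒᵖ] M}, Comod.IsColinear f →
      Comod.counitComp f = ξ → Comod.toRegular ξ = f := fun hf hξ => by
    rw [← hξ, Comod.toRegular_counitComp hf]
  have hc : ∀ ξ : Dual A X, Comod.counitComp (Comod.toRegular ξ) = ξ := fun ξ =>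
    LinearMap.ext (Comod.counit_toRegular ξ)
  have hcol := Comod.toRegular_colinear (M := X) h
  let a : BalTensor (dualRact ι) (lact (leftAct ι)) →+ RTensor ι (colinMod ι M) :=
    BalTensor.map (ρ' := (colinMod ι M).ract)
      (AddMonoidHom.mk' (fun ξ : Dual A X => ⟨Comod.toRegular ξ, hcol ξ⟩)
        fun ξ η => Subtype.ext (ha ((hcol ξ).add (hcol η)) (by
          refine (LinearMap.comp_add _ _ _).trans ?_
          exact congrArg₂ _ (hc ξ) (hc η)))) (AddMonoidHom.id X)
      (fun r ξ => Subtype.ext (ha (Comod.IsColinear.comp (hcol ξ) (ι r).2)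
        (congrArg (fun f : Dual A X => f.comp (ι r).1) (hc ξ)))) (fun _ _ => rfl)
  let b : RTensor ι (colinMod ι M) →+ BalTensor (dualRact ι) (lact (leftAct ι)) :=
    BalTensor.map (ρ := (colinMod ι M).ract) (ρ' := dualRact ι)
      (AddMonoidHom.mk' (fun f => Comod.counitComp f.1) fun f g => LinearMap.comp_add _ _ _)
      (AddMonoidHom.id X) (fun _ _ => rfl) (fun _ _ => rfl)
  have hab : Function.Bijective a := by
    refine Function.bijective_iff_has_inverse.2 ⟨b, fun z => ?_, fun z => ?_⟩
    · induction z using BalTensor.induction with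
      | zero => simp
      | pure ξ x => exact congrArg (fun f => BalTensor.tmul _ _ f x) (hc ξ)
      | add x y hx hy => rw [map_add, map_add, hx, hy]
    · induction z using RTensor.induction with
      | zero => simp
      | pure f x =>
        exact congrArg (fun f => RTensor.tmulLin ι (M := colinMod ι M) f x)
          (Subtype.ext (Comod.toRegular_counitComp f.2))
      | add x y hx hy => rw [map_add, map_add, hx, hy]
  have : ⇑(can ι) = counitLin ι M ∘ a := by
    funext z
    rw [Function.comp_apply]
    induction z using BalTensor.induction with
    | zero => simp
    | pure ξ x => rfl
    | add x y hx hy => simp only [map_add, hx, hy]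
  rw [this]
  exact (counitLin_bijective_of_isSeparator h hsep hideal hX M).comp hab

end Generator

/-! ### Lifting over finitely generated subcomodules. -/

section LocalProjectivity

variable {A C : Type u} [Ring A] [AddCommGroup C] [Module A C] [Module Aᵐᵒᵖ C]
  [SMulCommClass A Aᵐᵒᵖ C]

theorem exists_support_subset {S P Q I : Type*} [Ring S] [AddCommGroup P] [Module S P]
    [AddCommGroup Q] [Module S Q] {E : Submodule S P} (hE : E.FG) (k : P →ₗ[S] (I →₀ Q)) :
    ∃ T : Finset I, ∀ x ∈ E, (k x).support ⊆ T := by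
  classical
  obtain ⟨s, rfl⟩ := hE
  refine ⟨s.biUnion fun x => (k x).support, fun x hx => ?_⟩
  induction hx using Submodule.span_induction with
  | mem x hx => exact Finset.subset_biUnion_of_mem (fun x => (k x).support) hx
  | zero => simp
  | add x y _ _ hx hy =>
    rw [map_add]
    exact Finsupp.support_add.trans (Finset.union_subset hx hy)
  | smul a x _ hx =>
    rw [map_smul]
    exact Finsupp.support_smul.trans hx

variable [Coring A C] {X : Comod A C}

theorem WeaklyLocallyProjective.exists_lift (h : HasLocalDualBases A C)
    (hX : WeaklyLocallyProjective X) {M N : Comod A C} {E : Submodule Aᵐᵒᵖ X} (hE : E.FG)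
    (hEs : Comod.Stable E) {f : X →ₗ[Aᵐᵒᵖ] N} (hf : Comod.IsColinear f) {g : M →ₗ[Aᵐᵒᵖ] N}
    (hg : Comod.IsColinear g) (hgs : Function.Surjective g) :
    ∃ k : X →ₗ[Aᵐᵒᵖ] M, Comod.IsColinear k ∧ ∀ x ∈ E, g (k x) = f x := by
  have hfg : (⊤ : Submodule Aᵐᵒᵖ (hEs.sub h)).FG := (Submodule.fg_top E).2 hE
  obtain ⟨k, hk⟩ := hX (hEs.subtype_colinear h).hom hf.hom hg.hom (hEs.mono h)
    (Comod.epi_of_surjective _ hgs) (Comod.isFinGen_of_fg h _ hfg)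
  exact ⟨k.lin, k.colinear, fun x hx => congr(($hk).lin ⟨x, hx⟩)⟩

/-- Lift `f` along the epimorphism from a direct sum of copies of `X`. As `E` is finitely generated,
only finitely many coordinates of the lift matter on it. -/
theorem WeaklyLocallyProjective.exists_sum_lift (h : HasLocalDualBases A C)
    (hX : WeaklyLocallyProjective X) {N : Comod A C} {E : Submodule Aᵐᵒᵖ X} (hE : E.FG)
    (hEs : Comod.Stable E) {f : X →ₗ[Aᵐᵒᵖ] N} (hf : Comod.IsColinear f) {I : Type u}
    {t : I → X →ₗ[Aᵐᵒᵖ] N} (ht : ∀ i, Comod.IsColinear (t i))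
    (hts : ∀ n, n ∈ ⨆ i, LinearMap.range (t i)) :
    ∃ (T : Finset I) (k : I → X →ₗ[Aᵐᵒᵖ] X), (∀ i, Comod.IsColinear (k i)) ∧
      ∀ x ∈ E, ∑ i ∈ T, t i (k i x) = f x := by
  let g : (I →₀ X) →ₗ[Aᵐᵒᵖ] N := Finsupp.lsum ℕ t
  have hg1 : ∀ i, g.comp (Finsupp.lsingle i) = t i := fun i => by ext; simp [g]
  have hg : Comod.IsColinear (M := Comod.pow h I X) (N := N) g :=
    Comod.pow_colinear h fun i => by rw [hg1]; exact ht i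
  have hgs : Function.Surjective g := by
    rw [← LinearMap.range_eq_top, eq_top_iff]
    intro n _
    refine (iSup_le fun i => ?_ : ⨆ i, LinearMap.range (t i) ≤ _) (hts n)
    rw [← hg1]
    exact LinearMap.range_comp_le_range _ _
  obtain ⟨k, hk, hkE⟩ := hX.exists_lift h (M := Comod.pow h I X) hE hEs hf hg hgs
  obtain ⟨T, hT⟩ := exists_support_subset hE (k : X →ₗ[Aᵐᵒᵖ] (I →₀ X))
  refine ⟨T, fun i => (Finsupp.lapply i : (I →₀ X) →ₗ[Aᵐᵒᵖ] X).comp k,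
    fun i => Comod.IsColinear.comp (Comod.lapply_colinear h i) hk, fun x hx => ?_⟩
  rw [← hkE x hx]
  simp only [g, Finsupp.lsum_apply]
  exact (Finsupp.sum_of_support_subset _ (hT x hx) _ (by simp)).symm

/-! ### The ideal of endomorphisms of finite type -/

/-- The endomorphisms whose image lies in a finitely generated subcomodule. -/
def finEnd (X : Comod A C) : NonUnitalSubring X.endRing where
  carrier := {t | ∃ E : Submodule Aᵐᵒᵖ X, E.FG ∧ Comod.Stable E ∧ ∀ x, t.1 x ∈ E}
  zero_mem' := ⟨⊥, Submodule.fg_bot, fun φ m hm => by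
    rw [(Submodule.mem_bot _).1 hm, map_zero]; exact zero_mem _, fun _ => rfl⟩
  add_mem' := by
    rintro s t ⟨E, hE, hEs, hs⟩ ⟨F, hF, hFs, ht⟩
    exact ⟨E ⊔ F, hE.sup hF, hEs.sup hFs, fun x =>
      add_mem (Submodule.mem_sup_left (hs x)) (Submodule.mem_sup_right (ht x))⟩
  neg_mem' := by
    rintro s ⟨E, hE, hEs, hs⟩
    exact ⟨E, hE, hEs, fun x => neg_mem (hs x)⟩
  mul_mem' := by
    rintro s t ⟨E, hE, hEs, hs⟩ _
    exact ⟨E, hE, hEs, fun x => hs (t.1 x)⟩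

theorem mul_mem_finEnd (t : X.endRing) {r : X.endRing} (hr : r ∈ finEnd X) : t * r ∈ finEnd X := by
  obtain ⟨E, hE, hEs, h⟩ := hr
  exact ⟨E.map t.1, hE.map _, hEs.map t.2, fun x => ⟨r.1 x, h x, rfl⟩⟩

theorem mul_mem_finEnd' (t : X.endRing) {r : X.endRing} (hr : r ∈ finEnd X) : r * t ∈ finEnd X := by
  obtain ⟨E, hE, hEs, h⟩ := hr
  exact ⟨E, hE, hEs, fun x => h (t.1 x)⟩

/-- The inclusion of the endomorphisms of finite type. -/
def finIncl (X : Comod A C) : finEnd X →ₙ+* X.endRing := NonUnitalSubringClass.subtype (finEnd X)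

theorem finIncl_injective : Function.Injective (finIncl X) := Subtype.val_injective

theorem finIncl_mul_mem_range (t : X.endRing) (r : finEnd X) :
    t * finIncl X r ∈ Set.range (finIncl X) := ⟨⟨_, mul_mem_finEnd t r.2⟩, rfl⟩

theorem finIncl_mul_mem_range' (t : X.endRing) (r : finEnd X) :
    finIncl X r * t ∈ Set.range (finIncl X) := ⟨⟨_, mul_mem_finEnd' t r.2⟩, rfl⟩

/-- A morphism from `X` to the subcomodule generated by `x` becomes an endomorphism of finite type
of `X`, and such morphisms reach `x`. -/
theorem mem_iSup_range_finIncl (h : HasLocalDualBases A C) (hsep : IsSeparator X) (x : X) :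
    x ∈ ⨆ r : finEnd X, LinearMap.range (finIncl X r).1 := by
  have hE := Comod.stable_gen x
  obtain ⟨L, _, k, w, hk, hw⟩ := Comod.exists_eq_sum_of_isSeparator h hsep
    (M := hE.sub h) ⟨x, Comod.mem_gen x⟩
  have := congrArg (Comod.gen x).subtype hw
  rw [map_sum] at this
  have h1 : x = ∑ l, (Comod.gen x).subtype (k l (w l)) := this
  rw [h1]
  refine sum_mem fun l _ => Submodule.mem_iSup_of_mem
    ⟨⟨(Comod.gen x).subtype.comp (k l), Comod.IsColinear.comp (hE.subtype_colinear h) (hk l)⟩,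
      Comod.gen x, Comod.fg_gen h x, hE, fun y => (k l y).2⟩ ⟨w l, rfl⟩

/-- Lift the identity over `E` along the sum of all `r` in the ideal. The lift has the form `e = ∑ r
k_r`, which lies in the ideal because it is closed under right multiplication. -/
theorem exists_finEnd_eq_self (h : HasLocalDualBases A C) (hX : WeaklyLocallyProjective X)
    (hsep : IsSeparator X) {E : Submodule Aᵐᵒᵖ X} (hE : E.FG) (hEs : Comod.Stable E) :
    ∃ e : finEnd X, ∀ x ∈ E, (finIncl X e).1 x = x := by
  obtain ⟨T, k, hk, hT⟩ := hX.exists_sum_lift h hE hEs Comod.IsColinear.id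
    (t := fun r : finEnd X => (finIncl X r).1) (fun r => (finIncl X r).2)
    (mem_iSup_range_finIncl h hsep)
  refine ⟨⟨∑ r ∈ T, r.1 * ⟨k r, hk r⟩, sum_mem fun r _ => mul_mem_finEnd' _ r.2⟩, fun x hx => ?_⟩
  refine Eq.trans ?_ (hT x hx)
  change (∑ r ∈ T, r.1 * (⟨k r, hk r⟩ : X.endRing) : X.endRing).1 x = _
  rw [AddSubmonoidClass.coe_finsetSum, LinearMap.sum_apply]
  rfl

theorem exists_finEnd_apply_eq (h : HasLocalDualBases A C) (hX : WeaklyLocallyProjective X)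
    (hsep : IsSeparator X) (x : X) : ∃ r, lact (leftAct (finIncl X)) r x = x := by
  obtain ⟨e, he⟩ := exists_finEnd_eq_self h hX hsep (Comod.fg_gen h x) (Comod.stable_gen x)
  exact ⟨e, he x (Comod.mem_gen x)⟩

theorem hasLeftLocalUnits_finEnd (h : HasLocalDualBases A C) (hX : WeaklyLocallyProjective X)
    (hsep : IsSeparator X) : HasLeftLocalUnits (finEnd X) := by
  classical
  intro s
  obtain ⟨E, hE, hEs, hs⟩ : ∃ E : Submodule Aᵐᵒᵖ X, E.FG ∧ Comod.Stable E ∧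
      ∀ r ∈ s, ∀ x, (finIncl X r).1 x ∈ E := by
    induction s using Finset.induction_on with
    | empty => exact ⟨⊥, Submodule.fg_bot, fun φ m hm => by
        rw [(Submodule.mem_bot _).1 hm, map_zero]; exact zero_mem _, by simp⟩
    | insert a s _ ih =>
      obtain ⟨E, hE, hEs, hs⟩ := ih
      obtain ⟨F, hF, hFs, ha⟩ := a.2
      refine ⟨E ⊔ F, hE.sup hF, hEs.sup hFs, fun r hr x => ?_⟩
      rcases Finset.mem_insert.1 hr with rfl | hr
      · exact Submodule.mem_sup_right (ha x)
      · exact Submodule.mem_sup_left (hs r hr x)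
  obtain ⟨e, he⟩ := exists_finEnd_eq_self h hX hsep hE hEs
  exact ⟨e, fun r hr => Subtype.ext (Subtype.ext (LinearMap.ext fun x => he _ (hs r hr x)))⟩

/-! ### Weak local projectivity over the base ring -/

/-- The counit of `C` as a right `A`-linear map. -/
def counitRight (A C : Type u) [Ring A] [AddCommGroup C] [Module A C] [Module Aᵐᵒᵖ C]
    [SMulCommClass A Aᵐᵒᵖ C] [Coring A C] : C →ₗ[Aᵐᵒᵖ] A :=
  ⟨(Coring.counit (A := A) (C := C)).toAddHom, Coring.counit_op_smul⟩

/-- The map `⨁_X C → X ⊗_A C` sending `c` in the component `x` to `x ⊗ c`. -/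
noncomputable def sumTmul (X : Comod A C) : (X →₀ C) →ₗ[Aᵐᵒᵖ] ATensor A X C :=
  Finsupp.lsum ℕ fun x =>
    ({ toFun := fun c => ATensor.tmul A x c
       map_add' := map_add _
       map_smul' := fun _ _ => rfl } : C →ₗ[Aᵐᵒᵖ] ATensor A X C)

theorem sumTmul_single (x : X) (c : C) :
    sumTmul X (Finsupp.single x c) = ATensor.tmul A x c := by
  rw [sumTmul, Finsupp.lsum_single]; rfl

theorem sumTmul_surjective : Function.Surjective (sumTmul X) := by
  intro z
  induction z using ATensor.induction with
  | zero => exact ⟨0, map_zero _⟩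
  | pure x c => exact ⟨_, sumTmul_single x c⟩
  | add x y hx hy =>
    obtain ⟨a, rfl⟩ := hx
    obtain ⟨b, rfl⟩ := hy
    exact ⟨a + b, map_add _ _ _⟩

/-- The map `⨁_X C → X` sending `c` in the component `x` to `x ε(c)`. -/
noncomputable def sumCounit (X : Comod A C) : (X →₀ C) →ₗ[Aᵐᵒᵖ] X :=
  Finsupp.lsum ℕ fun x => (spanMap A x).comp (counitRight A C)

theorem sumCounit_eq (w : X →₀ C) :
    sumCounit X w = ATensor.slice Coring.counit (sumTmul X w) := by
  induction w using Finsupp.induction_linear with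
  | zero => simp
  | add f g hf hg => simp only [map_add, hf, hg]
  | single x c => rw [sumTmul_single, sumCounit, Finsupp.lsum_single]; rfl

theorem sumTmul_hit (h : HasLocalDualBases A C) (φ : C →ₗ[A] A) (w : X →₀ C) :
    sumTmul X ((Comod.pow h X (Comod.regular A C)).hit φ w) =
      ATensor.map LinearMap.id (conv φ) (sumTmul X w) := by
  induction w using Finsupp.induction_linear with
  | zero => rw [map_zero]; exact (map_zero (sumTmul X)).trans (by rw [map_zero, map_zero])
  | add f g hf hg =>
    refine (congrArg (sumTmul X) (map_add ((Comod.pow h X (Comod.regular A C)).hit φ) f g)).trans ?_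
    refine (map_add (sumTmul X) _ _).trans ((congrArg₂ (· + ·) hf hg).trans ?_)
    rw [map_add (sumTmul X) f g, map_add]
  | single x c =>
    rw [sumTmul_single, ATensor.map_tmul, LinearMap.id_apply, ← sumTmul_single]
    exact congrArg _ ((Comod.single_colinear h (M := Comod.regular A C) x).hit φ c).symm

/-- A lift `k` of the identity over `E` to the subcomodule `U` of `⨁_X C` lying over `ρ(X)` has
coordinates `k_y : X → C`. Then `x = ∑_y y ε(k_y(x))` on `E`, so the functionals `ε ∘ k_y` form a
dual basis. -/
theorem WeaklyLocallyProjective.exists_dualBasis (h : HasLocalDualBases A C)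
    (hX : WeaklyLocallyProjective X) {E : Submodule Aᵐᵒᵖ X} (hE : E.FG) (hEs : Comod.Stable E) :
    ∃ z : DualTensor A X, ∀ x ∈ E, DualTensor.ev z x = x := by
  let P := Comod.pow h X (Comod.regular A C)
  -- Colinearity of `∑ y ⊗ c ↦ ∑ y ε(c)` is obtained from `hU`, which holds over the image of `ρ`;
  -- hence the restriction to `U`.
  let U : Submodule Aᵐᵒᵖ P := Submodule.comap (sumTmul X) (LinearMap.range X.coact)
  have hU : ∀ w : X →₀ C, w ∈ U → sumTmul X w = X.coact (sumCounit X w) := by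
    rintro w ⟨x, hx⟩
    rw [sumCounit_eq, ← hx]
    exact congrArg _ (X.counit x).symm
  have hUs : Comod.Stable U := by
    rintro φ w ⟨x, hx⟩
    exact ⟨X.hit φ x, by rw [Comod.coact_hit, hx, sumTmul_hit]⟩
  let g : hUs.sub h →ₗ[Aᵐᵒᵖ] X := (sumCounit X).comp U.subtype
  have hg : Comod.IsColinear g := Comod.isColinear_of_hit h fun φ w => by
    have h1 : (((hUs.sub h).hit φ w : U) : X →₀ C) = P.hit φ w.1 := hUs.coe_slice_coact h φ w
    change sumCounit X ((hUs.sub h).hit φ w : U).1 = X.hit φ (sumCounit X w.1)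
    rw [h1, sumCounit_eq, sumTmul_hit, hU _ w.2, ← Comod.coact_hit]
    exact X.counit _
  have hgs : Function.Surjective g := fun x => by
    obtain ⟨w, hw⟩ := sumTmul_surjective (X.coact x)
    refine ⟨⟨w, x, hw.symm⟩, ?_⟩
    change sumCounit X w = x
    rw [sumCounit_eq, hw]
    exact X.counit x
  obtain ⟨k, hk, hkE⟩ := hX.exists_lift h hE hEs Comod.IsColinear.id hg hgs
  let k' : X →ₗ[Aᵐᵒᵖ] (X →₀ C) := U.subtype.comp k
  obtain ⟨T, hT⟩ := exists_support_subset hE k'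
  refine ⟨∑ y ∈ T, ATensor.tmul A y ((counitRight A C).comp ((Finsupp.lapply y).comp k')),
    fun x hx => ?_⟩
  refine Eq.trans ?_ (hkE x hx)
  rw [map_sum, LinearMap.sum_apply]
  change _ = sumCounit X (k' x)
  rw [sumCounit, Finsupp.lsum_apply, Finsupp.sum_of_support_subset _ (hT x hx) _ (by simp)]
  rfl

end LocalProjectivity

/-! ### The action of `X ⊗_A X^*` on `X`. -/

section DualTensorAction

variable {A X : Type*} [Ring A] [AddCommGroup X] [Module Aᵐᵒᵖ X]

/-- Indeed `(y ⊗ η) z = y ⊗ (η ∘ ev z)` depends only on the action of `z`. -/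
theorem DualTensor.mul_eq_zero_of_ev_eq_zero {z : DualTensor A X} (hz : ev z = 0)
    (w : DualTensor A X) : w * z = 0 := by
  induction w using ATensor.induction with
  | zero => exact zero_mul z
  | pure y η =>
    have key : ∀ z : DualTensor A X, (ATensor.tmul A y η : DualTensor A X) * z =
        ATensor.tmul A y (η.comp (ev z)) := by
      intro z
      induction z using ATensor.induction with
      | zero =>
        rw [map_zero, LinearMap.comp_zero, map_zero]
        exact mul_zero _
      | pure x ξ =>
        rw [tmul_mul_tmul, ATensor.tmul_balanced]
        congr 1
        ext v
        rw [LinearMap.comp_apply, ev_tmul, map_smul]; rfl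
      | add a b ha hb =>
        rw [map_add, LinearMap.comp_add, map_add, ← ha, ← hb]
        exact mul_add _ _ _
    rw [key, hz, LinearMap.comp_zero, map_zero]
  | add a b ha hb => rw [add_mul, ha, hb, add_zero]

/-- The right multiplication by an endomorphism on `X ⊗_A X^*`. -/
def DualTensor.compRight (t : Module.End Aᵐᵒᵖ X) : DualTensor A X →+ DualTensor A X :=
  ATensor.map LinearMap.id
    { toFun := fun ξ : Dual A X => ξ.comp t
      map_add' := fun _ _ => rfl
      map_smul' := fun _ _ => rfl }

theorem DualTensor.ev_compRight (t : Module.End Aᵐᵒᵖ X) (z : DualTensor A X) :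
    ev (compRight t z) = ev z * t := by
  induction z using ATensor.induction with
  | zero => simp
  | pure x ξ => rfl
  | add a b ha hb => rw [map_add, map_add, ha, hb, map_add, add_mul]

end DualTensorAction

/-! ### The ring morphism from the ideal to `X ⊗_A X^*`. -/

section Kappa

variable {A C : Type u} [Ring A] [AddCommGroup C] [Module A C] [Module Aᵐᵒᵖ C]
  [SMulCommClass A Aᵐᵒᵖ C] [Coring A C] {X : Comod A C}

/-- A dual basis `w` on a subcomodule containing the first factors of `z` satisfies `w z = z`, while
`w z = 0` if `z` acts as zero. -/
theorem WeaklyLocallyProjective.ev_injective (h : HasLocalDualBases A C)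
    (hX : WeaklyLocallyProjective X) :
    Function.Injective (DualTensor.ev : DualTensor A X →+ Module.End Aᵐᵒᵖ X) := by
  refine (injective_iff_map_eq_zero _).2 fun z hz => ?_
  obtain ⟨E, hE, hEs, hw⟩ : ∃ E : Submodule Aᵐᵒᵖ X, E.FG ∧ Comod.Stable E ∧
      ∀ w : DualTensor A X, (∀ x ∈ E, DualTensor.ev w x = x) → w * z = z := by
    clear hz
    induction z using ATensor.induction with
    | zero => exact ⟨⊥, Submodule.fg_bot, fun φ m hm => by
        rw [(Submodule.mem_bot _).1 hm, map_zero]; exact zero_mem _, fun w _ => mul_zero w⟩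
    | pure x ξ =>
      refine ⟨Comod.gen x, Comod.fg_gen h x, Comod.stable_gen x, fun w hw => ?_⟩
      rw [DualTensor.mul_def, ATensor.map_tmul, hw x (Comod.mem_gen x)]; rfl
    | add a b ha hb =>
      obtain ⟨E, hE, hEs, ha⟩ := ha
      obtain ⟨F, hF, hFs, hb⟩ := hb
      refine ⟨E ⊔ F, hE.sup hF, hEs.sup hFs, fun w hw => ?_⟩
      refine (mul_add w a b).trans ?_
      rw [ha w fun x hx => hw x (Submodule.mem_sup_left hx),
        hb w fun x hx => hw x (Submodule.mem_sup_right hx)]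
  obtain ⟨w, hw'⟩ := hX.exists_dualBasis h hE hEs
  rw [← hw w hw', DualTensor.mul_eq_zero_of_ev_eq_zero hz]

/-- A dual basis on a subcomodule containing the image of `r`, composed with `r`, represents `r`.
The representative is unique by `ev_injective`, which makes `κ` a ring morphism. -/
theorem weaklyRLocallyProjective_finIncl (h : HasLocalDualBases A C)
    (hX : WeaklyLocallyProjective X) (hsep : IsSeparator X) :
    WeaklyRLocallyProjective (finIncl X) := by
  have hinj := hX.ev_injective h
  have hex : ∀ r : finEnd X, ∃ z : DualTensor A X, DualTensor.ev z = (finIncl X r).1 := by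
    rintro ⟨r, E, hE, hEs, hr⟩
    obtain ⟨z, hz⟩ := hX.exists_dualBasis h hE hEs
    refine ⟨DualTensor.compRight r.1 z, ?_⟩
    rw [DualTensor.ev_compRight]
    exact LinearMap.ext fun x => hz _ (hr x)
  choose κ hκ using hex
  refine ⟨{ toFun := κ
            map_mul' := fun r s => hinj (by rw [DualTensor.ev_mul, hκ, hκ, hκ]; rfl)
            map_zero' := hinj (by rw [hκ, map_zero, map_zero]; rfl)
            map_add' := fun r s => hinj (by rw [map_add, hκ, hκ, hκ]; rfl) },
    fun r x => congr($(hκ r) x), fun x => ?_⟩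
  obtain ⟨r, hr⟩ := exists_finEnd_apply_eq h hX hsep x
  exact ⟨r, congr($(hκ r) x).trans hr⟩

end Kappa

/-! ### Elements that vanish after tensoring are annihilated by the ring. -/

section Proper

variable {A C : Type u} [Ring A] [AddCommGroup C] [Module A C] [Module Aᵐᵒᵖ C]
  [SMulCommClass A Aᵐᵒᵖ C] [Coring A C] {X : Comod A C}

/-- The relations witnessing `n ⊗ x = 0` can be taken supported at `n` alone. They then read `x = ∑
t_l w_l` with `n t_l = 0`. -/
theorem mem_iSup_range_annihilator (h : HasLocalDualBases A C)
    (hX : WeaklyLocallyProjective X) (hsep : IsSeparator X) {N : RMod (finEnd X)} {n : N}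
    (hn : RTensor.tmulLin (finIncl X) n = 0) (x : X) :
    x ∈ ⨆ t : {t : finEnd X // N.ract t n = 0}, LinearMap.range (finIncl X t.1).1 := by
  classical
  obtain ⟨L, _, k, w, hk, hu, hs⟩ := exists_supported_trivial_relations h hsep
    finIncl_injective finIncl_mul_mem_range (exists_finEnd_apply_eq h hX hsep)
    (u := Finsupp.single n x) ((formalTmul_single n x).trans congr($hn x))
  have hkn : ∀ l, k l = Finsupp.single n (k l n) := fun l => by
    ext1 m
    by_cases hm : m = n
    · rw [hm, Finsupp.single_eq_same]
    · rw [Finsupp.single_eq_of_ne hm, hs m (Finsupp.single_eq_of_ne hm) l]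
  have hx : x = ∑ l, (finIncl X (k l n)).1 (w l) := by
    have := congr($hu n)
    rw [Finsupp.single_eq_same, Finsupp.finsetSum_apply] at this
    exact this
  rw [hx]
  refine sum_mem fun l _ => Submodule.mem_iSup_of_mem ⟨k l n, ?_⟩ ⟨w l, rfl⟩
  rw [← formalSum_single, ← hkn, hk]

/-- Lifting the identity over `E ⊇ im r` through the `t i` gives `∑ t_i k_i = id` on `E`; multiply
by `r` on the right. -/
theorem finEnd_eq_sum (h : HasLocalDualBases A C) (hX : WeaklyLocallyProjective X)
    {I : Type u} (t : I → finEnd X) (ht : ∀ x, x ∈ ⨆ i, LinearMap.range (finIncl X (t i)).1)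
    (r : finEnd X) : ∃ (T : Finset I) (s : I → finEnd X), r = ∑ i ∈ T, t i * s i := by
  obtain ⟨r, E, hE, hEs, hr⟩ := r
  obtain ⟨T, k, hk, hT⟩ := hX.exists_sum_lift h hE hEs Comod.IsColinear.id
    (fun i => (finIncl X (t i)).2) ht
  refine ⟨T, fun i => ⟨⟨k i, hk i⟩ * r, mul_mem_finEnd _ ⟨E, hE, hEs, hr⟩⟩,
    finIncl_injective (Subtype.ext (LinearMap.ext fun x => ?_))⟩
  refine (hT _ (hr x)).symm.trans ?_
  rw [map_sum, AddSubmonoidClass.coe_finsetSum, LinearMap.sum_apply]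
  rfl

theorem ract_eq_zero_of_tmulLin_eq_zero (h : HasLocalDualBases A C)
    (hX : WeaklyLocallyProjective X) (hsep : IsSeparator X) {N : RMod (finEnd X)} {n : N}
    (hn : RTensor.tmulLin (finIncl X) n = 0) (r : finEnd X) : N.ract r n = 0 := by
  obtain ⟨T, s, rfl⟩ := finEnd_eq_sum h hX (fun t : {t : finEnd X // N.ract t n = 0} => t.1)
    (mem_iSup_range_annihilator h hX hsep hn) r
  let a : finEnd X →+ N := AddMonoidHom.mk' (fun r => N.ract r n) fun a b => N.ract_add_apply a b n
  refine (map_sum a _ T).trans (Finset.sum_eq_zero fun t _ => ?_)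
  change N.ract _ n = 0
  rw [N.ract_mul, t.2, map_zero]

end Proper

/-! ### The functor as an equivalence with firm Hom modules as inverse. -/

section Equivalence

variable {A C : Type u} [Ring A] [AddCommGroup C] [Module A C] [Module Aᵐᵒᵖ C]
  [SMulCommClass A Aᵐᵒᵖ C] [Coring A C] {X : Comod A C} {R : Type u} [NonUnitalRing R]
  {ι : R →ₙ+* X.endRing}

theorem tensorFunctor_faithful
    (hp : ∀ (N : RMod R) (n : N), RTensor.tmulLin ι n = 0 → ∀ r, N.ract r n = 0) :
    (tensorFunctor ι).Faithful where
  map_injective {M N f g} hfg := FirmMod.hom_ext fun m => by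
    induction m using RMod.IsFirm.induction M.property with
    | zero => rw [map_zero, map_zero]
    | ract r m =>
      rw [f.hom.linear, g.hom.linear, ← sub_eq_zero, ← map_sub]
      refine hp N.obj _ (LinearMap.ext fun x => ?_) r
      have h1 : RTensor.tmulLin ι (f.hom.toHom m) x = RTensor.tmulLin ι (g.hom.toHom m) x :=
        congr(($hfg).lin (RTensor.tmulLin ι m x))
      refine (congr($(map_sub (BalTensor.tmul N.obj.ract (lact (leftAct ι))) _ _) x)).trans ?_
      exact sub_eq_zero.2 h1
    | add x y hx hy => rw [map_add, map_add, hx, hy]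

/-- The firm module `Hom^C(X, M) ⊗_R R`. -/
abbrev firmHom (ι : R →ₙ+* X.endRing) (hR : HasLeftLocalUnits R) (M : Comod A C) : FirmMod R :=
  ⟨_, RMod.isFirm_tensorR hR (colinMod ι M)⟩

/-- The evaluation `(Hom^C(X, M) ⊗_R R) ⊗_R X → M`. -/
def firmCounit (ι : R →ₙ+* X.endRing) (hR : HasLeftLocalUnits R) (M : Comod A C) :
    (tensorFunctor ι).obj (firmHom ι hR M) ⟶ M :=
  RTensor.comodMap ι (colinMod ι M).mulR ≫ counitHom ι M

theorem isIso_firmCounit (h : HasLocalDualBases A C) (hR : HasLeftLocalUnits R)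
    (hX : IsFirmLeft (leftAct ι)) (M : Comod A C) (hε : Function.Bijective (counitLin ι M)) :
    IsIso (firmCounit ι hR M) := by
  refine Comod.isIso_of_bijective h _ ?_
  exact hε.comp (RMod.tensorMap_mulR_bijective hX (colinMod ι M))

/-- The map induced on `Hom^C(X, -) ⊗_R R` by a morphism of comodules. -/
def firmHomMap (ι : R →ₙ+* X.endRing) (hR : HasLeftLocalUnits R) {M N : Comod A C} (g : M ⟶ N) :
    firmHom ι hR M ⟶ firmHom ι hR N :=
  ObjectProperty.homMk (RMod.mapR (colinMap ι g))

theorem firmCounit_naturality (hR : HasLeftLocalUnits R) {M N : Comod A C} (g : M ⟶ N) :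
    (tensorFunctor ι).map (firmHomMap ι hR g) ≫ firmCounit ι hR N = firmCounit ι hR M ≫ g := by
  refine Comod.hom_ext fun z => ?_
  change counitLin ι N (RTensor.mapLin ι (colinMod ι N).mulR
    (RTensor.mapLin ι (RMod.mapR (colinMap ι g)) z)) =
    g.lin (counitLin ι M (RTensor.mapLin ι (colinMod ι M).mulR z))
  rw [← counitLin_naturality]
  congr 1
  induction z using RTensor.induction with
  | zero => simp
  | pure w x =>
    rw [RTensor.mapLin_tmul, RTensor.mapLin_tmul, RTensor.mapLin_tmul, RTensor.mapLin_tmul,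
      RMod.mulR_mapR]
  | add x y hx hy => simp only [map_add, hx, hy]

/-- The map `N → Hom^C(X, N ⊗_R X)`, `n ↦ (x ↦ n ⊗ x)`. -/
def tensorUnit (ι : R →ₙ+* X.endRing) (N : RMod R) : N ⟶ colinMod ι (RTensor.comod ι N) where
  toHom := AddMonoidHom.mk'
    (fun n => ⟨RTensor.tmulLin ι n, fun x => RTensor.coact_tmul ι N n x⟩)
    fun a b => Subtype.ext (RTensor.tmulLin_add ι a b)
  linear r n := Subtype.ext (RTensor.tmulLin_ract ι r n)

/-- The lift of `N → Hom^C(X, N ⊗_R X)` to `Hom^C(X, N ⊗_R X) ⊗_R R`, for a firm module `N`. -/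
noncomputable def firmUnit (ι : R →ₙ+* X.endRing) (hR : HasLeftLocalUnits R) (N : FirmMod R) :
    N ⟶ firmHom ι hR ((tensorFunctor ι).obj N) :=
  ObjectProperty.homMk (RMod.IsFirm.lift N.property (tensorUnit ι N.obj))

theorem map_firmUnit_firmCounit (hR : HasLeftLocalUnits R) (N : FirmMod R) :
    (tensorFunctor ι).map (firmUnit ι hR N) ≫ firmCounit ι hR ((tensorFunctor ι).obj N) = 𝟙 _ := by
  refine Comod.hom_ext fun z => ?_
  change counitLin ι (RTensor.comod ι N.obj) (RTensor.mapLin ι (colinMod ι _).mulR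
    (RTensor.mapLin ι (RMod.IsFirm.lift N.property (tensorUnit ι N.obj)) z)) = z
  induction z using RTensor.induction with
  | zero => rw [map_zero, map_zero]; exact map_zero _
  | pure n x =>
    rw [RTensor.mapLin_tmul, RTensor.mapLin_tmul, ← RMod.comp_apply, RMod.IsFirm.lift_mulR]
    rfl
  | add x y hx hy =>
    rw [map_add, map_add]
    exact (map_add _ _ _).trans (congrArg₂ (· + ·) hx hy)

/-- By the triangle identity the functor sends the unit to an isomorphism. Being faithful, it
reflects monomorphisms and epimorphisms, and over firm modules a surjective monomorphism is an
isomorphism. -/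
theorem isIso_firmUnit (h : HasLocalDualBases A C) (hR : HasLeftLocalUnits R)
    (hX : IsFirmLeft (leftAct ι)) (hε : ∀ M, Function.Bijective (counitLin ι M))
    [(tensorFunctor ι).Faithful] (N : FirmMod R) : IsIso (firmUnit ι hR N) := by
  have := isIso_firmCounit h hR hX _ (hε ((tensorFunctor ι).obj N))
  have h1 := map_firmUnit_firmCounit (ι := ι) hR N
  have : IsIso ((tensorFunctor ι).map (firmUnit ι hR N)) := by
    rw [← IsIso.eq_comp_inv, Category.id_comp] at h1
    rw [h1]
    infer_instance
  have := (tensorFunctor ι).mono_of_mono_map (f := firmUnit ι hR N) inferInstance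
  have := (tensorFunctor ι).epi_of_epi_map (f := firmUnit ι hR N) inferInstance
  exact FirmMod.isIso_of_mono_of_surjective hR _ (FirmMod.surjective_of_epi _)

theorem tensorFunctor_isEquivalence (h : HasLocalDualBases A C) (hR : HasLeftLocalUnits R)
    (hX : IsFirmLeft (leftAct ι)) (hε : ∀ M, Function.Bijective (counitLin ι M))
    [(tensorFunctor ι).Faithful] : (tensorFunctor ι).IsEquivalence where
  full := ⟨fun {N N'} φ => by
    have := isIso_firmUnit h hR hX hε N'
    refine ⟨firmUnit ι hR N ≫ firmHomMap ι hR φ ≫ inv (firmUnit ι hR N'), ?_⟩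
    have h1 := map_firmUnit_firmCounit (ι := ι) hR N'
    have h2 : firmCounit ι hR ((tensorFunctor ι).obj N') =
        inv ((tensorFunctor ι).map (firmUnit ι hR N')) := (IsIso.inv_eq_of_hom_inv_id h1).symm
    rw [Functor.map_comp, Functor.map_comp, Functor.map_inv, ← h2, firmCounit_naturality,
      ← Category.assoc, map_firmUnit_firmCounit, Category.id_comp]⟩
  essSurj := ⟨fun M => by
    have := isIso_firmCounit h hR hX M (hε M)
    exact ⟨firmHom ι hR M, ⟨asIso (firmCounit ι hR M)⟩⟩⟩

end Equivalence

/-! ### A criterion for exactness from a given kernel and cokernel. -/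

section Exactness

variable {𝒞 : Type*} [Category 𝒞] [Limits.HasZeroMorphisms 𝒞]

/-- Homology data are assembled directly with homology `Z`: the zero map from `K` is a cokernel of
the epimorphism `f'`, and the zero map into `Q` is a kernel of the monomorphism `g'`. -/
theorem ShortComplex.exact_of_epi_of_mono (S : ShortComplex 𝒞) {Z K Q : 𝒞} (hZ : Limits.IsZero Z)
    {i : K ⟶ S.X₂} {wi : i ≫ S.g = 0} (hi : Limits.IsLimit (Limits.KernelFork.ofι i wi))
    {p : S.X₂ ⟶ Q} {wp : S.f ≫ p = 0} (hp : Limits.IsColimit (Limits.CokernelCofork.ofπ p wp))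
    {f' : S.X₁ ⟶ K} [Epi f'] (hf' : f' ≫ i = S.f) {g' : Q ⟶ S.X₃} [Mono g'] (hg' : p ≫ g' = S.g) :
    S.Exact := by
  have h1 : hi.lift (Limits.KernelFork.ofι S.f S.zero) = f' := Limits.Fork.IsLimit.hom_ext hi
    ((Limits.Fork.IsLimit.lift_ι hi).trans hf'.symm)
  have h2 : hp.desc (Limits.CokernelCofork.ofπ S.g S.zero) = g' := Limits.Cofork.IsColimit.hom_ext
    hp ((Limits.Cofork.IsColimit.π_desc hp).trans hg'.symm)
  exact ⟨{ left :=
             { K := K, H := Z, i := i, π := 0, wi := wi, hi := hi, wπ := Limits.comp_zero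
               hπ := Limits.CokernelCofork.IsColimit.ofEpiOfIsZero _ (h1 ▸ ‹Epi f'›) hZ }
           right :=
             { Q := Q, H := Z, p := p, ι := 0, wp := wp, hp := hp, wι := Limits.zero_comp
               hι := Limits.KernelFork.IsLimit.ofMonoOfIsZero _ (h2 ▸ ‹Mono g'›) hZ }
           iso := Iso.refl Z
           comm := by
             change 0 ≫ _ = i ≫ p
             rw [Limits.zero_comp, ← cancel_epi f', ← Category.assoc, hf', wp, Limits.comp_zero] },
    hZ⟩

end Exactness

/-! ### Faithful flatness from flatness and faithfulness. -/

section FaithfullyFlat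

variable {A C : Type u} [Ring A] [AddCommGroup C] [Module A C] [Module Aᵐᵒᵖ C]
  [SMulCommClass A Aᵐᵒᵖ C] [Coring A C] {X : Comod A C} {R : Type u} [NonUnitalRing R]
  {ι : R →ₙ+* X.endRing}

theorem FirmMod.isZero_of_forall_eq_zero {Z : FirmMod R} (hZ : ∀ z : Z.obj, z = 0) :
    Limits.IsZero Z where
  unique_to N := ⟨⟨⟨0⟩, fun f => FirmMod.hom_ext fun z => by
    rw [hZ z, map_zero, map_zero]⟩⟩
  unique_from N := ⟨⟨⟨0⟩, fun f => FirmMod.hom_ext fun z => (hZ _).trans (hZ _).symm⟩⟩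

variable (R) in
/-- The zero module. -/
abbrev FirmMod.zero : FirmMod R :=
  ⟨RMod.ofRact PUnit (fun _ => 0) (fun _ _ _ => rfl) (fun _ _ _ => rfl), by
    refine ⟨(injective_iff_map_eq_zero _).2 fun z _ => ?_, fun _ => ⟨0, rfl⟩⟩
    induction z using BalTensor.induction with
    | zero => rfl
    | pure m r => rw [show m = 0 from rfl, map_zero]; rfl
    | add x y hx hy =>
      rw [hx rfl, hy rfl, add_zero]⟩

/-- Exactness says that `K` maps epimorphically to the kernel and the cokernel maps monomorphically
to `N`. A faithful functor reflects both properties, and after tensoring they follow from flatness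
and the assumed exactness. -/
theorem isFaithfullyFlatLeft_of_faithful (hR : HasLeftLocalUnits R)
    (hX : IsFirmLeft (leftAct ι)) (hflat : IsFlatLeft (leftAct ι))
    [(tensorFunctor ι).Faithful] : IsFaithfullyFlatLeft (leftAct ι) := by
  refine ⟨hflat, fun K L N f g hfg => ?_⟩
  have w : f ≫ g = 0 := (tensorFunctor ι).map_injective (Comod.hom_ext fun z => by
    refine congr(($((tensorFunctor ι).map_comp f g)).lin z).trans ?_
    exact ((hfg _).2 ⟨z, rfl⟩).trans (tensorMap_zero z).symm)
  have hw : ∀ k, g.hom.toHom (f.hom.toHom k) = 0 := fun k => congr(($w).hom.toHom k)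
  let U := L.obj.sub g.hom.toHom.ker (RMod.ract_mem_ker g.hom)
  let u : U ⟶ L.obj := L.obj.subι g.hom.toHom.ker (RMod.ract_mem_ker g.hom)
  -- The kernel in firm modules is the firm replacement of the set-theoretic kernel `U`; the tensor
  -- product with `X` does not distinguish them.
  let Z : FirmMod R := ⟨_, RMod.isFirm_tensorR hR U⟩
  let i : Z ⟶ L := ObjectProperty.homMk (U.mulR ≫ u)
  have hi : Mono i := FirmMod.mono_of_injective _ u Subtype.val_injective
  have wi : i ≫ g = 0 := FirmMod.hom_ext fun z => (U.mulR.toHom z).2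
  let lk : ∀ {W : FirmMod R} (k : W ⟶ L), k ≫ g = 0 → (W.obj ⟶ U) := fun {W} k hk =>
    ⟨k.hom.toHom.codRestrict g.hom.toHom.ker fun w => congr(($hk).hom.toHom w),
      fun r w => Subtype.ext (k.hom.linear r w)⟩
  have hlk : ∀ {W : FirmMod R} (k : W ⟶ L) (hk : k ≫ g = 0),
      (ObjectProperty.homMk (RMod.IsFirm.lift W.property (lk k hk)) : W ⟶ Z) ≫ i = k := by
    intro W k hk
    refine FirmMod.hom_ext fun x => ?_
    exact congr(u.toHom (($(RMod.IsFirm.lift_mulR W.property (lk k hk))).toHom x))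
  let Q : FirmMod R := ⟨_, RMod.isFirm_quot K.property L.property f.hom⟩
  let p : L ⟶ Q := ObjectProperty.homMk (L.obj.quotπ _ (RMod.ract_mem_range f.hom))
  have hps : Function.Surjective p.hom.toHom := QuotientAddGroup.mk_surjective
  have hp : Epi p := ⟨fun a b hab => FirmMod.hom_ext fun q => by
    obtain ⟨l, rfl⟩ := hps q
    exact congr(($hab).hom.toHom l)⟩
  have wp : f ≫ p = 0 := FirmMod.hom_ext fun k => (QuotientAddGroup.eq_zero_iff _).2 ⟨k, rfl⟩
  let dq : ∀ {W : FirmMod R} (k : L ⟶ W), f ≫ k = 0 → (Q ⟶ W) := fun {W} k hk =>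
    ObjectProperty.homMk
    ⟨QuotientAddGroup.lift _ k.hom.toHom (by
        rintro _ ⟨x, rfl⟩
        exact congr(($hk).hom.toHom x)), fun r q => by
      obtain ⟨l, rfl⟩ := hps q
      exact k.hom.linear r l⟩
  have hdq : ∀ {W : FirmMod R} (k : L ⟶ W) (hk : f ≫ k = 0), p ≫ dq k hk = k :=
    fun k hk => FirmMod.hom_ext fun l => rfl
  let f' : K ⟶ Z := ObjectProperty.homMk (RMod.IsFirm.lift K.property (lk f w))
  have hf' : f' ≫ i = f := hlk f w
  let g' : Q ⟶ N := dq g w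
  have hg' : p ≫ g' = g := hdq g w
  have hTi : Function.Injective (tensorMap (leftAct ι) i.hom) := by
    have h1 : ∀ z, tensorMap (leftAct ι) i.hom z =
        tensorMap (leftAct ι) u (tensorMap (leftAct ι) U.mulR z) := fun z =>
      congr(($((RTensor.functor ι).map_comp U.mulR u)).lin z)
    rw [funext h1]
    exact (hflat.injective u Subtype.val_injective).comp (RMod.tensorMap_mulR_bijective hX U).1
  have hTf : ∀ z, tensorMap (leftAct ι) i.hom (tensorMap (leftAct ι) f'.hom z) =
      tensorMap (leftAct ι) f.hom z := fun z =>
    congr(($(((tensorFunctor ι).map_comp f' i).symm.trans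
      (congrArg (tensorFunctor ι).map hf'))).lin z)
  have hTg : ∀ z, tensorMap (leftAct ι) g'.hom (tensorMap (leftAct ι) p.hom z) =
      tensorMap (leftAct ι) g.hom z := fun z =>
    congr(($(((tensorFunctor ι).map_comp p g').symm.trans
      (congrArg (tensorFunctor ι).map hg'))).lin z)
  have hTw : ∀ z, tensorMap (leftAct ι) g.hom (tensorMap (leftAct ι) i.hom z) = 0 := fun z =>
    congr(($(((tensorFunctor ι).map_comp i g).symm.trans
      (congrArg (tensorFunctor ι).map wi))).lin z).trans (tensorMap_zero z)
  have hTp : ∀ z, tensorMap (leftAct ι) p.hom (tensorMap (leftAct ι) f.hom z) = 0 := fun z =>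
    congr(($(((tensorFunctor ι).map_comp f p).symm.trans
      (congrArg (tensorFunctor ι).map wp))).lin z).trans (tensorMap_zero z)
  have hf'e : Epi f' := (tensorFunctor ι).epi_of_epi_map (Comod.epi_of_surjective _ fun z => by
    obtain ⟨y, hy⟩ := (hfg _).1 (hTw z)
    exact ⟨y, hTi ((hTf y).trans hy)⟩)
  have hTps : Function.Surjective (tensorMap (leftAct ι) p.hom) := fun z => by
    induction z using BalTensor.induction with
    | zero => exact ⟨0, map_zero _⟩
    | pure q x =>
      obtain ⟨l, rfl⟩ := hps q
      exact ⟨BalTensor.tmul _ _ l x, rfl⟩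
    | add x y hx hy =>
      obtain ⟨a, rfl⟩ := hx
      obtain ⟨b, rfl⟩ := hy
      exact ⟨a + b, map_add _ _ _⟩
  have hg'm : Mono g' := (tensorFunctor ι).mono_of_mono_map (Comod.mono_of_injective _ (by
    refine (injective_iff_map_eq_zero (tensorMap (leftAct ι) g'.hom)).2 fun z hz => ?_
    obtain ⟨y, rfl⟩ := hTps z
    rw [hTg] at hz
    obtain ⟨t, rfl⟩ := (hfg y).1 hz
    exact hTp t))
  exact ⟨w, ShortComplex.exact_of_epi_of_mono (ShortComplex.mk f g w)
    (FirmMod.isZero_of_forall_eq_zero (Z := FirmMod.zero R) fun _ => rfl)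
    (Limits.KernelFork.IsLimit.ofι' i wi fun k hk => ⟨_, hlk k hk⟩)
    (Limits.CokernelCofork.IsColimit.ofπ' p wp fun k hk => ⟨_, hdq k hk⟩) hf' hg'⟩

end FaithfullyFlat

/-! ### The properties of the ideal of endomorphisms of finite type, and the theorem. -/

section GaloisProperties

variable {A C : Type u} [Ring A] [AddCommGroup C] [Module A C] [Module Aᵐᵒᵖ C]
  [SMulCommClass A Aᵐᵒᵖ C] [Coring A C] {X : Comod A C}

theorem finIncl_properties (h : HasLocalDualBases A C) (hX : WeaklyLocallyProjective X)
    (hsep : IsSeparator X) :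
    IsFirmLeft (leftAct (finIncl X)) ∧ (tensorFunctor (finIncl X)).IsEquivalence ∧
      Function.Bijective (can (finIncl X)) ∧ IsFaithfullyFlatLeft (leftAct (finIncl X)) := by
  have hR := hasLeftLocalUnits_finEnd h hX hsep
  have hX' := exists_finEnd_apply_eq h hX hsep
  have hfirm := hR.isFirmLeft hX'
  have hF : (tensorFunctor (finIncl X)).Faithful := tensorFunctor_faithful fun N n hn =>
    ract_eq_zero_of_tmulLin_eq_zero h hX hsep hn
  exact ⟨hfirm, tensorFunctor_isEquivalence h hR hfirm
      (counitLin_bijective_of_isSeparator h hsep finIncl_mul_mem_range hX'),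
    can_bijective_of_isSeparator h hsep finIncl_mul_mem_range hX',
    isFaithfullyFlatLeft_of_faithful hR hfirm
      (isFlatLeft_of_isSeparator h hsep finIncl_injective finIncl_mul_mem_range hX')⟩

end GaloisProperties

end Galois

theorem theorem3p2 {A C : Type u} [Ring A] [AddCommGroup C] [Module A C] [Module Aᵐᵒᵖ C]
    [SMulCommClass A Aᵐᵒᵖ C] [Galois.Coring A C]
    (hC : Galois.WeaklyLocallyProjective (ModuleCat.of A C)) (X : Galois.Comod A C) :
    List.TFAE [
      Galois.WeaklyLocallyProjective X ∧ CategoryTheory.IsSeparator X,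
      ∃ (R : Type u) (_ : NonUnitalRing R) (ι : R →ₙ+* X.endRing),
        Galois.HasLeftLocalUnits R ∧
        Galois.IsFirmLeft (Galois.leftAct ι) ∧
        (Galois.tensorFunctor ι).IsEquivalence,
      ∃ (R : Type u) (_ : NonUnitalRing R) (ι : R →ₙ+* X.endRing),
        Galois.HasLeftLocalUnits R ∧
        Galois.WeaklyRLocallyProjective ι ∧
        Function.Bijective (Galois.can ι) ∧
        Galois.IsFaithfullyFlatLeft (Galois.leftAct ι)] ∧
    (Galois.WeaklyLocallyProjective X ∧ CategoryTheory.IsSeparator X →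
      ∃ (R : Type u) (_ : NonUnitalRing R) (ι : R →ₙ+* X.endRing),
        Function.Injective ι ∧
        (∀ (t : X.endRing) (r : R), t * ι r ∈ Set.range ι ∧ ι r * t ∈ Set.range ι) ∧
        Galois.HasLeftLocalUnits R ∧
        Galois.IsFirmLeft (Galois.leftAct ι) ∧
        (Galois.tensorFunctor ι).IsEquivalence ∧
        Galois.WeaklyRLocallyProjective ι ∧
        Function.Bijective (Galois.can ι) ∧
        Galois.IsFaithfullyFlatLeft (Galois.leftAct ι)) := by
  have h := Galois.HasLocalDualBases.of_weaklyLocallyProjective hC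
  have key : ∀ hX : Galois.WeaklyLocallyProjective X ∧ IsSeparator X, _ := fun hX =>
    Galois.finIncl_properties h hX.1 hX.2
  refine ⟨?_, fun hX => ⟨Galois.finEnd X, inferInstance, Galois.finIncl X,
    Galois.finIncl_injective, fun t r => ⟨Galois.finIncl_mul_mem_range t r,
      Galois.finIncl_mul_mem_range' t r⟩, Galois.hasLeftLocalUnits_finEnd h hX.1 hX.2,
    (key hX).1, (key hX).2.1, Galois.weaklyRLocallyProjective_finIncl h hX.1 hX.2,
    (key hX).2.2.1, (key hX).2.2.2⟩⟩
  tfae_have 1 → 2 := fun hX => ⟨Galois.finEnd X, inferInstance, Galois.finIncl X,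
    Galois.hasLeftLocalUnits_finEnd h hX.1 hX.2, (key hX).1, (key hX).2.1⟩
  tfae_have 1 → 3 := fun hX => ⟨Galois.finEnd X, inferInstance, Galois.finIncl X,
    Galois.hasLeftLocalUnits_finEnd h hX.1 hX.2,
    Galois.weaklyRLocallyProjective_finIncl h hX.1 hX.2, (key hX).2.2.1, (key hX).2.2.2⟩
  tfae_have 2 → 1 := fun ⟨_, _, ι, hR, hX, hF⟩ =>
    Galois.weaklyLocallyProjective_and_isSeparator_of_isEquivalence h ι hR hX hF
  tfae_have 3 → 1 := fun ⟨_, _, _, hR, hκ, hcan, hff⟩ =>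
    Galois.weaklyLocallyProjective_and_isSeparator_of_isFaithfullyFlatLeft h hR hκ hcan hff
  tfae_finish
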